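/- Let $G=(V,E)$ be a connected simple graph on $n$ nodes. Every edge $\{u,v\}$ has positive integral costs $w(u,v)$ and $w(v,u)$ for traversing it from $u$ to $v$ and from $v$ to $u$, and every node $v$ has a demand $b_v\in\mathbb{Z}$, with $\sum_v b_v=0$. Orient each edge in its more expensive direction (breaking ties by node identifiers). Let $A\in\mathbb{R}^{V\times E}$ be the node-arc incidence matrix (the column of the arc $(u,v)$ has $-1$ at $u$ and $+1$ at $v$), let $w^+\ge w^-$ be the vectors of forward and backward costs, $W_\pm=\mathrm{diag}(w^\pm)$, $W_*=[W_+\;-W_-]^T$, $R_*=[W_+^{-1}\;-W_-^{-1}]^T$, $p(z)=\sum_i\max\{0,z_i\}$, $q(z)=\max\{0,\max_i z_i\}$, and $\lambda=\max_{e\in E} w^+_e/w^-_e\ge 1$ ($\lambda=1$ if $E=\emptyset$). The asymmetric shortest transshipment problem is the primal-dual pair $$\min\{p(W_*x): Ax=b\}=\max\{b^Ty: q(R_*A^Ty)\le 1\}.$$ In the broadcast congest model, the nodes have unique $O(\log n)$-bit identifiers, and initially each node knows its identifier, its demand, $\epsilon$, the identifiers of its neighbors, and both costs of each incident edge. In each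 synchronous round, every node may perform arbitrary local computations and broadcasts one $O(\log n)$-bit message, which is received exactly by its neighbors in $G$. Identifiers, costs and the absolute values of demands are assumed to be at most $n^c$ for a fixed constant $c$. For every $c$ there is a deterministic algorithm in this model that, for every such instance and every $0<\epsilon\le 1$, computes a $(1+\epsilon)$-approximation of the asymmetric shortest transshipment problem in $\tilde O(\lambda^4\epsilon^{-3}n)$ rounds, that is, in at most $C\,\lambda^4\epsilon^{-3}\,n\,(\lfloor\log_2 n\rfloor+1)^{k}$ rounds, where $C$ and $k$ (and the constant in the message size) depend only on $c$. In particular, if $\lambda=O(\mathrm{polylog}\,n)$, for instance for symmetric costs, this is $\tilde O(\epsilon^{-3}n)$ rounds. Here, a $(1+\epsilon)$-approximation is computed if every node $v$ has decided on a value $z_v$ with $\mathrm{OPT}\le z_v\le(1+\epsilon)\,\mathrm{OPT}$, where $\mathrm{OPT}$ is the optimum, on a potential $y_v$, and on the flow $x_e$ of each incident edge $e$ (the same at both endpoints), such that $Ax=b$, $q(R_*A^Ty)\le1$ and $p(W_*x)\le(1+\epsilon)\,b^Ty$. -/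

import Mathlib

open Finset Matrix

noncomputable section

namespace Transshipment

/-! ### Transshipment instances on a network -/

/-- An instance of the asymmetric transshipment problem: a connected simple graph whose nodes carry
unique identifiers, with a positive integral cost `cost u v` for traversing the edge `{u, v}` from
`u` to `v`, and an integral demand at every node (total demand zero, i.e. the instance is feasible).
Values of `cost` on non-adjacent pairs are irrelevant. -/
structure Network (V : Type) [Fintype V] where
  graph : SimpleGraph V
  connected : graph.Connected
  ident : V → ℕ
  ident_injective : Function.Injective ident
  cost : V → V → ℕ
  cost_pos : ∀ u v, graph.Adj u v → 1 ≤ cost u v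
  demand : V → ℤ
  sum_demand : ∑ v, demand v = 0

variable {V : Type} [Fintype V]

namespace Network

variable (N : Network V)

/-- Identifiers, edge costs and demands are polynomially bounded, with exponent `c`, in the
number of nodes. -/
def PolyBounded (c : ℕ) : Prop :=
  (∀ v, N.ident v ≤ Fintype.card V ^ c) ∧
  (∀ u v, N.graph.Adj u v → N.cost u v ≤ Fintype.card V ^ c) ∧
  (∀ v, |N.demand v| ≤ (Fintype.card V : ℤ) ^ c)

/-- Each edge is oriented in its more expensive direction; ties are broken by identifiers. -/
def IsForward (u v : V) : Prop :=
  N.graph.Adj u v ∧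
    (N.cost v u < N.cost u v ∨ (N.cost v u = N.cost u v ∧ N.ident u < N.ident v))

/-- The edges of the network, each represented by its forward arc `(tail, head)`. -/
abbrev Edge : Type := {a : V × V // N.IsForward a.1 a.2}

def tail (e : N.Edge) : V := e.1.1

def head (e : N.Edge) : V := e.1.2

instance : Fintype N.Edge := Fintype.ofFinite _

/-- Forward weights `w⁺`. -/
def wPlus (e : N.Edge) : ℝ := N.cost (N.tail e) (N.head e)

/-- Backward weights `w⁻`. -/
def wMinus (e : N.Edge) : ℝ := N.cost (N.head e) (N.tail e)

/-- The maximum `λ = ‖W₋⁻¹ w⁺‖_∞` of the cost ratio between the two directions of an edge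
(and `1` if there are no edges). -/
def asymmetry : ℝ := max 1 (⨆ e : N.Edge, N.wPlus e / N.wMinus e)

open Classical in
/-- The node-arc incidence matrix: the column of the arc `(u, v)` has `-1` at `u` and `1` at `v`. -/
def incidence : Matrix V N.Edge ℝ :=
  fun v e => (if v = N.head e then 1 else 0) - (if v = N.tail e then 1 else 0)

open Classical in
/-- `W_* = [W₊ -W₋]ᵀ`. -/
def wStar : Matrix (N.Edge ⊕ N.Edge) N.Edge ℝ :=
  Matrix.fromRows (Matrix.diagonal N.wPlus) (-Matrix.diagonal N.wMinus)

open Classical in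
/-- `R_* = [W₊⁻¹ -W₋⁻¹]ᵀ`. -/
def rStar : Matrix (N.Edge ⊕ N.Edge) N.Edge ℝ :=
  Matrix.fromRows (Matrix.diagonal fun e => (N.wPlus e)⁻¹)
    (-Matrix.diagonal fun e => (N.wMinus e)⁻¹)

end Network

/-- The asymmetric norm `p(x) = ∑ᵢ max {0, xᵢ}`. -/
def pNorm {ι : Type} [Fintype ι] (x : ι → ℝ) : ℝ := ∑ i, max 0 (x i)

/-- The asymmetric norm `q(x) = max {0, maxᵢ xᵢ}` (which is `0` on the empty index set). -/
def qNorm {ι : Type} [Fintype ι] (x : ι → ℝ) : ℝ := ⨆ i, max 0 (x i)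

namespace Network

variable (N : Network V)

/-- Primal feasibility `A x = b`. -/
def PrimalFeasible (x : N.Edge → ℝ) : Prop :=
  N.incidence *ᵥ x = fun v => (N.demand v : ℝ)

/-- Primal objective `p(W_* x)`. -/
def primalCost (x : N.Edge → ℝ) : ℝ := pNorm (N.wStar *ᵥ x)

/-- Dual feasibility `q(R_* Aᵀ y) ≤ 1`. -/
def DualFeasible (y : V → ℝ) : Prop :=
  qNorm (N.rStar *ᵥ (N.incidenceᵀ *ᵥ y)) ≤ 1

/-- Dual objective `bᵀ y`. -/
def dualValue (y : V → ℝ) : ℝ := ∑ v, (N.demand v : ℝ) * y v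

/-- `opt` is the (attained) optimum `min {p(W_* x) : A x = b}`. -/
def IsOptimum (opt : ℝ) : Prop :=
  IsLeast {z | ∃ x, N.PrimalFeasible x ∧ z = N.primalCost x} opt

end Network

/-! ### The broadcast congest model -/

/-- What a node knows initially: its own identifier, its demand, the accuracy `ε`, and for every
incident edge the identifier of the other endpoint together with the cost of traversing the edge
towards that endpoint and the cost of traversing it from that endpoint. In particular
the number of nodes is not known. -/
structure LocalInput where
  ident : ℕ
  demand : ℤ
  accuracy : ℝ
  incident : Finset (ℕ × ℕ × ℕ)

/-- A deterministic algorithm for the broadcast congest model; all nodes run the same one. In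
each synchronous round, a node broadcasts to its neighbors one message (a bit string, possibly
empty) that depends on its state, receives the messages of its neighbors, labeled by
their senders' identifiers, and updates its state by an arbitrary local computation. A node's
output is `none` as long as it has not decided. -/
structure BroadcastAlgorithm (Out : Type) where
  State : Type
  init : LocalInput → State
  message : State → List Bool
  step : State → Finset (ℕ × List Bool) → State
  output : State → Option Out

namespace Network

variable (N : Network V)

open Classical in
/-- The initial knowledge of node `v` if the accuracy is `ε`. -/
def localInput (ε : ℝ) (v : V) : LocalInput where
  ident := N.ident v
  demand := N.demand v
  accuracy := ε
  incident := (univ.filter fun u => N.graph.Adj v u).image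
    fun u => (N.ident u, N.cost v u, N.cost u v)

end Network

namespace BroadcastAlgorithm

variable {Out : Type} (alg : BroadcastAlgorithm Out) (N : Network V) (ε : ℝ)

open Classical in
/-- The state of each node after `t` rounds. -/
def stateAt : ℕ → V → alg.State
  | 0, v => alg.init (N.localInput ε v)
  | t + 1, v => alg.step (stateAt t v)
      ((univ.filter fun u => N.graph.Adj v u).image
        fun u => (N.ident u, alg.message (stateAt t u)))

/-- In the execution on `N`, no node ever broadcasts a message of more than `s` bits. -/
def MessagesBounded (s : ℕ) : Prop :=
  ∀ t v, (alg.message (alg.stateAt N ε t v)).length ≤ s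

/-- In the execution on `N`, each node `v` has decided on the output `out v` after `T` rounds,
and never announces any other output. -/
def ComputesWithin (T : ℕ) (out : V → Out) : Prop :=
  (∀ v t, T ≤ t → alg.output (alg.stateAt N ε t v) = some (out v)) ∧
  (∀ v t o, alg.output (alg.stateAt N ε t v) = some o → o = out v)

end BroadcastAlgorithm

/-- A node's part of the output: an approximation of the optimum value, the node's own potential
(dual variable), and the flow on each incident edge, indexed by the identifier of the
other endpoint and signed with respect to the forward orientation of the edge. -/
structure NodeOutput where
  value : ℝ
  potential : ℝ
  flow : ℕ → ℝ

/-- The outputs of the nodes form a `(1 + ε)`-approximate solution: every node knows the optimum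
up to a factor of `1 + ε`, and the nodes jointly know feasible primal and dual solutions
`x`, `y` with `p(W_* x) ≤ (1 + ε) bᵀ y`, where both endpoints of an edge know its flow. -/
def Network.IsApproximation (N : Network V) (ε : ℝ) (out : V → NodeOutput) : Prop :=
  (∃ opt, N.IsOptimum opt ∧ ∀ v, opt ≤ (out v).value ∧ (out v).value ≤ (1 + ε) * opt) ∧
  ∃ (x : N.Edge → ℝ) (y : V → ℝ),
    (∀ e, (out (N.tail e)).flow (N.ident (N.head e)) = x e ∧
      (out (N.head e)).flow (N.ident (N.tail e)) = x e) ∧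
    (∀ v, (out v).potential = y v) ∧
    N.PrimalFeasible x ∧ N.DualFeasible y ∧ N.primalCost x ≤ (1 + ε) * N.dualValue y

end Transshipment

end

/-!
All communication goes through a shared blackboard: if every node floods one announcement that it
has not forwarded yet per round, in a fixed order, then `k` announcements reach all nodes within
`O(n + k)` rounds. What remains is to solve the problem with few announcements and free local
computation.

Let `γ = Ω(ε / (λ log n))`. For a guess `g` of the optimum, each arc carries a weight that is
exponential in its stretch `(Φ v - Φ u) / w(u, v)` under the current potential `Φ`, and the weights
define a flow of cost at most `g`. After this flow has been rounded, every node announces its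
residual demand. If the residual demands can be routed cheaply on a sparse subgraph, which every
node knows, then the two flows together have cost at most `(1 + ε / 3) g`. Otherwise linear
programming duality yields a potential `φ` on the sparse subgraph whose value on the residual
demands is large compared with its stretch, and adding it to `Φ` increases the logarithm of the
total weight by less than its dual value accounts for. After `O(log n / γ ^ 2)` such steps, `Φ`
can be scaled to a feasible potential of value `g`, and the guess is multiplied by `1 + ε / 3`.

The sparse subgraph is the union of spanners for the classes of edges of roughly equal cost, with
stretch `O(log n)` and `O(n polylog n)` edges. The random sampling of clusters in the construction
of Baswana and Sen is replaced by a greedily chosen hitting set. Rounding the flow is harmless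
unless `n ε < 1`, and in that case the whole network can be announced.
-/

noncomputable section

namespace Transshipment

/-! ### Gossip -/

/-- What a node stores while spreading items: the items it knows and the items it has sent. -/
structure GossipState (α : Type*) where
  known : Finset α
  sent : Finset α

namespace GossipState

variable {α : Type*} [LinearOrder α]

/-- The item that a node sends next: the least known item that it has not sent yet, if any. -/
def next (s : GossipState α) : Option α :=
  if h : (s.known \ s.sent).Nonempty then some ((s.known \ s.sent).min' h) else none

/-- The state after sending the next item and receiving the items in `received`. -/
def advance (s : GossipState α) (received : Finset α) : GossipState α where
  known := s.known ∪ received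
  sent := s.sent ∪ s.next.toFinset

lemma mem_sdiff_of_mem_next {s : GossipState α} {x : α} (hx : x ∈ s.next) :
    x ∈ s.known \ s.sent := by
  unfold next at hx
  split_ifs at hx with h
  · cases hx
    exact min'_mem _ _
  · cases hx

lemma exists_mem_next_le {s : GossipState α} {y : α} (hy : y ∈ s.known \ s.sent) :
    ∃ x ∈ s.next, x ≤ y :=
  ⟨_, dif_pos ⟨y, hy⟩, min'_le _ _ hy⟩

lemma card_sent_le_add_one_le {s : GossipState α} (received : Finset α) {x y : α}
    (hy : y ∈ s.known \ s.sent) (hyx : y ≤ x) :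
    #{z ∈ s.sent | z ≤ x} + 1 ≤ #{z ∈ (s.advance received).sent | z ≤ x} := by
  obtain ⟨z, hz, hzy⟩ := exists_mem_next_le hy
  have hz_unsent : z ∉ {w ∈ s.sent | w ≤ x} := fun h =>
    (mem_sdiff.1 (mem_sdiff_of_mem_next hz)).2 (mem_filter.1 h).1
  rw [← card_insert_of_notMem hz_unsent]
  refine card_le_card fun w hw => ?_
  rcases mem_insert.1 hw with rfl | hw
  · exact mem_filter.2 ⟨mem_union_right _ (Option.mem_toFinset.2 hz), hzy.trans hyx⟩
  · exact mem_filter.2 ⟨mem_union_left _ (mem_filter.1 hw).1, (mem_filter.1 hw).2⟩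

end GossipState

lemma length_le_card_of_subset {V α : Type*} {G : SimpleGraph V} {P : V → Finset α}
    (hne : ∀ v, (P v).Nonempty)
    (hdisj : Pairwise fun u v => Disjoint (P u) (P v)) {u v : V} {p : G.Walk u v} (hp : p.IsPath)
    {S : Finset α} (hS : ∀ k < p.length, P (p.getVert k) ⊆ S) : p.length ≤ #S := by
  choose item hitem using hne
  rw [← card_range p.length]
  refine card_le_card_of_injOn (fun k => item (p.getVert k))
    (fun k hk => hS k (mem_range.1 hk) (hitem _)) fun k hk l hl hkl => ?_
  have hvert : p.getVert k = p.getVert l := by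
    by_contra hne
    refine disjoint_left.1 (hdisj hne) (hitem _) ?_
    rw [show item (p.getVert k) = item (p.getVert l) from hkl]
    exact hitem _
  exact hp.getVert_injOn (mem_range.1 hk).le (mem_range.1 hl).le hvert

section Gossip

variable {V α : Type*} [Fintype V] [LinearOrder α] (G : SimpleGraph V) (P : V → Finset α)

open Classical in
/-- The states after `t` rounds if node `v` initially knows the items in `P v` and in every round
each node sends its next item to its neighbors. -/
def gossip : ℕ → V → GossipState α
  | 0, v => ⟨P v, ∅⟩
  | t + 1, v => (gossip t v).advance
      ((univ.filter fun u => G.Adj v u).biUnion fun u => (gossip t u).next.toFinset)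

variable {G P}

lemma mem_known_gossip_succ {t : ℕ} {v : V} {x : α} :
    x ∈ (gossip G P (t + 1) v).known ↔
      x ∈ (gossip G P t v).known ∨ ∃ u, G.Adj v u ∧ x ∈ (gossip G P t u).next := by
  simp [gossip, GossipState.advance]

lemma mem_sent_gossip_succ {t : ℕ} {v : V} {x : α} :
    x ∈ (gossip G P (t + 1) v).sent ↔ x ∈ (gossip G P t v).sent ∨ x ∈ (gossip G P t v).next := by
  simp [gossip, GossipState.advance]

lemma monotone_known_gossip (v : V) : Monotone fun t => (gossip G P t v).known :=
  monotone_nat_of_le_succ fun _ _ hx => mem_known_gossip_succ.2 (Or.inl hx)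

lemma monotone_sent_gossip (v : V) : Monotone fun t => (gossip G P t v).sent :=
  monotone_nat_of_le_succ fun _ _ hx => mem_sent_gossip_succ.2 (Or.inl hx)

lemma sent_gossip_subset_known_of_adj (t : ℕ) {u v : V} (h : G.Adj v u) :
    (gossip G P t u).sent ⊆ (gossip G P t v).known := by
  induction t with
  | zero => simp [gossip]
  | succ t ih =>
    intro x hx
    rcases mem_sent_gossip_succ.1 hx with hx | hx
    · exact mem_known_gossip_succ.2 (Or.inl (ih hx))
    · exact mem_known_gossip_succ.2 (Or.inr ⟨u, h, hx⟩)

lemma known_gossip_subset (t : ℕ) (v : V) : (gossip G P t v).known ⊆ univ.biUnion P := by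
  induction t generalizing v with
  | zero => exact subset_biUnion_of_mem P (mem_univ v)
  | succ t ih =>
    intro x hx
    rcases mem_known_gossip_succ.1 hx with hx | ⟨u, -, hx⟩
    · exact ih v hx
    · exact ih u (mem_sdiff.1 (GossipState.mem_sdiff_of_mem_next hx)).1

lemma succ_le_card_sent_gossip_succ {t s : ℕ} {v : V} {x : α}
    (hx_unsent : x ∉ (gossip G P t v).sent) (hsent : s ≤ #{z ∈ (gossip G P t v).sent | z ≤ x})
    (hknown : x ∈ (gossip G P t v).known ∨ s + 1 ≤ #{z ∈ (gossip G P t v).known | z ≤ x}) :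
    s + 1 ≤ #{z ∈ (gossip G P (t + 1) v).sent | z ≤ x} := by
  by_cases hs : s + 1 ≤ #{z ∈ (gossip G P t v).sent | z ≤ x}
  · exact hs.trans (card_le_card
      (filter_subset_filter _ (monotone_sent_gossip v (Nat.le_succ t))))
  obtain ⟨y, hy, hyx⟩ : ∃ y ∈ (gossip G P t v).known \ (gossip G P t v).sent, y ≤ x := by
    rcases hknown with hx | hcard
    · exact ⟨x, mem_sdiff.2 ⟨hx, hx_unsent⟩, le_rfl⟩
    · obtain ⟨y, hy, hy'⟩ := exists_mem_notMem_of_card_lt_card ((not_le.1 hs).trans_le hcard)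
      rw [mem_filter] at hy hy'
      exact ⟨y, mem_sdiff.2 ⟨hy.1, fun h => hy' ⟨h, hy.2⟩⟩, hy.2⟩
  exact (Nat.succ_le_succ hsent).trans (GossipState.card_sent_le_add_one_le _ hy hyx)

/-- Pipelining: on its way along a walk, an item is delayed only by smaller items, and each of them
costs at most one round. -/
lemma mem_sent_gossip_or_le_card {x : α} {o v : V} (hx : x ∈ P o) (p : G.Walk v o) (s : ℕ) :
    x ∈ (gossip G P (p.length + s) v).sent ∨
      s ≤ #{z ∈ (gossip G P (p.length + s) v).sent | z ≤ x} := by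
  induction p generalizing s with
  | nil =>
    induction s with
    | zero => exact Or.inr (Nat.zero_le _)
    | succ s ih =>
      refine or_iff_not_imp_left.2 fun hx' => ?_
      have hx_unsent := fun h => hx' (monotone_sent_gossip _ (Nat.le_succ _) h)
      exact succ_le_card_sent_gossip_succ hx_unsent (ih.resolve_left hx_unsent)
        (Or.inl (monotone_known_gossip _ (Nat.zero_le _) hx))
  | @cons v u _ hadj p ih =>
    rw [SimpleGraph.Walk.length_cons]
    induction s with
    | zero => exact Or.inr (Nat.zero_le _)
    | succ s ihs =>
      refine or_iff_not_imp_left.2 fun hx' => ?_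
      have hx_unsent := fun h => hx' (monotone_sent_gossip _ (Nat.le_succ _) h)
      have hsub := sent_gossip_subset_known_of_adj (P := P) (p.length + 1 + s) hadj
      refine succ_le_card_sent_gossip_succ hx_unsent (ihs.resolve_left hx_unsent) ?_
      have hu := ih hx (s + 1)
      rw [show p.length + (s + 1) = p.length + 1 + s by ring] at hu
      exact hu.imp (fun h => hsub h)
        fun h => h.trans (card_le_card (filter_subset_filter _ hsub))

lemma lt_dist_add_card_known_gossip (hG : G.Connected) {x : α} {o v : V} {t : ℕ} (hx : x ∈ P o)
    (hx_unknown : x ∉ (gossip G P t v).known) :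
    t < G.dist v o + #(gossip G P t v).known := by
  obtain ⟨p, hp⟩ := hG.exists_walk_length_eq_dist v o
  rw [← hp]
  cases p with
  | nil => exact absurd (monotone_known_gossip _ (Nat.zero_le t) hx) hx_unknown
  | cons hadj q =>
    have hsub := sent_gossip_subset_known_of_adj (P := P) t hadj
    rw [SimpleGraph.Walk.length_cons]
    rcases le_total t q.length with ht | ht
    · omega
    · have hpipe := mem_sent_gossip_or_le_card hx q (t - q.length)
      rw [Nat.add_sub_cancel' ht] at hpipe
      have hle := hpipe.resolve_left fun h => hx_unknown (hsub h)
      have hle' := hle.trans ((card_filter_le _ _).trans (card_le_card hsub))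
      omega

lemma lt_two_mul_card_known_gossip (hG : G.Connected) (hne : ∀ v, (P v).Nonempty)
    (hdisj : Pairwise fun u v => Disjoint (P u) (P v)) {t : ℕ} {v : V}
    (h : (gossip G P t v).known ≠ univ.biUnion P) : t < 2 * #(gossip G P t v).known := by
  classical
  obtain ⟨o, ho, hmin⟩ := exists_min_image {o | ¬ P o ⊆ (gossip G P t v).known} (G.dist v) <| by
    by_contra hempty
    refine h ((known_gossip_subset t v).antisymm (biUnion_subset.2 fun o _ => ?_))
    by_contra ho
    exact hempty ⟨o, by simpa using ho⟩
  obtain ⟨x, hx, hx_unknown⟩ := not_subset.1 (mem_filter.1 ho).2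
  obtain ⟨p, hp, hp_length⟩ := hG.exists_path_of_dist v o
  have hcloser : ∀ k < p.length, P (p.getVert k) ⊆ (gossip G P t v).known := by
    intro k hk
    by_contra hmissing
    have hdist : G.dist v (p.getVert k) ≤ k :=
      (SimpleGraph.dist_le (p.take k)).trans (by simp)
    have := hmin _ (by simpa using hmissing)
    omega
  have hdist_le := length_le_card_of_subset hne hdisj hp hcloser
  have := lt_dist_add_card_known_gossip hG hx hx_unknown
  omega

lemma two_mul_card_known_gossip_le_iff (hG : G.Connected) (hne : ∀ v, (P v).Nonempty)
    (hdisj : Pairwise fun u v => Disjoint (P u) (P v)) (t : ℕ) (v : V) :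
    2 * #(gossip G P t v).known ≤ t ↔ 2 * #(univ.biUnion P) ≤ t := by
  refine ⟨fun h => ?_, fun h => ?_⟩
  · by_cases hall : (gossip G P t v).known = univ.biUnion P
    · rwa [hall] at h
    · exact absurd h (lt_two_mul_card_known_gossip hG hne hdisj hall).not_ge
  · exact (Nat.mul_le_mul_left 2 (card_le_card (known_gossip_subset t v))).trans h

lemma known_gossip_eq (hG : G.Connected) (hne : ∀ v, (P v).Nonempty)
    (hdisj : Pairwise fun u v => Disjoint (P u) (P v)) {t : ℕ} (v : V)
    (h : 2 * #(univ.biUnion P) ≤ t) :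
    (gossip G P t v).known = univ.biUnion P := by
  by_contra hmissing
  exact (lt_two_mul_card_known_gossip hG hne hdisj hmissing).not_ge
    ((two_mul_card_known_gossip_le_iff hG hne hdisj t v).2 h)

end Gossip

/-! ### Blackboard programs -/

/-- A program for a blackboard shared by all nodes. In each phase, every node posts a finite set of
numbers that depends on its initial knowledge, and the continuation depends on the board,
which consists of the posted numbers tagged with the identifiers of the nodes (see `tagged`). -/
inductive BoardProgram (α : Type) : Type
  | pure : α → BoardProgram α
  | ask : (LocalInput → Finset ℕ) → (Finset ℕ → BoardProgram α) → BoardProgram α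

namespace BoardProgram

variable {α α' : Type}

/-- Sequential composition: the second program may depend on the result of the first. -/
def bind : BoardProgram α → (α → BoardProgram α') → BoardProgram α'
  | pure a, f => f a
  | ask post next, f => ask post fun board => bind (next board) f

/-- The program that runs `step 0`, …, `step (n - 1)` one after the other, each on the result of the
previous one. -/
def iter (step : ℕ → α → BoardProgram α) : ℕ → α → BoardProgram α
  | 0, a => pure a
  | n + 1, a => (iter step n a).bind (step n)

end BoardProgram

/-- The items that the node with identifier `i` contributes to the board when it posts `S`. The item
`Nat.pair i 0` announces the node itself, even if it posts nothing. -/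
def tagged (i : ℕ) (S : Finset ℕ) : Finset ℕ :=
  insert (Nat.pair i 0) (S.image fun a => Nat.pair i (a + 1))

/-- The numbers posted by the node with identifier `i`. -/
def postedBy (board : Finset ℕ) (i : ℕ) : Finset ℕ :=
  (board.image fun x => x.unpair.2 - 1).filter fun a => Nat.pair i (a + 1) ∈ board

/-- The number posted by the node with identifier `i`, provided that it posts exactly one: the
supremum extracts the element of a singleton. -/
def postedNumber (board : Finset ℕ) (i : ℕ) : ℕ := (postedBy board i).sup id

/-- The identifiers of the nodes that contributed to the board. -/
def senders (board : Finset ℕ) : Finset ℕ := board.image fun x => x.unpair.1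

lemma mem_postedBy {board : Finset ℕ} {i a : ℕ} :
    a ∈ postedBy board i ↔ Nat.pair i (a + 1) ∈ board := by
  simp only [postedBy, mem_filter, mem_image, and_iff_right_iff_imp]
  exact fun h => ⟨_, h, by simp⟩

lemma mem_tagged {i x : ℕ} {S : Finset ℕ} :
    x ∈ tagged i S ↔ x = Nat.pair i 0 ∨ ∃ a ∈ S, Nat.pair i (a + 1) = x := by
  simp [tagged]

lemma tagged_nonempty (i : ℕ) (S : Finset ℕ) : (tagged i S).Nonempty := insert_nonempty _ _

lemma unpair_fst_of_mem_tagged {i x : ℕ} {S : Finset ℕ} (h : x ∈ tagged i S) :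
    x.unpair.1 = i := by
  rcases mem_tagged.1 h with rfl | ⟨a, -, rfl⟩ <;> simp

lemma disjoint_tagged {i j : ℕ} (hij : i ≠ j) (S S' : Finset ℕ) :
    Disjoint (tagged i S) (tagged j S') :=
  disjoint_left.2 fun _ hi hj =>
    hij ((unpair_fst_of_mem_tagged hi).symm.trans (unpair_fst_of_mem_tagged hj))

lemma card_tagged_le (i : ℕ) (S : Finset ℕ) : #(tagged i S) ≤ #S + 1 :=
  (card_insert_le _ _).trans (Nat.succ_le_succ card_image_le)

lemma pair_add_one_lt {i j β : ℕ} (hi : i < 2 ^ β) (hj : j < 2 ^ β) :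
    Nat.pair i j + 1 < 2 ^ (2 * β + 1) := by
  have hpair : Nat.pair i j + 1 ≤ (max i j + 1) ^ 2 := Nat.pair_lt_max_add_one_sq i j
  have hsq : (max i j + 1) ^ 2 ≤ (2 ^ β) ^ 2 := Nat.pow_le_pow_left (by omega) 2
  calc Nat.pair i j + 1 ≤ (2 ^ β) ^ 2 := hpair.trans hsq
    _ < 2 ^ (2 * β + 1) := by rw [← pow_mul']; exact Nat.pow_lt_pow_right one_lt_two (by omega)

lemma add_one_lt_of_mem_tagged {i x β : ℕ} {S : Finset ℕ} (hi : i < 2 ^ β)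
    (hS : ∀ a ∈ S, a + 1 < 2 ^ β) (hx : x ∈ tagged i S) : x + 1 < 2 ^ (2 * β + 1) := by
  rcases mem_tagged.1 hx with rfl | ⟨a, ha, rfl⟩
  · exact pair_add_one_lt hi (by positivity)
  · exact pair_add_one_lt hi (hS a ha)

namespace Network

variable {V : Type} [Fintype V] (N : Network V) (ε : ℝ)

/-- The items contributed to the board by node `v` if each node posts `post` of its initial
knowledge. -/
def items (post : LocalInput → Finset ℕ) (v : V) : Finset ℕ :=
  tagged (N.ident v) (post (N.localInput ε v))

/-- The board that results if each node posts `post` of its initial knowledge. -/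
def board (post : LocalInput → Finset ℕ) : Finset ℕ := univ.biUnion (N.items ε post)

variable {N ε}

lemma postedBy_board (post : LocalInput → Finset ℕ) (v : V) :
    postedBy (N.board ε post) (N.ident v) = post (N.localInput ε v) := by
  ext a
  simp only [mem_postedBy, board, items, mem_biUnion, mem_univ, true_and, mem_tagged,
    Nat.pair_eq_pair]
  constructor
  · rintro ⟨u, ⟨-, h⟩ | ⟨a', ha', hu, h⟩⟩
    · omega
    · obtain rfl := N.ident_injective hu
      rwa [← Nat.succ_injective h]
  · exact fun h => ⟨v, Or.inr ⟨a, h, rfl, rfl⟩⟩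

lemma postedNumber_board {post : LocalInput → Finset ℕ} {v : V} {a : ℕ}
    (h : post (N.localInput ε v) = {a}) : postedNumber (N.board ε post) (N.ident v) = a := by
  rw [postedNumber, postedBy_board, h, sup_singleton, id]

lemma senders_board (post : LocalInput → Finset ℕ) :
    senders (N.board ε post) = univ.image N.ident := by
  ext i
  simp only [senders, board, mem_image, mem_biUnion, mem_univ, true_and]
  constructor
  · rintro ⟨x, ⟨v, hv⟩, rfl⟩
    exact ⟨v, (unpair_fst_of_mem_tagged hv).symm⟩
  · rintro ⟨v, rfl⟩
    exact ⟨Nat.pair (N.ident v) 0, ⟨v, mem_insert_self _ _⟩, by simp⟩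

lemma card_board_le (post : LocalInput → Finset ℕ) {m : ℕ}
    (h : ∀ v, #(post (N.localInput ε v)) ≤ m) :
    #(N.board ε post) ≤ Fintype.card V * (m + 1) :=
  card_biUnion_le_card_mul _ _ _ fun v _ =>
    (card_tagged_le _ _).trans (Nat.succ_le_succ (h v))

lemma card_board_pos (post : LocalInput → Finset ℕ) : 0 < #(N.board ε post) := by
  obtain ⟨v⟩ := N.connected.nonempty
  exact card_pos.2 ((tagged_nonempty _ _).mono (subset_biUnion_of_mem _ (mem_univ v)))

end Network

namespace BoardProgram

variable {V : Type} [Fintype V] {α α' : Type}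

/-- Running the program takes at most `T` rounds (`2 k` for a board of `k` items, the time needed to
gossip them and to notice that this is done), each posted number `a` satisfies
`a + 1 < 2 ^ β`, and the result has the property `Q`. -/
def Meets (N : Network V) (ε : ℝ) (β : ℕ) : BoardProgram α → ℕ → (α → Prop) → Prop
  | pure a, _, Q => Q a
  | ask post next, T, Q => (∀ v, ∀ a ∈ post (N.localInput ε v), a + 1 < 2 ^ β) ∧
      ∃ T', 2 * #(N.board ε post) + T' ≤ T ∧ Meets N ε β (next (N.board ε post)) T' Q

variable {N : Network V} {ε : ℝ} {β : ℕ}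

lemma Meets.mono {p : BoardProgram α} {T T' : ℕ} {Q Q' : α → Prop} (h : p.Meets N ε β T Q)
    (hT : T ≤ T') (hQ : ∀ a, Q a → Q' a) : p.Meets N ε β T' Q' := by
  induction p generalizing T T' with
  | pure a => exact hQ a h
  | ask post next ih =>
    obtain ⟨hpost, T₁, hT₁, hnext⟩ := h
    exact ⟨hpost, T₁, hT₁.trans hT, ih _ hnext le_rfl⟩

lemma Meets.bind {p : BoardProgram α} {f : α → BoardProgram α'} {T T' : ℕ} {Q : α → Prop}
    {Q' : α' → Prop} (h : p.Meets N ε β T Q) (hf : ∀ a, Q a → (f a).Meets N ε β T' Q') :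
    (p.bind f).Meets N ε β (T + T') Q' := by
  induction p generalizing T with
  | pure a => exact (hf a h).mono (Nat.le_add_left _ _) fun _ => id
  | ask post next ih =>
    obtain ⟨hpost, T₁, hT₁, hnext⟩ := h
    exact ⟨hpost, T₁ + T', by omega, ih _ hnext⟩

lemma meets_ask {post : LocalInput → Finset ℕ} {next : Finset ℕ → BoardProgram α} {m T : ℕ}
    {Q : α → Prop} (hbits : ∀ v, ∀ a ∈ post (N.localInput ε v), a + 1 < 2 ^ β)
    (hcard : ∀ v, #(post (N.localInput ε v)) ≤ m)
    (hnext : (next (N.board ε post)).Meets N ε β T Q) :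
    (ask post next).Meets N ε β (2 * (Fintype.card V * (m + 1)) + T) Q :=
  ⟨hbits, T, by have := Network.card_board_le post hcard; omega, hnext⟩

lemma meets_iter {step : ℕ → α → BoardProgram α} {T n : ℕ} (I : ℕ → α → Prop) {a : α}
    (hzero : I 0 a) (hstep : ∀ i < n, ∀ a, I i a → (step i a).Meets N ε β T (I (i + 1))) :
    (iter step n a).Meets N ε β (n * T) (I n) := by
  induction n with
  | zero => exact hzero
  | succ n ih =>
    rw [Nat.succ_mul]
    exact (ih fun i hi => hstep i (by omega)).bind (hstep n (by omega))

end BoardProgram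

/-! ### Running a blackboard program in the broadcast congest model -/

lemma natBits_injective : Function.Injective Nat.bits := fun m n h =>
  Nat.digits.injective 2 (by rw [Nat.digits_two_eq_bits, Nat.digits_two_eq_bits, h])

/-- The message that sends an item; the empty message sends nothing. -/
def encodeItem (o : Option ℕ) : List Bool := (o.elim 0 Nat.succ).bits

/-- The left inverse of `encodeItem`. -/
def decodeItem : List Bool → Option ℕ := Function.invFun encodeItem

lemma encodeItem_injective : Function.Injective encodeItem := by
  refine natBits_injective.comp fun o o' h => ?_
  cases o <;> cases o' <;> simp_all

lemma decodeItem_encodeItem (o : Option ℕ) : decodeItem (encodeItem o) = o :=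
  Function.leftInverse_invFun encodeItem_injective o

lemma length_encodeItem_le {o : Option ℕ} {s : ℕ} (h : ∀ x ∈ o, x + 1 < 2 ^ s) :
    (encodeItem o).length ≤ s := by
  rw [encodeItem, Nat.size_eq_bits_len, Nat.size_le]
  cases o with
  | none => exact Nat.two_pow_pos s
  | some x => exact h x rfl

/-- The state of a node that runs a blackboard program: its initial knowledge, the rest of the
program, the number of rounds since the current phase began, and the gossip state of this
phase. -/
structure NodeState (Out : Type) where
  input : LocalInput
  program : BoardProgram (LocalInput → Out)
  clock : ℕ
  items : GossipState ℕ

namespace NodeState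

variable {Out : Type}

/-- The state at the beginning of a phase. -/
def enter (inp : LocalInput) : BoardProgram (LocalInput → Out) → NodeState Out
  | .pure a => ⟨inp, .pure a, 0, ⟨∅, ∅⟩⟩
  | .ask post next => ⟨inp, .ask post next, 0, ⟨tagged inp.ident (post inp), ∅⟩⟩

/-- One round: the node gossips, and enters the next phase once it can tell that it knows the whole
board. -/
def step (s : NodeState Out) (received : Finset (ℕ × List Bool)) : NodeState Out :=
  match s.program with
  | .pure _ => s
  | .ask _ next =>
    let items := s.items.advance (received.biUnion fun m => (decodeItem m.2).toFinset)
    if 2 * #items.known ≤ s.clock + 1 then enter s.input (next items.known)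
    else ⟨s.input, s.program, s.clock + 1, items⟩

/-- The result of the program, applied to the initial knowledge of the node. -/
def output (s : NodeState Out) : Option Out :=
  match s.program with
  | .pure a => some (a s.input)
  | .ask _ _ => none

end NodeState

/-- The broadcast congest algorithm that runs a blackboard program, given the accuracy. -/
def compile {Out : Type} (p : ℝ → BoardProgram (LocalInput → Out)) : BroadcastAlgorithm Out where
  State := NodeState Out
  init inp := NodeState.enter inp (p inp.accuracy)
  message s := encodeItem s.items.next
  step := NodeState.step
  output := NodeState.output

/-- From round `t₀` on, messages have at most `s` bits, no node announces anything but `out`, and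
all nodes have announced it after `T` further rounds. -/
structure BroadcastAlgorithm.ComputesFrom {V Out : Type} [Fintype V]
    (alg : BroadcastAlgorithm Out) (N : Network V) (ε : ℝ) (t₀ T s : ℕ) (out : V → Out) : Prop where
  output_eq_some : ∀ v t, t₀ + T ≤ t → alg.output (alg.stateAt N ε t v) = some (out v)
  eq_of_output : ∀ v t o, t₀ ≤ t → alg.output (alg.stateAt N ε t v) = some o → o = out v
  length_message_le : ∀ t v, t₀ ≤ t → (alg.message (alg.stateAt N ε t v)).length ≤ s

lemma BroadcastAlgorithm.ComputesFrom.of_silent {V Out : Type} [Fintype V]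
    {alg : BroadcastAlgorithm Out} {N : Network V} {ε : ℝ} {t₀ t₁ T T' s : ℕ} {out : V → Out}
    (h : alg.ComputesFrom N ε t₁ T' s out) (hT : t₁ + T' ≤ t₀ + T)
    (houtput : ∀ t v, t₀ ≤ t → t < t₁ → alg.output (alg.stateAt N ε t v) = none)
    (hmessage : ∀ t v, t₀ ≤ t → t < t₁ → (alg.message (alg.stateAt N ε t v)).length ≤ s) :
    alg.ComputesFrom N ε t₀ T s out where
  output_eq_some v t ht := h.output_eq_some v t (hT.trans ht)
  eq_of_output v t o ht ho := by
    rcases lt_or_ge t t₁ with ht₁ | ht₁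
    · rw [houtput t v ht ht₁] at ho
      cases ho
    · exact h.eq_of_output v t o ht₁ ho
  length_message_le t v ht :=
    (lt_or_ge t t₁).elim (hmessage t v ht) (h.length_message_le t v)

section Simulation

variable {V : Type} [Fintype V] {N : Network V} {ε : ℝ} {Out : Type}
  {p : ℝ → BoardProgram (LocalInput → Out)} {post : LocalInput → Finset ℕ}
  {next : Finset ℕ → BoardProgram (LocalInput → Out)} {t₀ : ℕ}

variable (N ε post next) in
/-- The state of node `v` after the first `t` rounds of a phase. -/
def phaseState (t : ℕ) (v : V) : NodeState Out :=
  ⟨N.localInput ε v, .ask post next, t, gossip N.graph (N.items ε post) t v⟩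

lemma items_nonempty (v : V) : (N.items ε post v).Nonempty := tagged_nonempty _ _

lemma pairwise_disjoint_items :
    Pairwise fun u v => Disjoint (N.items ε post u) (N.items ε post v) :=
  fun _ _ huv => disjoint_tagged (N.ident_injective.ne huv) _ _

lemma stateAt_compile_add_one {t k : ℕ}
    (h : ∀ v, (compile p).stateAt N ε t v = phaseState N ε post next k v) (v : V) :
    (compile p).stateAt N ε (t + 1) v =
      if 2 * #(N.board ε post) ≤ k + 1 then
        NodeState.enter (N.localInput ε v) (next (N.board ε post))
      else phaseState N ε post next (k + 1) v := by
  classical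
  have hgossip : (gossip N.graph (N.items ε post) k v).advance
        (((univ.filter fun u => N.graph.Adj v u).image fun u => (N.ident u,
          encodeItem (gossip N.graph (N.items ε post) k u).next)).biUnion
          fun m => (decodeItem m.2).toFinset) =
      gossip N.graph (N.items ε post) (k + 1) v := by
    simp only [gossip, image_biUnion, decodeItem_encodeItem]
  have hcard : 2 * #(gossip N.graph (N.items ε post) (k + 1) v).known ≤ k + 1 ↔
      2 * #(N.board ε post) ≤ k + 1 :=
    two_mul_card_known_gossip_le_iff N.connected items_nonempty pairwise_disjoint_items _ v
  have hknown : 2 * #(N.board ε post) ≤ k + 1 →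
      (gossip N.graph (N.items ε post) (k + 1) v).known = N.board ε post :=
    known_gossip_eq N.connected items_nonempty pairwise_disjoint_items v
  simp only [BroadcastAlgorithm.stateAt, h]
  simp only [compile, NodeState.step, phaseState]
  simp only [hgossip, hcard]
  exact if_ctx_congr Iff.rfl (fun hdone => by rw [hknown hdone]) fun _ => rfl

lemma stateAt_compile_add
    (h : ∀ v, (compile p).stateAt N ε t₀ v = NodeState.enter (N.localInput ε v) (.ask post next))
    {k : ℕ} (hk : k < 2 * #(N.board ε post)) (v : V) :
    (compile p).stateAt N ε (t₀ + k) v = phaseState N ε post next k v := by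
  induction k generalizing v with
  | zero => exact h v
  | succ k ih => rw [← add_assoc, stateAt_compile_add_one (ih (by omega)), if_neg (by omega)]

lemma stateAt_compile_add_two_mul_card_board
    (h : ∀ v, (compile p).stateAt N ε t₀ v = NodeState.enter (N.localInput ε v) (.ask post next))
    (v : V) :
    (compile p).stateAt N ε (t₀ + 2 * #(N.board ε post)) v =
      NodeState.enter (N.localInput ε v) (next (N.board ε post)) := by
  have hpos := Network.card_board_pos (N := N) (ε := ε) post
  obtain ⟨k, hk⟩ : ∃ k, 2 * #(N.board ε post) = k + 1 := Nat.exists_eq_succ_of_ne_zero (by omega)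
  rw [hk, ← add_assoc, stateAt_compile_add_one (stateAt_compile_add h (by omega)), if_pos hk.le]

lemma stateAt_compile_of_pure {a : LocalInput → Out}
    (h : ∀ v, (compile p).stateAt N ε t₀ v = NodeState.enter (N.localInput ε v) (.pure a))
    {t : ℕ} (ht : t₀ ≤ t) (v : V) :
    (compile p).stateAt N ε t v = NodeState.enter (N.localInput ε v) (.pure a) := by
  induction t, ht using Nat.le_induction generalizing v with
  | base => exact h v
  | succ t _ ih =>
    rw [BroadcastAlgorithm.stateAt, ih v]
    rfl

lemma length_message_phaseState_le {β : ℕ} (hid : ∀ v, N.ident v < 2 ^ β)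
    (hpost : ∀ v, ∀ a ∈ post (N.localInput ε v), a + 1 < 2 ^ β) (k : ℕ) (v : V) :
    ((compile p).message (phaseState N ε post next k v)).length ≤ 2 * β + 1 := by
  refine length_encodeItem_le fun x hx => ?_
  have hx_known := (mem_sdiff.1 (GossipState.mem_sdiff_of_mem_next hx)).1
  obtain ⟨u, -, hu⟩ := mem_biUnion.1 (known_gossip_subset k v hx_known)
  exact add_one_lt_of_mem_tagged (hid u) (hpost u) hu

lemma computesFrom_compile {β : ℕ} (hid : ∀ v, N.ident v < 2 ^ β)
    {q : BoardProgram (LocalInput → Out)} {T : ℕ} {Q : (LocalInput → Out) → Prop}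
    (h : ∀ v, (compile p).stateAt N ε t₀ v = NodeState.enter (N.localInput ε v) q)
    (hq : q.Meets N ε β T Q) :
    ∃ a, Q a ∧
      (compile p).ComputesFrom N ε t₀ T (2 * β + 1) fun v => a (N.localInput ε v) := by
  induction q generalizing T t₀ with
  | pure a =>
    refine ⟨a, hq, fun v t ht => ?_, fun v t o ht ho => ?_, fun t v ht => ?_⟩
    · rw [stateAt_compile_of_pure h (by omega)]
      rfl
    · rw [stateAt_compile_of_pure h ht] at ho
      exact (Option.some.inj ho).symm
    · rw [stateAt_compile_of_pure h ht]
      simp [compile, NodeState.enter, GossipState.next, encodeItem]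
  | ask post next ih =>
    obtain ⟨hpost, T', hT, hnext⟩ := hq
    have hphase : ∀ t v, t₀ ≤ t → t < t₀ + 2 * #(N.board ε post) →
        (compile p).stateAt N ε t v = phaseState N ε post next (t - t₀) v := by
      intro t v ht ht'
      have hstate := stateAt_compile_add h (k := t - t₀) (by omega) v
      rwa [Nat.add_sub_cancel' ht] at hstate
    obtain ⟨a, ha, hrun⟩ := ih _ (stateAt_compile_add_two_mul_card_board h) hnext
    refine ⟨a, ha, hrun.of_silent (by omega) (fun t v ht ht' => ?_) fun t v ht ht' => ?_⟩
    · rw [hphase t v ht ht']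
      rfl
    · rw [hphase t v ht ht']
      exact length_message_phaseState_le hid hpost _ v

theorem compile_spec {β : ℕ} (hid : ∀ v, N.ident v < 2 ^ β) {T : ℕ}
    {Q : (LocalInput → Out) → Prop} (hq : (p ε).Meets N ε β T Q) :
    (compile p).MessagesBounded N ε (2 * β + 1) ∧
      ∃ a, Q a ∧ (compile p).ComputesWithin N ε T fun v => a (N.localInput ε v) := by
  obtain ⟨a, ha, hrun⟩ := computesFrom_compile (p := p) (t₀ := 0) hid (fun v => rfl) hq
  exact ⟨fun t v => hrun.length_message_le t v (Nat.zero_le t), a, ha,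
    fun v t ht => hrun.output_eq_some v t (by omega),
    fun v t o => hrun.eq_of_output v t o (Nat.zero_le t)⟩

end Simulation

/-! ### Flows and potentials -/

section Flow

variable {ι : Type} [Fintype ι]

/-- The net flow into each node, for a flow given on ordered pairs of nodes. -/
def netFlow : (ι → ι → ℝ) →ₗ[ℝ] ι → ℝ where
  toFun f v := ∑ u, f u v - ∑ u, f v u
  map_add' f g := by
    ext v
    simp only [Pi.add_apply, sum_add_distrib]
    ring
  map_smul' a f := by
    ext v
    simp only [Pi.smul_apply, smul_eq_mul, mul_sub, mul_sum, RingHom.id_apply]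

lemma netFlow_apply (f : ι → ι → ℝ) (v : ι) : netFlow f v = ∑ u, f u v - ∑ u, f v u := rfl

lemma sum_mul_netFlow (f : ι → ι → ℝ) (φ : ι → ℝ) :
    ∑ v, φ v * netFlow f v = ∑ u, ∑ v, f u v * (φ v - φ u) := by
  simp only [netFlow_apply, mul_sub, sum_sub_distrib, mul_sum]
  rw [sum_comm]
  congr 1 <;> exact sum_congr rfl fun u _ => sum_congr rfl fun v _ => mul_comm _ _

/-- The nonnegative flows on the arcs in `R` whose total cost with respect to `c` is at
most `τ`. -/
def cheapFlows (R : ι → ι → Prop) (c : ι → ι → ℝ) (τ : ℝ) : Set (ι → ι → ℝ) :=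
  {f | (∀ u v, 0 ≤ f u v) ∧ (∀ u v, ¬R u v → f u v = 0) ∧ ∑ u, ∑ v, c u v * f u v ≤ τ}

variable {R : ι → ι → Prop} {c : ι → ι → ℝ} {τ : ℝ}

lemma convex_cheapFlows : Convex ℝ (cheapFlows R c τ) := by
  rintro f ⟨hf, hfR, hfc⟩ g ⟨hg, hgR, hgc⟩ a b ha hb hab
  refine ⟨fun u v => ?_, fun u v h => ?_, ?_⟩
  · exact add_nonneg (mul_nonneg ha (hf u v)) (mul_nonneg hb (hg u v))
  · simp [hfR u v h, hgR u v h]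
  · calc ∑ u, ∑ v, c u v * (a • f + b • g) u v
        = a * ∑ u, ∑ v, c u v * f u v + b * ∑ u, ∑ v, c u v * g u v := by
          simp only [Pi.add_apply, Pi.smul_apply, smul_eq_mul, mul_sum, ← sum_add_distrib]
          exact sum_congr rfl fun u _ => sum_congr rfl fun v _ => by ring
      _ ≤ a * τ + b * τ := by gcongr
      _ = τ := by rw [← add_mul, hab, one_mul]

lemma le_div_of_mem_cheapFlows (hc : ∀ u v, R u v → 0 < c u v) {f : ι → ι → ℝ}
    (hf : f ∈ cheapFlows R c τ) {u v : ι} (h : R u v) : f u v ≤ τ / c u v := by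
  have hterm : ∀ a b, 0 ≤ c a b * f a b := fun a b => by
    by_cases hab : R a b
    · exact mul_nonneg (hc a b hab).le (hf.1 a b)
    · rw [hf.2.1 a b hab, mul_zero]
  rw [le_div_iff₀' (hc u v h)]
  calc c u v * f u v ≤ ∑ b, c u b * f u b :=
        single_le_sum (f := fun b => c u b * f u b) (fun b _ => hterm u b) (mem_univ v)
    _ ≤ ∑ a, ∑ b, c a b * f a b :=
        single_le_sum (f := fun a => ∑ b, c a b * f a b)
          (fun a _ => sum_nonneg fun b _ => hterm a b) (mem_univ u)
    _ ≤ τ := hf.2.2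

lemma isCompact_cheapFlows (hc : ∀ u v, R u v → 0 < c u v) : IsCompact (cheapFlows R c τ) := by
  refine (isCompact_Icc (a := 0) (b := fun u v => |τ / c u v|)).of_isClosed_subset ?_ ?_
  · simp only [cheapFlows, Set.ofPred_and, Set.ofPred_forall]
    refine IsClosed.inter ?_ (IsClosed.inter ?_ ?_)
    · exact isClosed_iInter fun u => isClosed_iInter fun v =>
        isClosed_le continuous_const (by fun_prop)
    · exact isClosed_iInter fun u => isClosed_iInter fun v => isClosed_iInter fun _ =>
        isClosed_eq (by fun_prop) continuous_const
    · exact isClosed_le (by fun_prop) continuous_const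
  · refine fun f hf => ⟨hf.1, fun u v => ?_⟩
    by_cases h : R u v
    · exact (le_div_of_mem_cheapFlows hc hf h).trans (le_abs_self _)
    · rw [hf.2.1 u v h]
      exact abs_nonneg _

open Classical in
lemma single_mem_cheapFlows (hc : ∀ u v, R u v → 0 < c u v) (hτ : 0 ≤ τ) {u v : ι} (h : R u v) :
    Pi.single u (Pi.single v (τ / c u v)) ∈ cheapFlows R c τ := by
  refine ⟨fun a b => ?_, fun a b hab => ?_, ?_⟩
  · have : (0 : ι → ι → ℝ) ≤ Pi.single u (Pi.single v (τ / c u v)) :=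
      Pi.single_nonneg.2 (Pi.single_nonneg.2 (div_nonneg hτ (hc u v h).le))
    exact this a b
  · rcases eq_or_ne a u with rfl | ha
    · rw [Pi.single_eq_same, Pi.single_eq_of_ne]
      rintro rfl
      exact hab h
    · rw [Pi.single_eq_of_ne ha, Pi.zero_apply]
  · rw [Fintype.sum_eq_single u, Fintype.sum_eq_single v]
    · simp only [Pi.single_eq_same]
      rw [mul_div_cancel₀ _ (hc u v h).ne']
    · exact fun b hb => by simp [hb]
    · exact fun a ha => by simp [ha]

/-- A functional that strictly separates `r` from the net flows of cheap flows is, after scaling,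
a potential. -/
lemma exists_potential_of_notMem (hc : ∀ u v, R u v → 0 < c u v) (hτ : 0 < τ) {r : ι → ℝ}
    (hr : r ∉ netFlow '' cheapFlows R c τ) :
    ∃ φ : ι → ℝ, (∀ u v, R u v → φ v - φ u ≤ c u v) ∧ τ < ∑ v, r v * φ v := by
  classical
  obtain ⟨ψ, s, hs, hsr⟩ := geometric_hahn_banach_closed_point
    (convex_cheapFlows.linear_image netFlow)
    ((isCompact_cheapFlows hc).image netFlow.continuous_of_finiteDimensional).isClosed hr
  let φ : ι → ℝ := fun v => ψ (Pi.single v 1)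
  have hψ : ∀ z : ι → ℝ, ψ z = ∑ v, φ v * z v := fun z => by
    conv_lhs => rw [pi_eq_sum_univ' z]
    rw [map_sum]
    exact sum_congr rfl fun v _ => by rw [map_smul, smul_eq_mul, mul_comm]
  have hs_pos : 0 < s := by
    simpa using hs _ ⟨0, ⟨by simp, by simp, by simpa using hτ.le⟩, map_zero _⟩
  refine ⟨fun v => τ / s * φ v, fun u v huv => ?_, ?_⟩
  · have hsingle : τ / c u v * (φ v - φ u) < s := by
      convert hs _ ⟨_, single_mem_cheapFlows hc hτ.le huv, rfl⟩
      rw [hψ, sum_mul_netFlow, Fintype.sum_eq_single u, Fintype.sum_eq_single v]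
      · simp only [Pi.single_eq_same]
      · exact fun b hb => by simp [hb]
      · exact fun a ha => by simp [ha]
    rw [div_mul_eq_mul_div, div_lt_iff₀ (hc u v huv)] at hsingle
    rw [← mul_sub, div_mul_eq_mul_div, div_le_iff₀' hs_pos]
    exact hsingle.le
  · calc τ < τ / s * ψ r := by
          rw [div_mul_eq_mul_div, lt_div_iff₀ hs_pos]
          exact mul_lt_mul_of_pos_left hsr hτ
      _ = ∑ v, r v * (τ / s * φ v) := by
          rw [hψ, mul_sum]
          exact sum_congr rfl fun v _ => by ring

theorem exists_flow_or_potential (hc : ∀ u v, R u v → 0 < c u v) (r : ι → ℝ) (hτ : 0 < τ) :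
    (∃ f ∈ cheapFlows R c τ, netFlow f = r) ∨
    ∃ φ : ι → ℝ, (∀ u v, R u v → φ v - φ u ≤ c u v) ∧ τ < ∑ v, r v * φ v :=
  or_iff_not_imp_left.2 fun hr => exists_potential_of_notMem hc hτ hr

end Flow

/-! ### Approximate solutions -/

namespace Network

variable {V : Type} [Fintype V] (N : Network V)

/-- Dual feasibility, stated for ordered pairs of adjacent nodes instead of oriented edges. -/
def IsPotential (y : V → ℝ) : Prop := ∀ u v, N.graph.Adj u v → y v - y u ≤ N.cost u v

/-- A flow on ordered pairs of nodes and a potential that certify each other to be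
`(1 + ε)`-approximate. -/
structure IsApproxPair (ε : ℝ) (f : V → V → ℝ) (y : V → ℝ) : Prop where
  nonneg : ∀ u v, 0 ≤ f u v
  support : ∀ u v, ¬N.graph.Adj u v → f u v = 0
  netFlow_eq : ∀ v, netFlow f v = N.demand v
  isPotential : N.IsPotential y
  cost_le : ∑ u, ∑ v, N.cost u v * f u v ≤ (1 + ε) * N.dualValue y

variable {N}

lemma isForward_or_isForward {u v : V} (h : N.graph.Adj u v) :
    N.IsForward u v ∨ N.IsForward v u := by
  have hne : N.ident u ≠ N.ident v := N.ident_injective.ne h.ne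
  rcases lt_trichotomy (N.cost u v) (N.cost v u) with hc | hc | hc
  · exact Or.inr ⟨h.symm, Or.inl hc⟩
  · rcases lt_or_gt_of_ne hne with hi | hi
    · exact Or.inl ⟨h, Or.inr ⟨hc.symm, hi⟩⟩
    · exact Or.inr ⟨h.symm, Or.inr ⟨hc, hi⟩⟩
  · exact Or.inl ⟨h, Or.inl hc⟩

lemma not_isForward_of_isForward {u v : V} (h : N.IsForward u v) : ¬N.IsForward v u := by
  rintro ⟨-, h'⟩
  have := h.2
  omega

lemma one_le_wPlus (e : N.Edge) : 1 ≤ N.wPlus e :=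
  Nat.one_le_cast.2 (N.cost_pos _ _ e.2.1)

lemma one_le_wMinus (e : N.Edge) : 1 ≤ N.wMinus e :=
  Nat.one_le_cast.2 (N.cost_pos _ _ e.2.1.symm)

open Classical in
lemma sum_sum_ite_isForward (F : V → V → ℝ) :
    ∑ u, ∑ v, (if N.IsForward u v then F u v else 0) =
      ∑ e : N.Edge, F (N.tail e) (N.head e) := by
  rw [← Fintype.sum_prod_type' (f := fun u v => if N.IsForward u v then F u v else 0),
    ← sum_filter]
  exact sum_subtype _ (fun a => by simp) fun a : V × V => F a.1 a.2

lemma sum_sum_eq_sum_edge {F : V → V → ℝ} (hF : ∀ u v, ¬N.graph.Adj u v → F u v = 0) :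
    ∑ u, ∑ v, F u v =
      ∑ e : N.Edge, (F (N.tail e) (N.head e) + F (N.head e) (N.tail e)) := by
  classical
  have hsplit : ∀ u v, F u v = (if N.IsForward u v then F u v else 0) +
      if N.IsForward v u then F u v else 0 := fun u v => by
    by_cases h : N.graph.Adj u v
    · rcases isForward_or_isForward h with h' | h' <;>
        simp [h', not_isForward_of_isForward h']
    · simp [hF u v h]
  rw [sum_add_distrib, ← sum_sum_ite_isForward F, ← sum_sum_ite_isForward fun u v => F v u,
    sum_comm (γ := V) (f := fun u v => if N.IsForward u v then F v u else 0)]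
  simp only [← sum_add_distrib, ← hsplit]

lemma incidence_transpose_mulVec (y : V → ℝ) (e : N.Edge) :
    (N.incidenceᵀ *ᵥ y) e = y (N.head e) - y (N.tail e) := by
  classical
  simp [mulVec, dotProduct, incidence, sub_mul, sum_sub_distrib]

lemma primalCost_eq (x : N.Edge → ℝ) :
    N.primalCost x = ∑ e, (max 0 (N.wPlus e * x e) + max 0 (-(N.wMinus e * x e))) := by
  classical
  simp [primalCost, pNorm, wStar, fromRows_mulVec, mulVec_diagonal, sum_add_distrib]

lemma rStar_mulVec_inl_le_one_iff (y : V → ℝ) (e : N.Edge) :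
    (N.rStar *ᵥ (N.incidenceᵀ *ᵥ y)) (Sum.inl e) ≤ 1 ↔
      y (N.head e) - y (N.tail e) ≤ N.wPlus e := by
  classical
  simp only [rStar, fromRows_mulVec, Sum.elim_inl, mulVec_diagonal, incidence_transpose_mulVec]
  rw [inv_mul_le_iff₀ (zero_lt_one.trans_le (one_le_wPlus e)), mul_one]

lemma rStar_mulVec_inr_le_one_iff (y : V → ℝ) (e : N.Edge) :
    (N.rStar *ᵥ (N.incidenceᵀ *ᵥ y)) (Sum.inr e) ≤ 1 ↔
      y (N.tail e) - y (N.head e) ≤ N.wMinus e := by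
  classical
  simp only [rStar, fromRows_mulVec, Sum.elim_inr, neg_mulVec, Pi.neg_apply, mulVec_diagonal,
    incidence_transpose_mulVec]
  rw [← mul_neg, neg_sub, inv_mul_le_iff₀ (zero_lt_one.trans_le (one_le_wMinus e)), mul_one]

lemma qNorm_le_one_iff {κ : Type} [Fintype κ] (z : κ → ℝ) : qNorm z ≤ 1 ↔ ∀ i, z i ≤ 1 :=
  ⟨fun h i => (le_max_right 0 _).trans ((le_ciSup (Set.finite_range _).bddAbove i).trans h),
    fun h => Real.iSup_le (fun i => max_le zero_le_one (h i)) zero_le_one⟩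

lemma dualFeasible_iff (y : V → ℝ) : N.DualFeasible y ↔ ∀ e : N.Edge,
    y (N.head e) - y (N.tail e) ≤ N.wPlus e ∧ y (N.tail e) - y (N.head e) ≤ N.wMinus e := by
  rw [DualFeasible, qNorm_le_one_iff, Sum.forall, ← forall_and]
  exact forall_congr' fun e =>
    and_congr (rStar_mulVec_inl_le_one_iff y e) (rStar_mulVec_inr_le_one_iff y e)

lemma IsPotential.dualFeasible {y : V → ℝ} (h : N.IsPotential y) : N.DualFeasible y :=
  (dualFeasible_iff y).2 fun e => ⟨h _ _ e.2.1, h _ _ e.2.1.symm⟩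

lemma dualValue_eq_of_primalFeasible {x : N.Edge → ℝ} (hx : N.PrimalFeasible x) (y : V → ℝ) :
    N.dualValue y = ∑ e, x e * (y (N.head e) - y (N.tail e)) := by
  have hdot : N.dualValue y = (N.incidence *ᵥ x) ⬝ᵥ y := by rw [hx]; rfl
  rw [hdot, dotProduct_comm, dotProduct_mulVec, ← mulVec_transpose, dotProduct_comm]
  exact sum_congr rfl fun e _ => by rw [incidence_transpose_mulVec]

theorem dualValue_le_primalCost {x : N.Edge → ℝ} {y : V → ℝ} (hx : N.PrimalFeasible x)
    (hy : N.DualFeasible y) : N.dualValue y ≤ N.primalCost x := by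
  rw [dualValue_eq_of_primalFeasible hx, primalCost_eq]
  refine sum_le_sum fun e _ => ?_
  obtain ⟨hplus, hminus⟩ := (dualFeasible_iff y).1 hy e
  rcases le_total 0 (x e) with h | h
  · refine le_add_of_le_of_nonneg (le_max_of_le_right ?_) (le_max_left _ _)
    rw [mul_comm]
    exact mul_le_mul_of_nonneg_right hplus h
  · refine le_add_of_nonneg_of_le (le_max_left _ _) (le_max_of_le_right ?_)
    nlinarith

lemma abs_le_edgeCost (x : N.Edge → ℝ) (e : N.Edge) :
    |x e| ≤ max 0 (N.wPlus e * x e) + max 0 (-(N.wMinus e * x e)) := by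
  rcases le_total 0 (x e) with h | h
  · rw [abs_of_nonneg h]
    exact le_add_of_le_of_nonneg
      (le_max_of_le_right (le_mul_of_one_le_left h (one_le_wPlus e))) (le_max_left _ _)
  · rw [abs_of_nonpos h, ← mul_neg]
    exact le_add_of_nonneg_of_le (le_max_left _ _) (le_max_of_le_right
      (le_mul_of_one_le_left (neg_nonneg.2 h) (one_le_wMinus e)))

lemma norm_le_primalCost (x : N.Edge → ℝ) : ‖x‖ ≤ N.primalCost x := by
  have hnonneg := fun e => (abs_nonneg _).trans (abs_le_edgeCost x e)
  rw [primalCost_eq]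
  refine (pi_norm_le_iff_of_nonneg (sum_nonneg fun e _ => hnonneg e)).2 fun e => ?_
  exact (abs_le_edgeCost x e).trans (single_le_sum
    (f := fun e => max 0 (N.wPlus e * x e) + max 0 (-(N.wMinus e * x e)))
    (fun e _ => hnonneg e) (mem_univ e))

lemma continuous_primalCost : Continuous N.primalCost := by
  rw [funext primalCost_eq]
  fun_prop

theorem exists_isOptimum {x₀ : N.Edge → ℝ} (h : N.PrimalFeasible x₀) :
    ∃ opt, N.IsOptimum opt := by
  have hclosed : IsClosed {x | N.PrimalFeasible x} :=
    isClosed_eq (Continuous.matrix_mulVec continuous_const continuous_id) continuous_const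
  have hcompact : IsCompact ({x | N.PrimalFeasible x} ∩
      {x | N.primalCost x ≤ N.primalCost x₀}) :=
    (isCompact_closedBall 0 (N.primalCost x₀)).of_isClosed_subset
      (hclosed.inter (isClosed_le continuous_primalCost continuous_const))
      fun x hx => mem_closedBall_zero_iff.2 ((norm_le_primalCost x).trans hx.2)
  obtain ⟨x, hx, hmin⟩ :=
    hcompact.exists_isMinOn ⟨x₀, h, le_refl (N.primalCost x₀)⟩ continuous_primalCost.continuousOn
  refine ⟨N.primalCost x, ⟨x, hx.1, rfl⟩, ?_⟩
  rintro z ⟨x', hx', rfl⟩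
  rcases le_total (N.primalCost x') (N.primalCost x₀) with h' | h'
  · exact hmin ⟨hx', h'⟩
  · exact le_trans hx.2 h'

/-- The flow on an edge, signed with respect to its forward orientation. -/
def edgeFlow (f : V → V → ℝ) (e : N.Edge) : ℝ :=
  f (N.tail e) (N.head e) - f (N.head e) (N.tail e)

lemma primalFeasible_edgeFlow {f : V → V → ℝ} (hf : ∀ u v, ¬N.graph.Adj u v → f u v = 0)
    (hb : ∀ v, netFlow f v = N.demand v) : N.PrimalFeasible (edgeFlow f) := by
  classical
  ext v
  have hnet := sum_mul_netFlow f fun u => if v = u then 1 else 0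
  simp only [ite_mul, one_mul, zero_mul, sum_ite_eq, mem_univ, if_true] at hnet
  rw [← hb v, hnet, sum_sum_eq_sum_edge fun a b hab => by rw [hf a b hab, zero_mul]]
  simp only [mulVec, dotProduct, incidence, edgeFlow]
  exact sum_congr rfl fun e _ => by ring

lemma primalCost_edgeFlow_le {f : V → V → ℝ} (hnonneg : ∀ u v, 0 ≤ f u v)
    (hf : ∀ u v, ¬N.graph.Adj u v → f u v = 0) :
    N.primalCost (edgeFlow f) ≤ ∑ u, ∑ v, N.cost u v * f u v := by
  rw [sum_sum_eq_sum_edge fun a b hab => by rw [hf a b hab, mul_zero], primalCost_eq]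
  refine sum_le_sum fun e _ => ?_
  have hplus := zero_le_one.trans (one_le_wPlus e)
  have hminus := zero_le_one.trans (one_le_wMinus e)
  have hforward := hnonneg (N.tail e) (N.head e)
  have hbackward := hnonneg (N.head e) (N.tail e)
  change _ ≤ N.wPlus e * _ + N.wMinus e * _
  rw [edgeFlow, ← mul_neg, neg_sub]
  gcongr <;> refine max_le (by positivity) ?_ <;> gcongr <;> exact sub_le_self _ ‹_›

theorem IsApproxPair.isApproximation {ε : ℝ} {f : V → V → ℝ} {y : V → ℝ}
    (h : N.IsApproxPair ε f y) (hε : 0 ≤ ε) {out : V → NodeOutput}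
    (hval : ∀ v, (out v).value = (1 + ε) * N.dualValue y) (hpot : ∀ v, (out v).potential = y v)
    (hflow : ∀ u v, N.IsForward u v → (out u).flow (N.ident v) = f u v - f v u ∧
      (out v).flow (N.ident u) = f u v - f v u) : N.IsApproximation ε out := by
  have hx := primalFeasible_edgeFlow h.support h.netFlow_eq
  have hy := h.isPotential.dualFeasible
  have hcost := (primalCost_edgeFlow_le h.nonneg h.support).trans h.cost_le
  obtain ⟨opt, hopt⟩ := exists_isOptimum hx
  refine ⟨⟨opt, hopt, fun v => ?_⟩, edgeFlow f, y, fun e => hflow _ _ e.2, hpot, hx, hy, hcost⟩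
  rw [hval v]
  refine ⟨(hopt.2 ⟨_, hx, rfl⟩).trans hcost, ?_⟩
  obtain ⟨x', hx', rfl⟩ := hopt.1
  exact mul_le_mul_of_nonneg_left (dualValue_le_primalCost hx' hy) (by linarith)

end Network

namespace Network

variable {V : Type} [Fintype V] {N : Network V} {c : ℕ}

variable (V) in
/-- The number of bits of the number of nodes. -/
def bitLength : ℕ := Nat.log 2 (Fintype.card V) + 1

lemma card_lt_two_pow_bitLength : Fintype.card V < 2 ^ bitLength V :=
  Nat.lt_pow_succ_log_self one_lt_two _

lemma card_pow_le (c : ℕ) : Fintype.card V ^ c ≤ 2 ^ (c * bitLength V) := by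
  rw [mul_comm, pow_mul]
  exact Nat.pow_le_pow_left card_lt_two_pow_bitLength.le c

lemma cast_card_le_two_pow_bitLength : (Fintype.card V : ℝ) ≤ 2 ^ bitLength V := by
  exact_mod_cast (card_lt_two_pow_bitLength (V := V)).le

lemma PolyBounded.cost_le (h : N.PolyBounded c) {u v : V} (huv : N.graph.Adj u v) :
    N.cost u v ≤ 2 ^ (c * bitLength V) := (h.2.1 u v huv).trans (card_pow_le c)

lemma PolyBounded.ident_le (h : N.PolyBounded c) (v : V) :
    N.ident v ≤ 2 ^ (c * bitLength V) := (h.1 v).trans (card_pow_le c)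

lemma PolyBounded.abs_demand_le (h : N.PolyBounded c) (v : V) :
    |N.demand v| ≤ 2 ^ (c * bitLength V) :=
  (h.2.2 v).trans (by exact_mod_cast card_pow_le c)

lemma IsPotential.sub_le {y : V → ℝ} (h : N.IsPotential y) {K : ℕ}
    (hK : ∀ u v, N.graph.Adj u v → N.cost u v ≤ K) (u v : V) :
    y v - y u ≤ Fintype.card V * K := by
  have hwalk : ∀ {u v : V} (p : N.graph.Walk u v), y v - y u ≤ p.length * K := by
    intro u v p
    induction p with
    | nil => simp
    | cons hadj p ih =>
      have hstep := (h _ _ hadj).trans (Nat.cast_le.2 (hK _ _ hadj))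
      simp only [SimpleGraph.Walk.length_cons, Nat.cast_add, Nat.cast_one]
      linarith
  obtain ⟨p, hp⟩ := (N.connected u v).exists_isPath
  refine (hwalk p).trans (mul_le_mul_of_nonneg_right ?_ (Nat.cast_nonneg _))
  exact_mod_cast hp.length_lt.le

lemma dualValue_eq_sum_sub (N : Network V) (y : V → ℝ) (a : ℝ) :
    N.dualValue y = ∑ v, (N.demand v : ℝ) * (y v - a) := by
  have hsum : ∑ v, (N.demand v : ℝ) = 0 := by exact_mod_cast N.sum_demand
  simp only [mul_sub, sum_sub_distrib, ← sum_mul, hsum, zero_mul, sub_zero, dualValue]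

lemma IsPotential.dualValue_le {y : V → ℝ} (h : N.IsPotential y) {K D : ℕ}
    (hK : ∀ u v, N.graph.Adj u v → N.cost u v ≤ K) (hD : ∀ v, |N.demand v| ≤ D) :
    N.dualValue y ≤ Fintype.card V * (D * (Fintype.card V * K)) := by
  obtain ⟨r⟩ := N.connected.nonempty
  have hterm : ∀ v, (N.demand v : ℝ) * (y v - y r) ≤ D * (Fintype.card V * K) := fun v => by
    have hdiff : |y v - y r| ≤ Fintype.card V * K :=
      abs_le.2 ⟨by linarith [h.sub_le hK v r], h.sub_le hK r v⟩
    have hdemand : |(N.demand v : ℝ)| ≤ D := by exact_mod_cast hD v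
    calc (N.demand v : ℝ) * (y v - y r) ≤ |(N.demand v : ℝ)| * |y v - y r| :=
          (le_abs_self _).trans (abs_mul _ _).le
      _ ≤ D * (Fintype.card V * K) := by gcongr
  calc N.dualValue y = ∑ v, (N.demand v : ℝ) * (y v - y r) := N.dualValue_eq_sum_sub y (y r)
    _ ≤ ∑ _v : V, (D : ℝ) * (Fintype.card V * K) := sum_le_sum fun v _ => hterm v
    _ = Fintype.card V * (D * (Fintype.card V * K)) := by rw [sum_const, nsmul_eq_mul, card_univ]

lemma PolyBounded.dualValue_le (hN : N.PolyBounded c) {y : V → ℝ} (h : N.IsPotential y) :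
    N.dualValue y ≤ 2 ^ ((2 * c + 2) * bitLength V) := by
  have hle := h.dualValue_le (fun u v huv => hN.cost_le huv)
    (fun v => by exact_mod_cast hN.abs_demand_le v)
  have hcard := cast_card_le_two_pow_bitLength (V := V)
  push_cast at hle
  calc N.dualValue y
      ≤ 2 ^ bitLength V * (2 ^ (c * bitLength V) * (2 ^ bitLength V * 2 ^ (c * bitLength V))) :=
        hle.trans (by gcongr)
    _ = 2 ^ ((2 * c + 2) * bitLength V) := by ring

variable (N) in
lemma bddAbove_dualValue : BddAbove (N.dualValue '' {y | N.IsPotential y}) := by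
  refine ⟨_, Set.forall_mem_image.2 fun y hy => hy.dualValue_le (K := ∑ u, ∑ v, N.cost u v)
    (D := ∑ v, (N.demand v).natAbs) (fun u v _ => ?_) fun v => ?_⟩
  · exact (single_le_sum (f := N.cost u) (fun _ _ => Nat.zero_le _) (mem_univ v)).trans
      (single_le_sum (f := fun u => ∑ v, N.cost u v) (fun _ _ => Nat.zero_le _) (mem_univ u))
  · rw [Int.abs_eq_natAbs, Nat.cast_le]
    exact single_le_sum (f := fun v => (N.demand v).natAbs) (fun _ _ => Nat.zero_le _)
      (mem_univ v)

lemma isPotential_indicator :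
    N.IsPotential fun v => if 0 < N.demand v then 1 else 0 := by
  intro u v huv
  have : (1 : ℝ) ≤ N.cost u v := by exact_mod_cast N.cost_pos u v huv
  dsimp only
  split_ifs <;> linarith

lemma one_le_dualValue_indicator (h : ∃ v, N.demand v ≠ 0) :
    1 ≤ N.dualValue fun v => if 0 < N.demand v then 1 else 0 := by
  have hnonneg : ∀ v, 0 ≤ N.demand v * (if 0 < N.demand v then 1 else 0) := fun v => by
    split_ifs with h
    · omega
    · simp
  obtain ⟨v, -, hv⟩ : ∃ v ∈ univ, 0 < N.demand v :=
    exists_pos_of_sum_zero_of_exists_nonzero _ N.sum_demand (by simpa using h)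
  have hsum : 1 ≤ ∑ v, N.demand v * (if 0 < N.demand v then 1 else 0) := by
    refine le_trans ?_ (single_le_sum (fun v _ => hnonneg v) (mem_univ v))
    rw [if_pos hv]
    omega
  unfold dualValue
  beta_reduce
  exact_mod_cast hsum

lemma isApproxPair_zero {ε : ℝ} (h : ∀ v, N.demand v = 0) :
    N.IsApproxPair ε (fun _ _ => 0) fun _ => 0 where
  nonneg _ _ := le_rfl
  support _ _ _ := rfl
  netFlow_eq v := by simp [netFlow_apply, h v]
  isPotential u v _ := by simp
  cost_le := by simp [dualValue]

variable (N) in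
theorem exists_isApproxPair {ε : ℝ} (hε : 0 < ε) : ∃ f y, N.IsApproxPair ε f y := by
  by_cases h : ∃ v, N.demand v ≠ 0
  · have hpos : 0 < sSup (N.dualValue '' {y | N.IsPotential y}) :=
      zero_lt_one.trans_le ((one_le_dualValue_indicator h).trans
        (le_csSup N.bddAbove_dualValue ⟨_, isPotential_indicator, rfl⟩))
    obtain ⟨_, ⟨y, hy, rfl⟩, hlt⟩ := exists_lt_of_lt_csSup
      (Set.Nonempty.image _ ⟨_, isPotential_indicator⟩)
      (div_lt_self hpos (lt_add_of_pos_right 1 hε))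
    rw [div_lt_iff₀' (by linarith)] at hlt
    rcases exists_flow_or_potential (c := fun u v => (N.cost u v : ℝ))
      (fun u v huv => by exact_mod_cast N.cost_pos u v huv) (fun v => (N.demand v : ℝ))
      (hpos.trans hlt) with ⟨f, ⟨hnonneg, hsupp, hcost⟩, hnet⟩ | ⟨φ, hφ, hφτ⟩
    · exact ⟨f, y, hnonneg, hsupp, congrFun hnet, hy, hcost⟩
    · exact absurd (hlt.trans hφτ) (le_csSup N.bddAbove_dualValue ⟨φ, hφ, rfl⟩).not_gt
  · push Not at h
    exact ⟨_, _, isApproxPair_zero h⟩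

end Network

/-! ### Hitting sets and representatives -/

section Selection

variable {α β ι : Type}

/-- Counting: `T` and `U \ T` both hit every `S i` unless one of the sets avoids an `S i`. -/
lemma exists_subset_forall_inter_nonempty [DecidableEq α] (U : Finset α) (I : Finset ι)
    (S : ι → Finset α) {d : ℕ} (hS : ∀ i ∈ I, S i ⊆ U ∧ d ≤ #(S i)) (hI : 2 * #I < 2 ^ d) :
    ∃ T ⊆ U, ∀ i ∈ I, (S i ∩ T).Nonempty ∧ (S i \ T).Nonempty := by
  rcases I.eq_empty_or_nonempty with rfl | ⟨i₀, hi₀⟩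
  · exact ⟨∅, empty_subset _, by simp⟩
  have hdU : d ≤ #U := (hS i₀ hi₀).2.trans (card_le_card (hS i₀ hi₀).1)
  let bad : Finset (Finset α) :=
    I.biUnion fun i => (U \ S i).powerset ∪ ((U \ S i).powerset).image (U \ ·)
  have hbad : #bad ≤ #I * (2 * 2 ^ (#U - d)) := by
    refine card_biUnion_le_card_mul _ _ _ fun i hi => ?_
    have hcard : #(U \ S i).powerset ≤ 2 ^ (#U - d) := by
      rw [card_powerset, card_sdiff_of_subset (hS i hi).1]
      exact Nat.pow_le_pow_right two_pos (Nat.sub_le_sub_left (hS i hi).2 _)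
    have himage := card_image_le (s := (U \ S i).powerset) (f := (U \ ·))
    have hunion := card_union_le (U \ S i).powerset (((U \ S i).powerset).image (U \ ·))
    omega
  have hlt : #bad < #U.powerset := by
    calc #bad ≤ 2 * #I * 2 ^ (#U - d) := by rw [mul_comm 2, mul_assoc]; exact hbad
      _ < 2 ^ d * 2 ^ (#U - d) := Nat.mul_lt_mul_of_pos_right hI (by positivity)
      _ = #U.powerset := by rw [← pow_add, card_powerset, Nat.add_sub_cancel' hdU]
  obtain ⟨T, hTU, hT⟩ := exists_mem_notMem_of_card_lt_card hlt
  rw [mem_powerset] at hTU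
  simp only [bad, mem_biUnion, mem_union, mem_powerset, mem_image, not_exists, not_and,
    not_or] at hT
  refine ⟨T, hTU, fun i hi => ⟨?_, ?_⟩⟩
  · by_contra hempty
    rw [not_nonempty_iff_eq_empty, ← disjoint_iff_inter_eq_empty] at hempty
    exact (hT i hi).1 (subset_sdiff.2 ⟨hTU, hempty.symm⟩)
  · by_contra hempty
    rw [not_nonempty_iff_eq_empty, sdiff_eq_empty_iff_subset] at hempty
    exact (hT i hi).2 (U \ T) (sdiff_subset_sdiff subset_rfl hempty)
      (Finset.sdiff_sdiff_eq_self hTU)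

lemma exists_small_hittingSet (U : Finset α) (I : Finset ι) (S : ι → Finset α)
    {d : ℕ} (hS : ∀ i ∈ I, S i ⊆ U ∧ d ≤ #(S i)) (hI : 2 * #I < 2 ^ d) :
    ∃ T ⊆ U, 2 * #T ≤ #U ∧ ∀ i ∈ I, ∃ x ∈ S i, x ∈ T := by
  classical
  obtain ⟨T, hTU, hT⟩ := exists_subset_forall_inter_nonempty U I S hS hI
  by_cases hcard : 2 * #T ≤ #U
  · refine ⟨T, hTU, hcard, fun i hi => ?_⟩
    simpa only [Finset.Nonempty, mem_inter] using (hT i hi).1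
  · refine ⟨U \ T, sdiff_subset, ?_, fun i hi => ?_⟩
    · rw [card_sdiff_of_subset hTU]
      omega
    · obtain ⟨x, hx⟩ := (hT i hi).2
      obtain ⟨hxS, hxT⟩ := mem_sdiff.1 hx
      exact ⟨x, hxS, mem_sdiff.2 ⟨(hS i hi).1 hxS, hxT⟩⟩

lemma exists_representatives (A : Finset α) (f : α → β) (d : ℕ) :
    ∃ S ⊆ A, Set.InjOn f S ∧ #S ≤ d ∧ (#S = d ∨ ∀ a ∈ A, ∃ s ∈ S, f s = f a) := by
  classical
  obtain ⟨S, hSA, hinj, himage⟩ := exists_subset_injOn_image_eq_of_surjOn (A : Set α) (A.image f)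
    (by simpa using Set.surjOn_image f A)
  have hattained : ∀ a ∈ A, ∃ s ∈ S, f s = f a := fun a ha =>
    mem_image.1 (himage ▸ mem_image_of_mem f ha)
  rcases le_total #S d with h | h
  · exact ⟨S, coe_subset.1 hSA, hinj, h, Or.inr hattained⟩
  · obtain ⟨S', hS', hcard⟩ := exists_subset_card_eq h
    exact ⟨S', hS'.trans (coe_subset.1 hSA), hinj.mono (coe_subset.2 hS'), hcard.le, Or.inl hcard⟩

/-- At most `d` elements of `A` with distinct values of `f`, which attain all values of `f` on `A`
unless there are `d` of them. -/
def representatives (A : Finset α) (f : α → β) (d : ℕ) : Finset α :=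
  (exists_representatives A f d).choose

lemma representatives_spec (A : Finset α) (f : α → β) (d : ℕ) :
    representatives A f d ⊆ A ∧ Set.InjOn f (representatives A f d) ∧
      #(representatives A f d) ≤ d ∧ (#(representatives A f d) = d ∨
        ∀ a ∈ A, ∃ s ∈ representatives A f d, f s = f a) :=
  (exists_representatives A f d).choose_spec

end Selection

/-! ### A sparse subgraph that preserves distances -/

/-- For each class `j` of edges (those of cost between `2 ^ j` and `2 ^ (j + 1)` in their cheaper
direction), the cluster of each node, if it belongs to one, and the edges selected so far, as
pairs of the selecting node and its neighbor. Nodes and clusters are represented by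
identifiers. -/
structure Clustering where
  cluster : ℕ → ℕ → Option ℕ
  selected : ℕ → ℕ → ℕ → Prop

/-- The neighbors along edges of class `j` that belong to a cluster. -/
def LocalInput.clusteredNeighbors (inp : LocalInput) (s : Clustering) (j : ℕ) : Finset ℕ :=
  (inp.incident.filter fun a => Nat.log 2 (min a.2.1 a.2.2) = j ∧
    (s.cluster j a.1).isSome).image fun a => a.1

/-- The neighbors selected in class `j` by node `i`. -/
def selectedNeighbors (board : Finset ℕ) (j i : ℕ) : Finset ℕ :=
  ((postedBy board i).filter fun a => a.unpair.1 = j).image fun a => a.unpair.2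

lemma mem_selectedNeighbors {board : Finset ℕ} {j i a : ℕ} :
    a ∈ selectedNeighbors board j i ↔ Nat.pair j a ∈ postedBy board i := by
  simp only [selectedNeighbors, mem_image, mem_filter]
  constructor
  · rintro ⟨x, ⟨hx, rfl⟩, rfl⟩
    simpa using hx
  · exact fun h => ⟨_, ⟨h, by simp⟩, by simp⟩

namespace Clustering

variable {s : Clustering} {ids board : Finset ℕ} {d j : ℕ}

/-- The edges that a clustered node selects, one for each of at most `d` adjacent clusters. -/
def post (s : Clustering) (J d : ℕ) (inp : LocalInput) : Finset ℕ :=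
  (range J).biUnion fun j =>
    if (s.cluster j inp.ident).isSome then
      (representatives (inp.clusteredNeighbors s j) (s.cluster j) d).image (Nat.pair j)
    else ∅

lemma mem_post {J : ℕ} {inp : LocalInput} {x : ℕ} :
    x ∈ s.post J d inp ↔ ∃ j < J, (s.cluster j inp.ident).isSome ∧
      ∃ a ∈ representatives (inp.clusteredNeighbors s j) (s.cluster j) d, Nat.pair j a = x := by
  simp only [post, mem_biUnion, mem_range, apply_ite (x ∈ ·), mem_image, notMem_empty,
    if_false_right]

lemma card_post_le (J : ℕ) (inp : LocalInput) : #(s.post J d inp) ≤ J * d := by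
  refine (card_biUnion_le_card_mul _ _ d fun j _ => ?_).trans_eq (by rw [card_range])
  split_ifs
  · exact card_image_le.trans (representatives_spec _ _ _).2.2.1
  · exact Nat.zero_le _

/-- The clusters of class `j`. -/
def clusters (s : Clustering) (ids : Finset ℕ) (j : ℕ) : Finset ℕ :=
  eraseNone (ids.image (s.cluster j))

lemma mem_clusters {k : ℕ} : k ∈ s.clusters ids j ↔ ∃ i ∈ ids, s.cluster j i = some k := by
  simp [clusters]

/-- The clusters of the neighbors selected in class `j` by node `i`. -/
def adjacentClusters (s : Clustering) (board : Finset ℕ) (j i : ℕ) : Finset ℕ :=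
  s.clusters (selectedNeighbors board j i) j

/-- `T` contains at most half of the clusters of class `j`, and it contains an adjacent cluster of
each node that has selected `d` edges. -/
def IsSample (s : Clustering) (ids : Finset ℕ) (d : ℕ) (board : Finset ℕ) (j : ℕ)
    (T : Finset ℕ) : Prop :=
  T ⊆ s.clusters ids j ∧ 2 * #T ≤ #(s.clusters ids j) ∧
    ∀ i ∈ ids, #(selectedNeighbors board j i) = d → ∃ k ∈ s.adjacentClusters board j i, k ∈ T

open Classical in
/-- A choice of clusters that satisfies `IsSample` if there is one. It is a function of public
knowledge, so that all nodes make the same choice. -/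
def sample (s : Clustering) (ids : Finset ℕ) (d : ℕ) (board : Finset ℕ) (j : ℕ) : Finset ℕ :=
  if h : ∃ T, s.IsSample ids d board j T then h.choose else ∅

lemma isSample_sample (h : ∃ T, s.IsSample ids d board j T) :
    s.IsSample ids d board j (s.sample ids d board j) := by
  rw [sample, dif_pos h]
  exact h.choose_spec

open Classical in
/-- The nodes of the sampled clusters stay in their clusters, the other clustered nodes join an
adjacent sampled cluster along a selected edge, if there is one. -/
def next (s : Clustering) (ids : Finset ℕ) (d : ℕ) (board : Finset ℕ) : Clustering where
  cluster j i := (s.cluster j i).bind fun k =>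
    if k ∈ s.sample ids d board j then some k
    else if h : ∃ k' ∈ s.adjacentClusters board j i, k' ∈ s.sample ids d board j then
      some h.choose
    else none
  selected j i a := s.selected j i a ∨ (i ∈ ids ∧ a ∈ selectedNeighbors board j i)

lemma of_cluster_next_eq_some {i k : ℕ} (h : (s.next ids d board).cluster j i = some k) :
    k ∈ s.sample ids d board j ∧
      (s.cluster j i = some k ∨ k ∈ s.adjacentClusters board j i) := by
  obtain ⟨k', hk', h⟩ := Option.bind_eq_some_iff.1 h
  split_ifs at h with hsampled hadj <;> obtain rfl := Option.some.inj h
  · exact ⟨hsampled, Or.inl hk'⟩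
  · exact ⟨hadj.choose_spec.2, Or.inr hadj.choose_spec.1⟩

lemma card_selectedNeighbors_ne_of_cluster_next_eq_none {i : ℕ}
    (hsample : ∃ T, s.IsSample ids d board j T) (hi : i ∈ ids) (hs : (s.cluster j i).isSome)
    (h : (s.next ids d board).cluster j i = none) : #(selectedNeighbors board j i) ≠ d := by
  intro hcard
  obtain ⟨k, hk⟩ := Option.isSome_iff_exists.1 hs
  simp only [next, hk, Option.bind_some] at h
  split_ifs at h with hsampled hadj
  exact hadj ((isSample_sample hsample).2.2 i hi hcard)

/-- The potential differences along the selected edges are at most the costs of their classes. -/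
def Respects (s : Clustering) (φ : ℕ → ℝ) : Prop :=
  ∀ j u v, s.selected j u v → |φ u - φ v| ≤ 2 ^ j

lemma Respects.of_next {φ : ℕ → ℝ} (h : (s.next ids d board).Respects φ) : s.Respects φ :=
  fun j u v huv => h j u v (Or.inl huv)

end Clustering

/-- The program that selects the edges of the sparse subgraph, in `l` rounds of sampling. -/
def sparsify (ids : Finset ℕ) (J l : ℕ) : BoardProgram Clustering :=
  .iter (fun _ s => .ask (s.post J (l + 1)) fun board => .pure (s.next ids (l + 1) board)) l
    ⟨fun _ i => some i, fun _ _ _ => False⟩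

namespace Network

variable {V : Type} [Fintype V] {N : Network V} {ε : ℝ} {c : ℕ}

variable (N) in
/-- The set of all identifiers. -/
def ids : Finset ℕ := univ.image N.ident

lemma mem_ids {i : ℕ} : i ∈ N.ids ↔ ∃ v, N.ident v = i := by
  simp [ids]

lemma ident_mem_ids (v : V) : N.ident v ∈ N.ids := mem_ids.2 ⟨v, rfl⟩

lemma card_ids : #N.ids = Fintype.card V :=
  (card_image_of_injective _ N.ident_injective).trans card_univ

lemma mem_incident {v : V} {a : ℕ × ℕ × ℕ} : a ∈ (N.localInput ε v).incident ↔
    ∃ u, N.graph.Adj v u ∧ a = (N.ident u, N.cost v u, N.cost u v) := by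
  classical
  simp only [localInput, mem_image, mem_filter, mem_univ, true_and]
  exact exists_congr fun u => and_congr_right fun _ => eq_comm

variable (N) in
/-- The class of an edge: the binary logarithm of its cost in the cheaper direction. -/
def edgeClass (u v : V) : ℕ := Nat.log 2 (min (N.cost u v) (N.cost v u))

lemma edgeClass_comm (u v : V) : N.edgeClass u v = N.edgeClass v u := by
  rw [edgeClass, min_comm, edgeClass]

lemma two_pow_edgeClass_le {u v : V} (h : N.graph.Adj u v) :
    2 ^ N.edgeClass u v ≤ min (N.cost u v) (N.cost v u) :=
  Nat.pow_log_le_self 2 (by have := N.cost_pos u v h; have := N.cost_pos v u h.symm; omega)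

lemma min_cost_lt {u v : V} :
    min (N.cost u v) (N.cost v u) < 2 ^ (N.edgeClass u v + 1) :=
  Nat.lt_pow_succ_log_self one_lt_two _

lemma PolyBounded.edgeClass_lt (hN : N.PolyBounded c) {u v : V} (h : N.graph.Adj u v) :
    N.edgeClass u v < c * bitLength V + 1 :=
  Nat.lt_succ_of_le ((Nat.pow_le_pow_iff_right one_lt_two).1
    ((two_pow_edgeClass_le h).trans ((min_le_left _ _).trans (hN.cost_le h))))

variable {s : Clustering} {J d j : ℕ}

lemma mem_clusteredNeighbors {a : ℕ} {v : V} :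
    a ∈ (N.localInput ε v).clusteredNeighbors s j ↔
      ∃ u, N.graph.Adj v u ∧ N.edgeClass v u = j ∧ (s.cluster j (N.ident u)).isSome ∧
        a = N.ident u := by
  simp only [LocalInput.clusteredNeighbors, mem_image, mem_filter, mem_incident]
  constructor
  · rintro ⟨_, ⟨⟨u, hu, rfl⟩, hclass, hclustered⟩, rfl⟩
    exact ⟨u, hu, hclass, hclustered, rfl⟩
  · rintro ⟨u, hu, hclass, hclustered, rfl⟩
    exact ⟨_, ⟨⟨u, hu, rfl⟩, hclass, hclustered⟩, rfl⟩

lemma selectedNeighbors_board (v : V) :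
    selectedNeighbors (N.board ε (s.post J d)) j (N.ident v) =
      if j < J ∧ (s.cluster j (N.ident v)).isSome then
        representatives ((N.localInput ε v).clusteredNeighbors s j) (s.cluster j) d
      else ∅ := by
  ext a
  rw [mem_selectedNeighbors, postedBy_board, Clustering.mem_post, apply_ite (a ∈ ·)]
  simp only [Nat.pair_eq_pair, notMem_empty, if_false_right]
  constructor
  · rintro ⟨j, hj, hclustered, a, ha, rfl, rfl⟩
    exact ⟨⟨hj, hclustered⟩, ha⟩
  · rintro ⟨⟨hj, hclustered⟩, ha⟩
    exact ⟨j, hj, hclustered, a, ha, rfl, rfl⟩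

lemma of_mem_selectedNeighbors {a : ℕ} {v : V}
    (h : a ∈ selectedNeighbors (N.board ε (s.post J d)) j (N.ident v)) :
    ∃ u, a = N.ident u ∧ N.graph.Adj v u ∧ N.edgeClass v u = j ∧
      (s.cluster j (N.ident u)).isSome := by
  rw [selectedNeighbors_board] at h
  split_ifs at h
  · obtain ⟨u, hadj, hclass, hclustered, rfl⟩ :=
      mem_clusteredNeighbors.1 ((representatives_spec _ _ _).1 h)
    exact ⟨u, rfl, hadj, hclass, hclustered⟩
  · simp at h

lemma adjacentClusters_board_subset (v : V) :
    s.adjacentClusters (N.board ε (s.post J d)) j (N.ident v) ⊆ s.clusters N.ids j := by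
  intro k hk
  obtain ⟨a, ha, hak⟩ := Clustering.mem_clusters.1 hk
  obtain ⟨u, rfl, -⟩ := of_mem_selectedNeighbors ha
  exact Clustering.mem_clusters.2 ⟨_, ident_mem_ids u, hak⟩

lemma card_adjacentClusters_board (v : V) :
    #(s.adjacentClusters (N.board ε (s.post J d)) j (N.ident v)) =
      #(selectedNeighbors (N.board ε (s.post J d)) j (N.ident v)) := by
  rw [Clustering.adjacentClusters, Clustering.clusters, card_eraseNone_of_not_mem,
    card_image_of_injOn]
  · rw [selectedNeighbors_board]
    split_ifs
    · exact (representatives_spec _ _ _).2.1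
    · simp
  · intro hnone
    obtain ⟨a, ha, hnone⟩ := mem_image.1 hnone
    obtain ⟨u, rfl, -, -, hclustered⟩ := of_mem_selectedNeighbors ha
    simp [hnone] at hclustered

lemma exists_isSample (hd : 2 * Fintype.card V < 2 ^ d) (j : ℕ) :
    ∃ T, s.IsSample N.ids d (N.board ε (s.post J d)) j T := by
  obtain ⟨T, hT, hcard, hhit⟩ := exists_small_hittingSet (s.clusters N.ids j)
    (N.ids.filter fun i => #(selectedNeighbors (N.board ε (s.post J d)) j i) = d)
    (s.adjacentClusters (N.board ε (s.post J d)) j) (d := d)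
    (fun i hi => by
      obtain ⟨hi, hcard⟩ := mem_filter.1 hi
      obtain ⟨v, rfl⟩ := mem_ids.1 hi
      exact ⟨adjacentClusters_board_subset v, by rw [card_adjacentClusters_board, hcard]⟩)
    ((Nat.mul_le_mul_left 2 ((card_filter_le _ _).trans card_ids.le)).trans_lt hd)
  exact ⟨T, hT, hcard, fun i hi hsel => hhit i (mem_filter.2 ⟨hi, hsel⟩)⟩

/-- The invariant of the construction of the sparse subgraph after `i` rounds of sampling: in each
class, clusters have radius at most `i` and their number has been halved `i` times; an edge
whose endpoints are not both clustered is already spanned. -/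
structure ClusteringInvariant (N : Network V) (i : ℕ) (s : Clustering) : Prop where
  isEdge : ∀ j a b, s.selected j a b →
    ∃ u v, a = N.ident u ∧ b = N.ident v ∧ N.graph.Adj u v ∧ N.edgeClass u v = j
  radius : ∀ φ, s.Respects φ → ∀ j v k, s.cluster j (N.ident v) = some k →
    |φ (N.ident v) - φ k| ≤ i * 2 ^ j
  stretch : ∀ φ, s.Respects φ → ∀ u v, N.graph.Adj u v →
    ((s.cluster (N.edgeClass u v) (N.ident u)).isSome ∧
      (s.cluster (N.edgeClass u v) (N.ident v)).isSome) ∨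
    |φ (N.ident u) - φ (N.ident v)| ≤ (2 * i + 1) * 2 ^ N.edgeClass u v
  card_le : ∀ j, #(s.clusters N.ids j) * 2 ^ i ≤ Fintype.card V

lemma clusteringInvariant_zero :
    N.ClusteringInvariant 0 ⟨fun _ i => some i, fun _ _ _ => False⟩ where
  isEdge _ _ _ h := h.elim
  radius φ _ j v k h := by
    obtain rfl := Option.some.inj h
    simp
  stretch _ _ u v _ := Or.inl ⟨rfl, rfl⟩
  card_le j := by
    rw [pow_zero, mul_one, ← card_ids (N := N)]
    exact card_le_card fun k hk => by
      obtain ⟨i, hi, h⟩ := Clustering.mem_clusters.1 hk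
      exact Option.some.inj h ▸ hi

namespace ClusteringInvariant

variable {i : ℕ} {φ : ℕ → ℝ}

lemma isEdge_next (h : N.ClusteringInvariant i s) {a b : ℕ}
    (hab : (s.next N.ids d (N.board ε (s.post J d))).selected j a b) :
    ∃ u v, a = N.ident u ∧ b = N.ident v ∧ N.graph.Adj u v ∧ N.edgeClass u v = j := by
  rcases hab with hab | ⟨ha, hb⟩
  · exact h.isEdge j a b hab
  · obtain ⟨u, rfl⟩ := mem_ids.1 ha
    obtain ⟨v, rfl, hadj, hclass, -⟩ := of_mem_selectedNeighbors hb
    exact ⟨u, v, rfl, rfl, hadj, hclass⟩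

lemma abs_sub_le_of_cluster_next_eq_some (h : N.ClusteringInvariant i s)
    (hφ : (s.next N.ids d (N.board ε (s.post J d))).Respects φ) {v : V} {k : ℕ}
    (hk : (s.next N.ids d (N.board ε (s.post J d))).cluster j (N.ident v) = some k) :
    |φ (N.ident v) - φ k| ≤ (i + 1) * 2 ^ j := by
  rcases (Clustering.of_cluster_next_eq_some hk).2 with hvk | hvk
  · exact (h.radius φ hφ.of_next j v k hvk).trans (by gcongr; linarith)
  · obtain ⟨a, ha, hak⟩ := Clustering.mem_clusters.1 hvk
    obtain ⟨u, rfl, -⟩ := of_mem_selectedNeighbors ha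
    have hedge := hφ _ _ _ (Or.inr ⟨ident_mem_ids v, ha⟩)
    have hradius := h.radius φ hφ.of_next j u k hak
    calc |φ (N.ident v) - φ k|
        ≤ |φ (N.ident v) - φ (N.ident u)| + |φ (N.ident u) - φ k| := abs_sub_le _ _ _
      _ ≤ (i + 1) * 2 ^ j := by linarith

/-- A node `u` that leaves the clustering has selected an edge to a node `w` in the cluster of each
of its clustered neighbors `v`, and `w` and `v` are connected through the center. -/
lemma abs_sub_le_of_cluster_next_eq_none (h : N.ClusteringInvariant i s)
    (hd : 2 * Fintype.card V < 2 ^ d)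
    (hφ : (s.next N.ids d (N.board ε (s.post J d))).Respects φ) {u v : V}
    (huv : N.graph.Adj u v) (hJ : N.edgeClass u v < J)
    (hu : (s.cluster (N.edgeClass u v) (N.ident u)).isSome)
    (hv : (s.cluster (N.edgeClass u v) (N.ident v)).isSome)
    (hnone : (s.next N.ids d (N.board ε (s.post J d))).cluster (N.edgeClass u v) (N.ident u) =
      none) :
    |φ (N.ident u) - φ (N.ident v)| ≤ (2 * i + 1) * 2 ^ N.edgeClass u v := by
  have hcard := Clustering.card_selectedNeighbors_ne_of_cluster_next_eq_none
    (exists_isSample hd _) (ident_mem_ids u) hu hnone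
  obtain ⟨a, ha, hav⟩ : ∃ a ∈ selectedNeighbors (N.board ε (s.post J d)) (N.edgeClass u v)
      (N.ident u), s.cluster (N.edgeClass u v) a = s.cluster (N.edgeClass u v) (N.ident v) := by
    rw [selectedNeighbors_board, if_pos ⟨hJ, hu⟩] at hcard ⊢
    exact (representatives_spec _ _ _).2.2.2.resolve_left hcard _
      (mem_clusteredNeighbors.2 ⟨v, huv, rfl, hv, rfl⟩)
  obtain ⟨w, rfl, -⟩ := of_mem_selectedNeighbors ha
  obtain ⟨k, hvk⟩ := Option.isSome_iff_exists.1 hv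
  have hedge := hφ _ _ _ (Or.inr ⟨ident_mem_ids u, ha⟩)
  have hw := h.radius φ hφ.of_next _ w k (hav.trans hvk)
  have hv' := h.radius φ hφ.of_next _ v k hvk
  rw [abs_sub_comm] at hv'
  calc |φ (N.ident u) - φ (N.ident v)|
      ≤ |φ (N.ident u) - φ (N.ident w)| + |φ (N.ident w) - φ k| + |φ k - φ (N.ident v)| :=
        (abs_sub_le _ (φ k) _).trans (add_le_add_left (abs_sub_le _ _ _) _)
    _ ≤ (2 * i + 1) * 2 ^ N.edgeClass u v := by linarith

lemma card_clusters_next_le (h : N.ClusteringInvariant i s) (hd : 2 * Fintype.card V < 2 ^ d)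
    (j : ℕ) : #((s.next N.ids d (N.board ε (s.post J d))).clusters N.ids j) * 2 ^ (i + 1) ≤
      Fintype.card V := by
  have hsub : (s.next N.ids d (N.board ε (s.post J d))).clusters N.ids j ⊆
      s.sample N.ids d (N.board ε (s.post J d)) j := fun k hk => by
    obtain ⟨a, -, hak⟩ := Clustering.mem_clusters.1 hk
    exact (Clustering.of_cluster_next_eq_some hak).1
  have hhalf := (Clustering.isSample_sample (exists_isSample (N := N) (ε := ε) (J := J)
    (s := s) hd j)).2.1
  refine le_trans ?_ (h.card_le j)
  rw [pow_succ, mul_comm _ 2, ← mul_assoc]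
  exact Nat.mul_le_mul_right _ (by have := card_le_card hsub; omega)

lemma next (h : N.ClusteringInvariant i s) (hd : 2 * Fintype.card V < 2 ^ d)
    (hJ : ∀ u v, N.graph.Adj u v → N.edgeClass u v < J) :
    N.ClusteringInvariant (i + 1) (s.next N.ids d (N.board ε (s.post J d))) where
  isEdge _ _ _ := h.isEdge_next
  radius φ hφ j v k hk := by
    exact_mod_cast h.abs_sub_le_of_cluster_next_eq_some hφ hk
  stretch φ hφ u v huv := by
    suffices hweak : _ ∨ |φ (N.ident u) - φ (N.ident v)| ≤ (2 * i + 1) * 2 ^ N.edgeClass u v from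
      hweak.imp_right fun hle => hle.trans (by push_cast; gcongr; linarith)
    rcases h.stretch φ hφ.of_next u v huv with ⟨hu, hv⟩ | hle
    · refine or_iff_not_imp_left.2 fun hnot => ?_
      rw [not_and_or, Option.not_isSome_iff_eq_none, Option.not_isSome_iff_eq_none] at hnot
      rcases hnot with hnone | hnone
      · exact h.abs_sub_le_of_cluster_next_eq_none hd hφ huv (hJ u v huv) hu hv hnone
      · rw [abs_sub_comm]
        rw [edgeClass_comm] at hu hv hnone ⊢
        exact h.abs_sub_le_of_cluster_next_eq_none hd hφ huv.symm (hJ v u huv.symm) hv hu hnone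
    · exact Or.inr hle
  card_le := h.card_clusters_next_le hd

end ClusteringInvariant

/-- The selected edges are edges of the network, and they preserve distances up to a logarithmic
factor. -/
structure IsSparsifier (N : Network V) (s : Clustering) : Prop where
  isEdge : ∀ j a b, s.selected j a b →
    ∃ u v, a = N.ident u ∧ b = N.ident v ∧ N.graph.Adj u v ∧ N.edgeClass u v = j
  stretch : ∀ φ, s.Respects φ → ∀ u v, N.graph.Adj u v →
    |φ (N.ident u) - φ (N.ident v)| ≤ (2 * bitLength V + 1) * 2 ^ N.edgeClass u v

/-- After `bitLength V` halvings no cluster is left. -/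
lemma ClusteringInvariant.isSparsifier (h : N.ClusteringInvariant (bitLength V) s) :
    N.IsSparsifier s where
  isEdge := h.isEdge
  stretch φ hφ u v huv := by
    refine (h.stretch φ hφ u v huv).resolve_left fun ⟨hu, _⟩ => ?_
    obtain ⟨k, hk⟩ := Option.isSome_iff_exists.1 hu
    have hpos : 0 < #(s.clusters N.ids (N.edgeClass u v)) :=
      card_pos.2 ⟨k, Clustering.mem_clusters.2 ⟨_, ident_mem_ids u, hk⟩⟩
    exact absurd ((Nat.le_mul_of_pos_left _ hpos).trans (h.card_le (N.edgeClass u v)))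
      card_lt_two_pow_bitLength.not_ge

lemma one_le_bitLength : 1 ≤ bitLength V := Nat.le_add_left _ _

lemma PolyBounded.ident_lt (hN : N.PolyBounded c) (v : V) :
    N.ident v < 2 ^ ((c + 1) * bitLength V) :=
  (hN.ident_le v).trans_lt
    (Nat.pow_lt_pow_right one_lt_two (by have := one_le_bitLength (V := V); nlinarith))

lemma PolyBounded.add_one_lt_of_mem_post (hN : N.PolyBounded c) {v : V} {x : ℕ}
    (hx : x ∈ s.post (c * bitLength V + 1) d (N.localInput ε v)) :
    x + 1 < 2 ^ (2 * ((c + 1) * bitLength V) + 1) := by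
  obtain ⟨j, hj, -, a, ha, rfl⟩ := Clustering.mem_post.1 hx
  obtain ⟨u, -, -, -, rfl⟩ := mem_clusteredNeighbors.1 ((representatives_spec _ _ _).1 ha)
  refine pair_add_one_lt ?_ (hN.ident_lt u)
  calc j ≤ c * bitLength V := Nat.le_of_lt_succ hj
    _ ≤ (c + 1) * bitLength V := Nat.mul_le_mul_right _ c.le_succ
    _ < 2 ^ ((c + 1) * bitLength V) := Nat.lt_two_pow_self

lemma meets_sparsify (hN : N.PolyBounded c) {β : ℕ}
    (hβ : 2 * ((c + 1) * bitLength V) + 1 ≤ β) :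
    (sparsify N.ids (c * bitLength V + 1) (bitLength V)).Meets N ε β
      (bitLength V * (2 * (Fintype.card V *
        ((c * bitLength V + 1) * (bitLength V + 1) + 1)))) N.IsSparsifier := by
  have hcard : 2 * Fintype.card V < 2 ^ (bitLength V + 1) := by
    rw [pow_succ']
    exact Nat.mul_lt_mul_of_pos_left card_lt_two_pow_bitLength two_pos
  refine (BoardProgram.meets_iter N.ClusteringInvariant clusteringInvariant_zero
    fun i _ s hs => ?_).mono le_rfl fun s => ClusteringInvariant.isSparsifier
  exact BoardProgram.meets_ask (T := 0)
    (fun v a ha => (hN.add_one_lt_of_mem_post ha).trans_le (Nat.pow_le_pow_right two_pos hβ))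
    (fun v => Clustering.card_post_le _ _)
    (hs.next hcard fun u v huv => hN.edgeClass_lt huv)

end Network

/-! ### Multiplicative weights -/

/-- The flow sent along an arc of cost `w` with potential difference `d` in a network of `n`
nodes: the exponential weight `exp (η * d / w)` of the arc, divided by `w` and normalized such that
the total cost is at most `g` as long as the total weight is at most `n ^ 2 * exp s`. -/
def arcFlow (n : ℕ) (g η s d : ℝ) (w : ℕ) : ℝ := g * Real.exp (η * (d / w) - s) / (n ^ 2 * w)

lemma arcFlow_nonneg {n : ℕ} {g η s d : ℝ} {w : ℕ} (hg : 0 ≤ g) : 0 ≤ arcFlow n g η s d w := by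
  unfold arcFlow
  positivity

lemma exp_mul_le_one_add {η z : ℝ} (hη : 0 ≤ η) (hη1 : η ≤ 1) (hz : |z| ≤ 1) :
    Real.exp (η * z) ≤ 1 + η * z + η ^ 2 := by
  have hηz : |η * z| ≤ 1 := by
    rw [abs_mul, abs_of_nonneg hη]
    exact mul_le_one₀ hη1 (abs_nonneg _) hz
  have hsq : (η * z) ^ 2 ≤ η ^ 2 := by
    rw [mul_pow]
    exact mul_le_of_le_one_right (sq_nonneg η) ((sq_le_one_iff_abs_le_one z).2 hz)
  linarith [(abs_le.1 (Real.abs_exp_sub_one_sub_id_le hηz)).2]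

namespace Network

variable {V : Type} [Fintype V] {N : Network V}

lemma one_le_cost {u v : V} (h : N.graph.Adj u v) : (1 : ℝ) ≤ N.cost u v := by
  exact_mod_cast N.cost_pos u v h

lemma dualValue_mul (k : ℝ) (y : V → ℝ) :
    N.dualValue (fun v => k * y v) = k * N.dualValue y := by
  rw [dualValue, dualValue, mul_sum]
  exact sum_congr rfl fun v _ => by ring

lemma dualValue_add (y z : V → ℝ) : N.dualValue (y + z) = N.dualValue y + N.dualValue z := by
  simp only [dualValue, Pi.add_apply, mul_add, sum_add_distrib]

open Classical in
variable (N) in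
/-- The sum of the exponential weights `exp (η * (Φ v - Φ u) / cost u v)` of all arcs `(u, v)`: a
smooth substitute for the largest stretch of an arc under the potential `Φ`. -/
def totalWeight (η : ℝ) (Φ : V → ℝ) : ℝ :=
  ∑ u, ∑ v, if N.graph.Adj u v then Real.exp (η * ((Φ v - Φ u) / N.cost u v)) else 0

lemma exp_le_totalWeight (η : ℝ) (Φ : V → ℝ) {u v : V} (h : N.graph.Adj u v) :
    Real.exp (η * ((Φ v - Φ u) / N.cost u v)) ≤ N.totalWeight η Φ := by
  classical
  have hnonneg : ∀ a b : V, 0 ≤ if N.graph.Adj a b then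
      Real.exp (η * ((Φ b - Φ a) / N.cost a b)) else 0 := fun a b => by
    split_ifs
    · positivity
    · rfl
  calc Real.exp (η * ((Φ v - Φ u) / N.cost u v))
      = if N.graph.Adj u v then Real.exp (η * ((Φ v - Φ u) / N.cost u v)) else 0 := (if_pos h).symm
    _ ≤ ∑ b, if N.graph.Adj u b then Real.exp (η * ((Φ b - Φ u) / N.cost u b)) else 0 :=
      single_le_sum (f := fun b => if N.graph.Adj u b then
        Real.exp (η * ((Φ b - Φ u) / N.cost u b)) else 0) (fun b _ => hnonneg u b) (mem_univ v)
    _ ≤ N.totalWeight η Φ := by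
      unfold totalWeight
      convert single_le_sum (f := fun a => ∑ b, if N.graph.Adj a b then
        Real.exp (η * ((Φ b - Φ a) / N.cost a b)) else 0)
        (fun a _ => sum_nonneg fun b _ => hnonneg a b) (mem_univ u)

lemma isPotential_of_totalWeight_lt {g η : ℝ} {Φ : V → ℝ} (hg : 0 < g) (hη : 0 < η)
    (hadj : ∃ u v, N.graph.Adj u v)
    (hW : N.totalWeight η Φ < Real.exp (η * (N.dualValue Φ / g))) :
    N.IsPotential (fun v => g / N.dualValue Φ * Φ v) ∧
      N.dualValue (fun v => g / N.dualValue Φ * Φ v) = g := by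
  have hstretch : ∀ u v, N.graph.Adj u v → Φ v - Φ u < N.dualValue Φ / g * N.cost u v := by
    intro u v h
    have hcost : (0 : ℝ) < N.cost u v := by linarith [one_le_cost h]
    rw [← div_lt_iff₀ hcost]
    exact lt_of_mul_lt_mul_left
      (Real.exp_lt_exp.1 ((exp_le_totalWeight η Φ h).trans_lt hW)) hη.le
  have hpos : 0 < N.dualValue Φ := by
    obtain ⟨u, v, h⟩ := hadj
    by_contra! hneg
    have hratio : N.dualValue Φ / g ≤ 0 := div_nonpos_of_nonpos_of_nonneg hneg hg.le
    nlinarith [hstretch u v h, hstretch v u h.symm, one_le_cost h, one_le_cost h.symm]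
  constructor
  · intro u v h
    calc g / N.dualValue Φ * Φ v - g / N.dualValue Φ * Φ u
        = g / N.dualValue Φ * (Φ v - Φ u) := by ring
      _ ≤ g / N.dualValue Φ * (N.dualValue Φ / g * N.cost u v) :=
          mul_le_mul_of_nonneg_left (hstretch u v h).le (by positivity)
      _ = N.cost u v := by field_simp
  · rw [dualValue_mul]
    field_simp

open Classical in
variable (N) in
/-- The flow proportional to the exponential weights, see `arcFlow`. -/
def weightFlow (g η s : ℝ) (Φ : V → ℝ) (u v : V) : ℝ :=
  if N.graph.Adj u v then arcFlow (Fintype.card V) g η s (Φ v - Φ u) (N.cost u v) else 0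

open Classical in
variable (N) in
/-- The flow `weightFlow` rounded down to multiples of `1 / K`, so that it can be communicated. -/
def roundedFlow (K : ℕ) (g η s : ℝ) (Φ : V → ℝ) (u v : V) : ℝ :=
  if N.graph.Adj u v then
    (⌊K * arcFlow (Fintype.card V) g η s (Φ v - Φ u) (N.cost u v)⌋₊ : ℝ) / K else 0

lemma weightFlow_nonneg {g η s : ℝ} {Φ : V → ℝ} (hg : 0 ≤ g) (u v : V) :
    0 ≤ N.weightFlow g η s Φ u v := by
  unfold weightFlow
  split_ifs
  · exact arcFlow_nonneg hg
  · rfl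

lemma roundedFlow_nonneg {K : ℕ} {g η s : ℝ} {Φ : V → ℝ} (u v : V) :
    0 ≤ N.roundedFlow K g η s Φ u v := by
  unfold roundedFlow
  split_ifs
  · positivity
  · rfl

lemma roundedFlow_le {K : ℕ} (hK : 0 < K) {g η s : ℝ} {Φ : V → ℝ} (hg : 0 ≤ g) (u v : V) :
    N.roundedFlow K g η s Φ u v ≤ N.weightFlow g η s Φ u v := by
  have hK' : (0 : ℝ) < K := by exact_mod_cast hK
  unfold roundedFlow weightFlow
  split_ifs
  · rw [div_le_iff₀ hK']
    exact (Nat.floor_le (mul_nonneg hK'.le (arcFlow_nonneg hg))).trans (mul_comm _ _).le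
  · rfl

lemma weightFlow_sub_roundedFlow_le {K : ℕ} (hK : 0 < K) {g η s : ℝ} {Φ : V → ℝ} (u v : V) :
    N.weightFlow g η s Φ u v - N.roundedFlow K g η s Φ u v ≤ 1 / K := by
  have hK' : (0 : ℝ) < K := by exact_mod_cast hK
  unfold roundedFlow weightFlow
  split_ifs
  · rw [sub_le_iff_le_add, ← add_div, le_div_iff₀ hK', mul_comm, add_comm]
    exact (Nat.lt_floor_add_one _).le
  · simp

lemma card_pos (N : Network V) : 0 < Fintype.card V :=
  have := N.connected.nonempty
  Fintype.card_pos

lemma weightFlow_mul_cost {g η s : ℝ} {Φ : V → ℝ} {u v : V}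
    (h : N.graph.Adj u v) : N.weightFlow g η s Φ u v * N.cost u v =
      g / (Fintype.card V ^ 2 * Real.exp s) * Real.exp (η * ((Φ v - Φ u) / N.cost u v)) := by
  have hcost := one_le_cost h
  have : (0 : ℝ) < Fintype.card V := Nat.cast_pos.2 N.card_pos
  simp only [weightFlow, arcFlow, if_pos h]
  rw [Real.exp_sub]
  field_simp

lemma sum_cost_weightFlow_le {g η s : ℝ} {Φ : V → ℝ} (hg : 0 ≤ g)
    (hW : N.totalWeight η Φ ≤ Fintype.card V ^ 2 * Real.exp s) :
    ∑ u, ∑ v, N.cost u v * N.weightFlow g η s Φ u v ≤ g := by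
  have : (0 : ℝ) < Fintype.card V := Nat.cast_pos.2 N.card_pos
  have hsum : ∑ u, ∑ v, N.cost u v * N.weightFlow g η s Φ u v =
      g / (Fintype.card V ^ 2 * Real.exp s) * N.totalWeight η Φ := by
    simp only [totalWeight, mul_sum]
    refine sum_congr rfl fun u _ => sum_congr rfl fun v _ => ?_
    split_ifs with h
    · rw [mul_comm, weightFlow_mul_cost h]
    · simp [weightFlow, h]
  rw [hsum, div_mul_eq_mul_div, div_le_iff₀ (by positivity)]
  exact mul_le_mul_of_nonneg_left hW hg

/-- The potential differences along each edge are, in absolute value, at most the costs of the edge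
in either direction. -/
def IsSlack (N : Network V) (y : V → ℝ) : Prop :=
  ∀ u v, N.graph.Adj u v → |y v - y u| ≤ N.cost u v

lemma totalWeight_add_le_linear {g η : ℝ} (s : ℝ) (Φ : V → ℝ) {y : V → ℝ}
    (hg : 0 < g) (hη : 0 ≤ η) (hη1 : η ≤ 1) (hy : N.IsSlack y) :
    N.totalWeight η (Φ + y) ≤ (1 + η ^ 2) * N.totalWeight η Φ +
      η * (Fintype.card V ^ 2 * Real.exp s) / g *
        ∑ u, ∑ v, N.weightFlow g η s Φ u v * (y v - y u) := by
  have : (0 : ℝ) < Fintype.card V := Nat.cast_pos.2 N.card_pos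
  simp only [totalWeight, mul_sum, ← sum_add_distrib]
  refine sum_le_sum fun u _ => sum_le_sum fun v _ => ?_
  split_ifs with h
  · have hcost : (0 : ℝ) < N.cost u v := by linarith [one_le_cost h]
    obtain ⟨z, hz⟩ : ∃ z, y v - y u = N.cost u v * z :=
      ⟨(y v - y u) / N.cost u v, by field_simp⟩
    have hz1 : |z| ≤ 1 := by
      have hslack := hy u v h
      rw [hz, abs_mul, abs_of_pos hcost] at hslack
      exact le_of_mul_le_mul_left (by linarith) hcost
    have hflow : η * (Fintype.card V ^ 2 * Real.exp s) / g *
        (N.weightFlow g η s Φ u v * (y v - y u)) =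
          Real.exp (η * ((Φ v - Φ u) / N.cost u v)) * (η * z) := by
      rw [hz, ← mul_assoc (N.weightFlow g η s Φ u v), weightFlow_mul_cost h]
      field_simp
    have hexponent : η * (((Φ + y) v - (Φ + y) u) / N.cost u v) =
        η * ((Φ v - Φ u) / N.cost u v) + η * z := by
      rw [Pi.add_apply, Pi.add_apply, add_sub_add_comm, hz]
      field_simp
    rw [hflow, hexponent, Real.exp_add]
    nlinarith [exp_mul_le_one_add hη hη1 hz1, Real.exp_pos (η * ((Φ v - Φ u) / N.cost u v))]
  · simp [weightFlow, h]

/-- One step of the multiplicative weights method. -/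
lemma totalWeight_add_le {g η s γ : ℝ} {Φ y : V → ℝ} (hg : 0 < g) (hη : 0 ≤ η)
    (hη1 : η ≤ 1) (hW : N.totalWeight η Φ ≤ Fintype.card V ^ 2 * Real.exp s) (hy : N.IsSlack y)
    (hgap : ∑ u, ∑ v, N.weightFlow g η s Φ u v * (y v - y u) ≤ N.dualValue y - g * γ) :
    N.totalWeight η (Φ + y) ≤
      Fintype.card V ^ 2 * Real.exp (s + η * N.dualValue y / g - η * γ + η ^ 2) := by
  set A : ℝ := Fintype.card V ^ 2 * Real.exp s with hA
  have hA0 : 0 ≤ A := by positivity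
  calc N.totalWeight η (Φ + y)
      ≤ (1 + η ^ 2) * N.totalWeight η Φ +
          η * A / g * ∑ u, ∑ v, N.weightFlow g η s Φ u v * (y v - y u) :=
        totalWeight_add_le_linear s Φ hg hη hη1 hy
    _ ≤ (1 + η ^ 2) * A + η * A / g * (N.dualValue y - g * γ) := by gcongr
    _ = A * (η * N.dualValue y / g - η * γ + η ^ 2 + 1) := by
        field_simp
        ring
    _ ≤ A * Real.exp (η * N.dualValue y / g - η * γ + η ^ 2) :=
        mul_le_mul_of_nonneg_left (Real.add_one_le_exp _) hA0
    _ = Fintype.card V ^ 2 * Real.exp (s + η * N.dualValue y / g - η * γ + η ^ 2) := by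
        rw [hA, mul_assoc, ← Real.exp_add]
        congr 2
        ring

end Network

/-! ### Routing on the sparse subgraph -/

namespace Clustering

/-- Two identifiers are joined if the edge between them has been selected, in whichever direction
and for whichever class. -/
def Joined (H : Clustering) (a b : ℕ) : Prop := ∃ j, H.selected j a b ∨ H.selected j b a

/-- The smallest class for which the edge between `a` and `b` has been selected; it is `0` if
they are not joined. -/
def level (H : Clustering) (a b : ℕ) : ℕ := sInf {j | H.selected j a b ∨ H.selected j b a}

lemma level_spec {H : Clustering} {a b : ℕ} (h : H.Joined a b) :
    H.selected (H.level a b) a b ∨ H.selected (H.level a b) b a :=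
  Nat.sInf_mem (s := {j | H.selected j a b ∨ H.selected j b a}) h

lemma level_le {H : Clustering} {j a b : ℕ} (h : H.selected j a b ∨ H.selected j b a) :
    H.level a b ≤ j :=
  Nat.sInf_le h

/-- The flow `F` on the selected edges satisfies the demands `r` and costs at most `τ`, where the
cost of an edge of level `j` is `2 ^ j` in both directions. -/
structure IsRouting (H : Clustering) (ids : Finset ℕ) (r : ℕ → ℝ) (τ : ℝ) (F : ℕ → ℕ → ℝ) :
    Prop where
  nonneg : ∀ a b, 0 ≤ F a b
  support : ∀ a b, ¬H.Joined a b → F a b = 0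
  cost_le : ∑ a ∈ ids, ∑ b ∈ ids, 2 ^ H.level a b * F a b ≤ τ
  netFlow_eq : ∀ a ∈ ids, ∑ b ∈ ids, F b a - ∑ b ∈ ids, F a b = r a

/-- A dual certificate that no routing of the demands `r` has cost at most `τ`. -/
structure IsWitness (H : Clustering) (ids : Finset ℕ) (r : ℕ → ℝ) (τ : ℝ) (φ : ℕ → ℝ) :
    Prop where
  respects : H.Respects φ
  lt : τ < ∑ a ∈ ids, r a * φ a

section

variable {H : Clustering} {ids : Finset ℕ} {r : ℕ → ℝ} {τ : ℝ}

open Classical in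
lemma isRouting_of_mem_cheapFlows {f : ids → ids → ℝ}
    (hf : f ∈ cheapFlows (fun a b : ids => H.Joined a b) (fun a b => 2 ^ H.level a b) τ)
    (hr : netFlow f = fun a : ids => r a) :
    H.IsRouting ids r τ
      fun a b => if h : a ∈ ids ∧ b ∈ ids then f ⟨a, h.1⟩ ⟨b, h.2⟩ else 0 := by
  obtain ⟨hnonneg, hsupport, hcost⟩ := hf
  refine ⟨fun a b => ?_, fun a b hab => ?_, ?_, fun a ha => ?_⟩
  · split_ifs
    · exact hnonneg _ _
    · rfl
  · split_ifs
    · exact hsupport _ _ hab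
    · rfl
  · simpa only [← sum_coe_sort ids, coe_mem, and_self, dite_true] using hcost
  · simpa only [netFlow_apply, ← sum_coe_sort ids, coe_mem, ha, and_self, dite_true] using
      congrFun hr ⟨a, ha⟩

open Classical in
lemma isWitness_of_potential {φ : ids → ℝ}
    (hH : ∀ j a b, H.selected j a b → a ∈ ids ∧ b ∈ ids)
    (hφ : ∀ a b : ids, H.Joined a b → φ b - φ a ≤ 2 ^ H.level a b) (hτ : τ < ∑ a : ids, r a * φ a) :
    H.IsWitness ids r τ fun a => if h : a ∈ ids then φ ⟨a, h⟩ else 0 := by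
  refine ⟨fun j a b hab => ?_, ?_⟩
  · obtain ⟨ha, hb⟩ := hH j a b hab
    have hpow : ∀ {a b}, H.selected j a b ∨ H.selected j b a → (2 : ℝ) ^ H.level a b ≤ 2 ^ j :=
      fun h => pow_le_pow_right₀ one_le_two (level_le h)
    simp only [ha, hb, dite_true]
    exact abs_le.2 ⟨by linarith [hφ ⟨a, ha⟩ ⟨b, hb⟩ ⟨j, .inl hab⟩, hpow (.inl hab)],
      by linarith [hφ ⟨b, hb⟩ ⟨a, ha⟩ ⟨j, .inr hab⟩, hpow (.inr hab)]⟩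
  · simpa only [← sum_coe_sort ids, coe_mem, dite_true] using hτ

lemma exists_isRouting_or_isWitness (hH : ∀ j a b, H.selected j a b → a ∈ ids ∧ b ∈ ids)
    (r : ℕ → ℝ) (hτ : 0 < τ) :
    (∃ F, H.IsRouting ids r τ F) ∨ ∃ φ, H.IsWitness ids r τ φ := by
  rcases exists_flow_or_potential (R := fun a b : ids => H.Joined a b)
    (c := fun a b => 2 ^ H.level a b) (fun a b _ => by positivity) (fun a : ids => r a) hτ with
    ⟨f, hf, hr⟩ | ⟨φ, hφ, hlt⟩
  · exact .inl ⟨_, isRouting_of_mem_cheapFlows hf hr⟩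
  · exact .inr ⟨_, isWitness_of_potential hH hφ hlt⟩

end

end Clustering

/-! ### The multiplicative weights program -/

/-- What every node knows about the instance after the first exchange: the identifiers, the
demands, and an integer upper bound for the asymmetry. -/
structure Setup where
  ids : Finset ℕ
  demand : ℕ → ℤ
  ratio : ℕ

/-- A pair of a potential and a flow known to every node. Nodes are given by their identifiers,
and `flow a b w` is the flow on the arc from `a` to `b` if its cost is `w`: the cost is an argument
because only the endpoints of an arc know it. -/
structure Solution where
  potential : ℕ → ℝ
  flow : ℕ → ℕ → ℕ → ℝ

namespace Setup

variable (S : Setup) (c : ℕ) (ε : ℝ)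

/-- The bit length of the number of nodes. -/
def bits : ℕ := Nat.log 2 #S.ids + 1

/-- The stretch of the sparse subgraph. -/
def stretch : ℝ := 2 * S.bits + 1

/-- The relative amount by which the routing cost of the residual demands exceeds the guess in an
iteration that does not terminate: the parameter `γ` of `Network.totalWeight_add_le`. Half of
it is the step size. -/
def gap : ℝ := ε / 3 / (4 * S.ratio * S.stretch)

/-- The number `K` such that flows are rounded to multiples of `1 / K`. -/
def precision : ℕ := 2 ^ ((2 * c + 10) * S.bits)

/-- The dual value of a potential that is indexed by identifiers. -/
def dual (φ : ℕ → ℝ) : ℝ := ∑ a ∈ S.ids, (S.demand a : ℝ) * φ a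

/-- The logarithm of the bound for the total weight after `t` iterations, see
`Network.WeightInvariant`. -/
def shift (g : ℝ) (t : ℕ) (Φ : ℕ → ℝ) : ℝ :=
  S.gap ε / 2 * S.dual Φ / g - t * (S.gap ε ^ 2 / 4)

/-- The rounded flow on an arc from `a` to `b` of cost `w`, as a multiple of the reciprocal of the
precision. -/
def units (g : ℝ) (t : ℕ) (Φ : ℕ → ℝ) (a b w : ℕ) : ℕ :=
  ⌊S.precision c * arcFlow #S.ids g (S.gap ε / 2) (S.shift ε g t Φ) (Φ b - Φ a) w⌋₊

/-- The post in an iteration: the pair of the rounded inflow and outflow of the node. -/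
def flowPost (g : ℝ) (t : ℕ) (Φ : ℕ → ℝ) (inp : LocalInput) : Finset ℕ :=
  {Nat.pair (∑ x ∈ inp.incident, S.units c ε g t Φ x.1 inp.ident x.2.2)
    (∑ x ∈ inp.incident, S.units c ε g t Φ inp.ident x.1 x.2.1)}

/-- The demands that the rounded flow leaves unsatisfied, decoded from the posts `flowPost`. -/
def residual (board : Finset ℕ) (a : ℕ) : ℝ :=
  S.demand a - (((postedNumber board a).unpair.1 : ℝ) - (postedNumber board a).unpair.2) /
    S.precision c

open Classical in
/-- The iteration for the guess `g` of the optimum: either the residual demands can be routed on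
the sparse subgraph at negligible cost, which yields a solution together with the known potential
`y`, or a witness against such a routing improves the potential `Φ`. -/
def mwStep (H : Clustering) (g : ℝ) (y : ℕ → ℝ) (t : ℕ) (Φ : ℕ → ℝ) :
    BoardProgram (Solution ⊕ (ℕ → ℝ)) :=
  .ask (S.flowPost c ε g t Φ) fun board =>
    if h : ∃ F, H.IsRouting S.ids (S.residual c board) (ε / 3 * g / (2 * S.ratio)) F then
      .pure (Sum.inl ⟨y, fun a b w => S.units c ε g t Φ a b w / S.precision c + h.choose a b⟩)
    else if h : ∃ φ, H.IsWitness S.ids (S.residual c board) (ε / 3 * g / (2 * S.ratio)) φ then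
      .pure (Sum.inr (Φ + fun a => 1 / S.stretch * h.choose a))
    else .pure (Sum.inr Φ)

lemma one_le_stretch : 1 ≤ S.stretch := by
  unfold stretch
  linarith [S.bits.cast_nonneg (α := ℝ)]

lemma stretch_le : S.stretch ≤ 2 ^ (2 * S.bits) := by
  have hbits : ((S.bits + 1 : ℕ) : ℝ) ≤ 2 ^ S.bits := by exact_mod_cast Nat.lt_two_pow_self
  push_cast at hbits
  rw [stretch, mul_comm 2 S.bits, pow_mul]
  nlinarith [S.bits.cast_nonneg (α := ℝ)]

lemma precision_pos : 0 < S.precision c := by unfold precision; positivity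

end Setup

namespace Network

variable {V : Type} [Fintype V] {N : Network V} {ε : ℝ} {c : ℕ}

variable (N) in
/-- The public knowledge `S` is correct, and its bound for the asymmetry is polynomial. -/
structure IsSetup (c : ℕ) (S : Setup) : Prop where
  ids_eq : S.ids = N.ids
  demand_eq : ∀ v, S.demand (N.ident v) = N.demand v
  one_le_ratio : 1 ≤ S.ratio
  ratio_le : S.ratio ≤ 2 ^ ((c + 1) * bitLength V)
  cost_le : ∀ u v, N.graph.Adj u v → N.cost u v ≤ S.ratio * N.cost v u

variable (N) in
/-- The public solution is a `(1 + ε)`-approximate solution. -/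
def IsGood (ε : ℝ) (sol : Solution) : Prop :=
  ∃ f, N.IsApproxPair ε f (sol.potential ∘ N.ident) ∧
    ∀ u v, N.graph.Adj u v → f u v = sol.flow (N.ident u) (N.ident v) (N.cost u v)

variable (N) in
/-- The weight flow for the parameters of the iteration `t` with guess `g` and potential `Φ`. -/
abbrev idealFlow (ε : ℝ) (S : Setup) (g : ℝ) (t : ℕ) (Φ : ℕ → ℝ) : V → V → ℝ :=
  N.weightFlow g (S.gap ε / 2) (S.shift ε g t Φ) (Φ ∘ N.ident)

variable (N) in
/-- The rounding of `idealFlow` that the nodes announce with `Setup.flowPost`. -/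
abbrev sentFlow (c : ℕ) (ε : ℝ) (S : Setup) (g : ℝ) (t : ℕ) (Φ : ℕ → ℝ) : V → V → ℝ :=
  N.roundedFlow (S.precision c) g (S.gap ε / 2) (S.shift ε g t Φ) (Φ ∘ N.ident)

lemma sum_ids {M : Type*} [AddCommMonoid M] (F : ℕ → M) :
    ∑ a ∈ N.ids, F a = ∑ v, F (N.ident v) :=
  sum_image fun _ _ _ _ h => N.ident_injective h

open Classical in
lemma sum_incident {M : Type*} [AddCommMonoid M] (v : V) (F : ℕ × ℕ × ℕ → M) :
    ∑ x ∈ (N.localInput ε v).incident, F x =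
      ∑ u, if N.graph.Adj v u then F (N.ident u, N.cost v u, N.cost u v) else 0 := by
  rw [← sum_filter]
  exact sum_image fun a _ b _ h => N.ident_injective (Prod.ext_iff.1 h).1

namespace IsSetup

variable {S : Setup}

lemma card_ids (h : N.IsSetup c S) : #S.ids = Fintype.card V := by
  rw [h.ids_eq, Network.card_ids]

lemma bits_eq (h : N.IsSetup c S) : S.bits = bitLength V := by
  rw [Setup.bits, h.card_ids, bitLength]

lemma dual_eq (h : N.IsSetup c S) (φ : ℕ → ℝ) : S.dual φ = N.dualValue (φ ∘ N.ident) := by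
  rw [Setup.dual, h.ids_eq, sum_ids]
  simp only [h.demand_eq, dualValue, Function.comp_apply]

lemma one_le_ratio_real (h : N.IsSetup c S) : (1 : ℝ) ≤ S.ratio := by
  exact_mod_cast h.one_le_ratio

lemma gap_pos (h : N.IsSetup c S) (hε : 0 < ε) : 0 < S.gap ε := by
  have := h.one_le_ratio_real
  have := S.one_le_stretch
  unfold Setup.gap
  positivity

lemma gap_le_one (h : N.IsSetup c S) (hε1 : ε ≤ 1) : S.gap ε ≤ 1 := by
  have hratio := h.one_le_ratio_real
  have hstretch := S.one_le_stretch
  unfold Setup.gap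
  rw [div_le_one (by positivity)]
  nlinarith

lemma div_two_pow_le_gap (h : N.IsSetup c S) (hε : 0 < ε) :
    ε / 2 ^ ((c + 7) * bitLength V) ≤ S.gap ε := by
  have := h.one_le_ratio_real
  have := S.one_le_stretch
  have hratio : (S.ratio : ℝ) ≤ 2 ^ ((c + 1) * bitLength V) := by exact_mod_cast h.ratio_le
  have hstretch : S.stretch ≤ 2 ^ (2 * bitLength V) := h.bits_eq ▸ S.stretch_le
  have htwelve : (12 : ℝ) ≤ 2 ^ (4 * bitLength V) := by
    calc (12 : ℝ) ≤ 2 ^ 4 := by norm_num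
      _ ≤ 2 ^ (4 * bitLength V) :=
        pow_le_pow_right₀ one_le_two (Nat.le_mul_of_pos_right 4 one_le_bitLength)
  calc ε / 2 ^ ((c + 7) * bitLength V)
      = ε / (2 ^ (4 * bitLength V) * 2 ^ ((c + 1) * bitLength V) * 2 ^ (2 * bitLength V)) := by
        rw [← pow_add, ← pow_add]
        ring_nf
    _ ≤ ε / (12 * S.ratio * S.stretch) := by gcongr
    _ = S.gap ε := by
        unfold Setup.gap
        field_simp
        norm_num

lemma rounding_le (h : N.IsSetup c S) (hε : 0 < ε) (hn : 1 ≤ Fintype.card V * ε) :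
    (Fintype.card V : ℝ) ^ 2 * 2 ^ (c * bitLength V) / S.precision c ≤ S.gap ε := by
  have hcard : (Fintype.card V : ℝ) ≤ 2 ^ bitLength V := cast_card_le_two_pow_bitLength
  have hprecision : (S.precision c : ℝ) = 2 ^ ((2 * c + 10) * bitLength V) := by
    rw [Setup.precision, h.bits_eq]
    norm_cast
  refine le_trans ?_ (h.div_two_pow_le_gap hε)
  rw [hprecision, div_le_div_iff₀ (by positivity) (by positivity)]
  calc (Fintype.card V : ℝ) ^ 2 * 2 ^ (c * bitLength V) * 2 ^ ((c + 7) * bitLength V)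
      ≤ (2 ^ bitLength V) ^ 2 * 2 ^ (c * bitLength V) * 2 ^ ((c + 7) * bitLength V) *
          (Fintype.card V * ε) := by
        refine (le_mul_of_one_le_right (by positivity) hn).trans ?_
        gcongr
    _ ≤ (2 ^ bitLength V) ^ 2 * 2 ^ (c * bitLength V) * 2 ^ ((c + 7) * bitLength V) *
          (2 ^ bitLength V * ε) := by gcongr
    _ = ε * 2 ^ ((2 * c + 10) * bitLength V) := by ring

lemma units_div (h : N.IsSetup c S) {g : ℝ} {t : ℕ} {Φ : ℕ → ℝ} {u v : V}
    (huv : N.graph.Adj u v) :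
    (S.units c ε g t Φ (N.ident u) (N.ident v) (N.cost u v) : ℝ) / S.precision c =
      N.sentFlow c ε S g t Φ u v := by
  rw [sentFlow, roundedFlow, if_pos huv, Setup.units, h.card_ids]
  rfl

lemma residual_board (h : N.IsSetup c S) (g : ℝ) (t : ℕ) (Φ : ℕ → ℝ) (v : V) :
    S.residual c (N.board ε (S.flowPost c ε g t Φ)) (N.ident v) =
      N.demand v - netFlow (N.sentFlow c ε S g t Φ) v := by
  classical
  have hident : (N.localInput ε v).ident = N.ident v := rfl
  rw [Setup.residual, h.demand_eq, postedNumber_board rfl, Nat.unpair_pair, netFlow_apply,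
    sum_incident, sum_incident, hident]
  push_cast
  rw [sub_div, sum_div, sum_div]
  congr 2
  · refine sum_congr rfl fun u _ => ?_
    split_ifs with hu
    · exact h.units_div hu.symm
    · rw [sentFlow, roundedFlow, if_neg fun hu' => hu hu'.symm, zero_div]
  · refine sum_congr rfl fun u _ => ?_
    split_ifs with hu
    · exact h.units_div hu
    · rw [sentFlow, roundedFlow, if_neg hu, zero_div]

end IsSetup

end Network

namespace Network

variable {V : Type} [Fintype V] {N : Network V} {ε : ℝ} {c : ℕ}

namespace IsSparsifier

variable {H : Clustering}

lemma mem_ids (hH : N.IsSparsifier H) (j a b : ℕ) (h : H.selected j a b) :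
    a ∈ N.ids ∧ b ∈ N.ids := by
  obtain ⟨u, v, rfl, rfl, -, -⟩ := hH.isEdge j a b h
  exact ⟨ident_mem_ids u, ident_mem_ids v⟩

lemma adj_and_level_eq (hH : N.IsSparsifier H) {u v : V}
    (h : H.Joined (N.ident u) (N.ident v)) :
    N.graph.Adj u v ∧ H.level (N.ident u) (N.ident v) = N.edgeClass u v := by
  rcases Clustering.level_spec h with hsel | hsel
  · obtain ⟨u', v', hu, hv, hadj, hclass⟩ := hH.isEdge _ _ _ hsel
    obtain rfl := N.ident_injective hu
    obtain rfl := N.ident_injective hv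
    exact ⟨hadj, hclass.symm⟩
  · obtain ⟨v', u', hv, hu, hadj, hclass⟩ := hH.isEdge _ _ _ hsel
    obtain rfl := N.ident_injective hu
    obtain rfl := N.ident_injective hv
    rw [edgeClass_comm]
    exact ⟨hadj.symm, hclass.symm⟩

lemma isSlack (hH : N.IsSparsifier H) {φ : ℕ → ℝ} (hφ : H.Respects φ) :
    N.IsSlack fun v => 1 / (2 * bitLength V + 1) * φ (N.ident v) := by
  intro u v huv
  dsimp only
  rw [← mul_sub, abs_mul, abs_of_pos (by positivity), abs_sub_comm]
  calc 1 / (2 * bitLength V + 1 : ℝ) * |φ (N.ident u) - φ (N.ident v)|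
      ≤ 1 / (2 * bitLength V + 1 : ℝ) * ((2 * bitLength V + 1) * 2 ^ N.edgeClass u v) :=
        mul_le_mul_of_nonneg_left (hH.stretch φ hφ u v huv) (by positivity)
    _ = 2 ^ N.edgeClass u v := by field_simp
    _ ≤ N.cost u v := by exact_mod_cast (two_pow_edgeClass_le huv).trans (min_le_left _ _)

end IsSparsifier

lemma sum_weightFlow_mul_le {K M : ℕ} (hK : 0 < K)
    (hM : ∀ u v, N.graph.Adj u v → N.cost u v ≤ M) {g : ℝ} (η s : ℝ) (Φ : V → ℝ) {y : V → ℝ}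
    (hg : 0 ≤ g) (hy : N.IsSlack y) :
    ∑ u, ∑ v, N.weightFlow g η s Φ u v * (y v - y u) ≤
      ∑ u, ∑ v, N.roundedFlow K g η s Φ u v * (y v - y u) + (Fintype.card V : ℝ) ^ 2 * M / K := by
  have harc : ∀ u v, N.weightFlow g η s Φ u v * (y v - y u) ≤
      N.roundedFlow K g η s Φ u v * (y v - y u) + M / K := by
    intro u v
    by_cases huv : N.graph.Adj u v
    · have hdiff : y v - y u ≤ M :=
        (le_abs_self _).trans ((hy u v huv).trans (Nat.cast_le.2 (hM u v huv)))
      have herror : (N.weightFlow g η s Φ u v - N.roundedFlow K g η s Φ u v) * (y v - y u) ≤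
          1 / K * M :=
        (mul_le_mul_of_nonneg_left hdiff (sub_nonneg.2 (roundedFlow_le hK hg u v))).trans
          (mul_le_mul_of_nonneg_right (weightFlow_sub_roundedFlow_le hK u v) M.cast_nonneg)
      rw [one_div_mul_eq_div] at herror
      linarith
    · rw [weightFlow, roundedFlow, if_neg huv, if_neg huv]
      have : (0 : ℝ) ≤ M / K := by positivity
      linarith
  refine (sum_le_sum fun u _ => sum_le_sum fun v _ => harc u v).trans (le_of_eq ?_)
  simp only [sum_add_distrib, sum_const, card_univ, nsmul_eq_mul]
  ring

/-- The invariant of the iterations: the total weight is at most `n ^ 2 * exp (shift)`. -/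
def WeightInvariant (N : Network V) (ε : ℝ) (S : Setup) (g : ℝ) (t : ℕ) (Φ : ℕ → ℝ) : Prop :=
  N.totalWeight (S.gap ε / 2) (Φ ∘ N.ident) ≤
    Fintype.card V ^ 2 * Real.exp (S.shift ε g t Φ)

lemma one_add_third_mul_le {g D : ℝ} (hε : 0 ≤ ε) (hε1 : ε ≤ 1) (hD : 0 ≤ D)
    (h : g ≤ (1 + ε / 3) * D) : (1 + ε / 3) * g ≤ (1 + ε) * D := by
  calc (1 + ε / 3) * g ≤ (1 + ε / 3) * ((1 + ε / 3) * D) := by gcongr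
    _ = (1 + ε / 3) * (1 + ε / 3) * D := by ring
    _ ≤ (1 + ε) * D := mul_le_mul_of_nonneg_right (by nlinarith) hD

namespace IsSetup

variable {S : Setup} {H : Clustering} {g τ : ℝ} {t : ℕ} {Φ r φ : ℕ → ℝ} {F : ℕ → ℕ → ℝ}

lemma stretch_eq (h : N.IsSetup c S) : S.stretch = 2 * bitLength V + 1 := by
  rw [Setup.stretch, h.bits_eq]

lemma cost_le_two_pow (h : N.IsSetup c S) {u v : V} (huv : N.graph.Adj u v) :
    (N.cost u v : ℝ) ≤ 2 * S.ratio * 2 ^ N.edgeClass u v := by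
  have hmin : N.cost u v ≤ S.ratio * min (N.cost u v) (N.cost v u) := by
    rcases min_choice (N.cost u v) (N.cost v u) with heq | heq <;> rw [heq]
    · exact Nat.le_mul_of_pos_left _ h.one_le_ratio
    · exact h.cost_le u v huv
  have hcost : N.cost u v ≤ 2 * S.ratio * 2 ^ N.edgeClass u v :=
    calc N.cost u v ≤ S.ratio * min (N.cost u v) (N.cost v u) := hmin
      _ ≤ S.ratio * 2 ^ (N.edgeClass u v + 1) := Nat.mul_le_mul_left _ min_cost_lt.le
      _ = 2 * S.ratio * 2 ^ N.edgeClass u v := by ring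
  exact_mod_cast hcost

lemma sum_cost_routing_le (h : N.IsSetup c S) (hH : N.IsSparsifier H)
    (hF : H.IsRouting S.ids r τ F) :
    ∑ u, ∑ v, N.cost u v * F (N.ident u) (N.ident v) ≤ 2 * S.ratio * τ := by
  have hcost := hF.cost_le
  rw [h.ids_eq] at hcost
  simp only [sum_ids] at hcost
  calc ∑ u, ∑ v, N.cost u v * F (N.ident u) (N.ident v)
      ≤ ∑ u, ∑ v, 2 * S.ratio *
          (2 ^ H.level (N.ident u) (N.ident v) * F (N.ident u) (N.ident v)) := by
        refine sum_le_sum fun u _ => sum_le_sum fun v _ => ?_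
        by_cases hj : H.Joined (N.ident u) (N.ident v)
        · obtain ⟨hadj, hlevel⟩ := hH.adj_and_level_eq hj
          rw [hlevel, ← mul_assoc]
          exact mul_le_mul_of_nonneg_right (h.cost_le_two_pow hadj) (hF.nonneg _ _)
        · simp [hF.support _ _ hj]
    _ = 2 * S.ratio * ∑ u, ∑ v,
          2 ^ H.level (N.ident u) (N.ident v) * F (N.ident u) (N.ident v) := by
        simp only [mul_sum]
    _ ≤ 2 * S.ratio * τ := mul_le_mul_of_nonneg_left hcost (by positivity)

lemma netFlow_routing (h : N.IsSetup c S) (hF : H.IsRouting S.ids r τ F) (v : V) :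
    netFlow (fun u v => F (N.ident u) (N.ident v)) v = r (N.ident v) := by
  have hflow := hF.netFlow_eq (N.ident v) (h.ids_eq ▸ ident_mem_ids v)
  rwa [h.ids_eq, sum_ids, sum_ids] at hflow

lemma sum_cost_sentFlow_le (hg : 0 ≤ g) (hI : N.WeightInvariant ε S g t Φ) :
    ∑ u, ∑ v, N.cost u v * N.sentFlow c ε S g t Φ u v ≤ g := by
  refine le_trans (sum_le_sum fun u _ => sum_le_sum fun v _ => ?_)
    (sum_cost_weightFlow_le hg hI)
  exact mul_le_mul_of_nonneg_left (roundedFlow_le (S.precision_pos c) hg u v) (Nat.cast_nonneg _)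

lemma isGood_of_isRouting (h : N.IsSetup c S) (hH : N.IsSparsifier H) (hε : 0 < ε)
    (hε1 : ε ≤ 1) (hg : 0 < g) (hI : N.WeightInvariant ε S g t Φ) {y : ℕ → ℝ}
    (hy : N.IsPotential (y ∘ N.ident)) (hgy : g ≤ (1 + ε / 3) * N.dualValue (y ∘ N.ident))
    (hF : H.IsRouting S.ids
      (S.residual c (N.board ε (S.flowPost c ε g t Φ))) (ε / 3 * g / (2 * S.ratio)) F) :
    N.IsGood ε ⟨y, fun a b w => S.units c ε g t Φ a b w / S.precision c + F a b⟩ := by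
  have hsupport : ∀ u v, ¬N.graph.Adj u v → F (N.ident u) (N.ident v) = 0 := fun u v huv =>
    hF.support _ _ fun hj => huv (hH.adj_and_level_eq hj).1
  have hdual : 0 ≤ N.dualValue (y ∘ N.ident) := by
    by_contra! hneg
    nlinarith
  have hrouting : ∑ u, ∑ v, N.cost u v * F (N.ident u) (N.ident v) ≤ ε / 3 * g := by
    have := h.one_le_ratio_real
    refine (h.sum_cost_routing_le hH hF).trans (le_of_eq ?_)
    field_simp
  refine ⟨N.sentFlow c ε S g t Φ + fun u v => F (N.ident u) (N.ident v), ⟨?_, ?_, ?_, hy, ?_⟩, ?_⟩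
  · exact fun u v => add_nonneg (roundedFlow_nonneg u v) (hF.nonneg _ _)
  · intro u v huv
    rw [Pi.add_apply, Pi.add_apply, hsupport u v huv, sentFlow, roundedFlow, if_neg huv, add_zero]
  · intro v
    rw [map_add, Pi.add_apply, h.netFlow_routing hF, h.residual_board]
    ring
  · simp only [Pi.add_apply, mul_add, sum_add_distrib]
    linarith [sum_cost_sentFlow_le (c := c) hg.le hI, one_add_third_mul_le hε.le hε1 hdual hgy]
  · intro u v huv
    dsimp only [Pi.add_apply]
    rw [h.units_div huv]

lemma sum_sentFlow_mul_le (h : N.IsSetup c S) (hφ : H.IsWitness S.ids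
      (S.residual c (N.board ε (S.flowPost c ε g t Φ))) (ε / 3 * g / (2 * S.ratio)) φ)
    {y : V → ℝ} (hy : y = fun v => 1 / S.stretch * φ (N.ident v)) :
    ∑ u, ∑ v, N.sentFlow c ε S g t Φ u v * (y v - y u) ≤
      N.dualValue y - 2 * (g * S.gap ε) := by
  have := h.one_le_ratio_real
  have := S.one_le_stretch
  have hlt := hφ.lt
  rw [h.ids_eq, sum_ids] at hlt
  simp only [h.residual_board] at hlt
  have hnetFlow : ∑ v, y v * netFlow (N.sentFlow c ε S g t Φ) v = N.dualValue y -
      1 / S.stretch *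
        ∑ v, (N.demand v - netFlow (N.sentFlow c ε S g t Φ) v) * φ (N.ident v) := by
    rw [dualValue, mul_sum, ← sum_sub_distrib]
    exact sum_congr rfl fun v _ => by rw [hy]; ring
  have hgap : 2 * (g * S.gap ε) = 1 / S.stretch * (ε / 3 * g / (2 * S.ratio)) := by
    unfold Setup.gap
    field_simp
    ring
  rw [← sum_mul_netFlow, hnetFlow, hgap]
  exact sub_le_sub_left (mul_le_mul_of_nonneg_left hlt.le (by positivity)) _

lemma weightInvariant_of_isWitness (h : N.IsSetup c S) (hN : N.PolyBounded c)
    (hH : N.IsSparsifier H) (hε : 0 < ε) (hε1 : ε ≤ 1) (hn : 1 ≤ Fintype.card V * ε) (hg : 1 ≤ g)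
    (hI : N.WeightInvariant ε S g t Φ) (hφ : H.IsWitness S.ids
      (S.residual c (N.board ε (S.flowPost c ε g t Φ))) (ε / 3 * g / (2 * S.ratio)) φ) :
    N.WeightInvariant ε S g (t + 1) (Φ + fun a => 1 / S.stretch * φ a) := by
  have hg0 : 0 < g := by linarith
  have hgap := h.gap_pos hε
  have hgap1 := h.gap_le_one hε1
  set y : V → ℝ := fun v => 1 / S.stretch * φ (N.ident v) with hy
  have hcomp : (Φ + fun a => 1 / S.stretch * φ a) ∘ N.ident = Φ ∘ N.ident + y := rfl
  have hslack : N.IsSlack y := by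
    rw [hy, h.stretch_eq]
    exact hH.isSlack hφ.respects
  have hround : ∑ u, ∑ v, N.idealFlow ε S g t Φ u v * (y v - y u) ≤
      ∑ u, ∑ v, N.sentFlow c ε S g t Φ u v * (y v - y u) + S.gap ε := by
    have herror := h.rounding_le hε hn
    have hle := sum_weightFlow_mul_le (S.precision_pos c) (fun u v huv => hN.cost_le huv)
      (S.gap ε / 2) (S.shift ε g t Φ) (Φ ∘ N.ident) hg0.le hslack
    push_cast at hle
    exact hle.trans (by linarith)
  have hcollected : ∑ u, ∑ v, N.idealFlow ε S g t Φ u v * (y v - y u) ≤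
      N.dualValue y - g * S.gap ε := by
    have hgap_le : S.gap ε ≤ g * S.gap ε := le_mul_of_one_le_left hgap.le hg
    linarith [h.sum_sentFlow_mul_le hφ hy]
  unfold WeightInvariant
  rw [hcomp]
  refine (totalWeight_add_le hg0 (by positivity) (by linarith) hI hslack hcollected).trans
    (le_of_eq ?_)
  congr 2
  simp only [Setup.shift, h.dual_eq, hcomp, dualValue_add]
  push_cast
  ring

lemma units_le (h : N.IsSetup c S) (hg : 0 ≤ g) {u v : V} (huv : N.graph.Adj u v) :
    (S.units c ε g t Φ (N.ident u) (N.ident v) (N.cost u v) : ℝ) ≤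
      S.precision c * (N.cost u v * N.idealFlow ε S g t Φ u v) := by
  have hK : (0 : ℝ) < S.precision c := by exact_mod_cast S.precision_pos c
  rw [← div_le_iff₀' hK, h.units_div huv]
  exact (roundedFlow_le (S.precision_pos c) hg u v).trans
    (le_mul_of_one_le_left (weightFlow_nonneg hg u v) (one_le_cost huv))

lemma sum_units_in_le (h : N.IsSetup c S) (hg : 0 ≤ g)
    (hI : N.WeightInvariant ε S g t Φ) (v : V) :
    ((∑ x ∈ (N.localInput ε v).incident, S.units c ε g t Φ x.1 (N.ident v) x.2.2 : ℕ) : ℝ) ≤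
      S.precision c * g := by
  classical
  have hnonneg : ∀ a b, 0 ≤ N.cost a b * N.idealFlow ε S g t Φ a b := fun a b =>
    mul_nonneg (Nat.cast_nonneg _) (weightFlow_nonneg hg a b)
  rw [sum_incident]
  push_cast
  calc _ ≤ ∑ u, S.precision c * (N.cost u v * N.idealFlow ε S g t Φ u v) := by
        refine sum_le_sum fun u _ => ?_
        split_ifs with huv
        · exact h.units_le hg huv.symm
        · exact mul_nonneg (Nat.cast_nonneg _) (hnonneg u v)
    _ = S.precision c * ∑ u, N.cost u v * N.idealFlow ε S g t Φ u v := by rw [mul_sum]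
    _ ≤ S.precision c * ∑ u, ∑ b, N.cost u b * N.idealFlow ε S g t Φ u b := by
        gcongr with u _
        exact single_le_sum (f := fun b => N.cost u b * N.idealFlow ε S g t Φ u b)
          (fun b _ => hnonneg u b) (mem_univ v)
    _ ≤ S.precision c * g := by
        gcongr
        exact sum_cost_weightFlow_le hg hI

lemma sum_units_out_le (h : N.IsSetup c S) (hg : 0 ≤ g)
    (hI : N.WeightInvariant ε S g t Φ) (v : V) :
    ((∑ x ∈ (N.localInput ε v).incident, S.units c ε g t Φ (N.ident v) x.1 x.2.1 : ℕ) : ℝ) ≤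
      S.precision c * g := by
  classical
  have hnonneg : ∀ a b, 0 ≤ N.cost a b * N.idealFlow ε S g t Φ a b := fun a b =>
    mul_nonneg (Nat.cast_nonneg _) (weightFlow_nonneg hg a b)
  rw [sum_incident]
  push_cast
  calc _ ≤ ∑ u, S.precision c * (N.cost v u * N.idealFlow ε S g t Φ v u) := by
        refine sum_le_sum fun u _ => ?_
        split_ifs with huv
        · exact h.units_le hg huv
        · exact mul_nonneg (Nat.cast_nonneg _) (hnonneg v u)
    _ = S.precision c * ∑ u, N.cost v u * N.idealFlow ε S g t Φ v u := by rw [mul_sum]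
    _ ≤ S.precision c * ∑ a, ∑ b, N.cost a b * N.idealFlow ε S g t Φ a b := by
        refine mul_le_mul_of_nonneg_left ?_ (Nat.cast_nonneg _)
        exact single_le_sum (f := fun a => ∑ b, N.cost a b * N.idealFlow ε S g t Φ a b)
          (fun a _ => sum_nonneg fun b _ => hnonneg a b) (mem_univ v)
    _ ≤ S.precision c * g := by
        gcongr
        exact sum_cost_weightFlow_le hg hI

lemma precision_mul_lt (h : N.IsSetup c S)
    (hg : g ≤ 2 * 2 ^ ((2 * c + 2) * bitLength V)) :
    S.precision c * g < 2 ^ ((4 * c + 14) * bitLength V) := by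
  have hl := one_le_bitLength (V := V)
  have htwo : (2 : ℝ) < 2 ^ (2 * bitLength V) := by
    calc (2 : ℝ) < 2 ^ 2 := by norm_num
      _ ≤ 2 ^ (2 * bitLength V) := pow_le_pow_right₀ one_le_two (by omega)
  calc S.precision c * g
      ≤ 2 ^ ((2 * c + 10) * bitLength V) * (2 * 2 ^ ((2 * c + 2) * bitLength V)) := by
        rw [Setup.precision, h.bits_eq]
        push_cast
        gcongr
    _ < 2 ^ ((2 * c + 10) * bitLength V) *
          (2 ^ (2 * bitLength V) * 2 ^ ((2 * c + 2) * bitLength V)) := by gcongr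
    _ = 2 ^ ((4 * c + 14) * bitLength V) := by ring

lemma add_one_lt_of_mem_flowPost (h : N.IsSetup c S) (hg : 0 ≤ g)
    (hg' : g ≤ 2 * 2 ^ ((2 * c + 2) * bitLength V)) (hI : N.WeightInvariant ε S g t Φ)
    {v : V} {a : ℕ} (ha : a ∈ S.flowPost c ε g t Φ (N.localInput ε v)) :
    a + 1 < 2 ^ (2 * ((4 * c + 14) * bitLength V) + 1) := by
  rw [Setup.flowPost, mem_singleton] at ha
  rw [ha]
  refine pair_add_one_lt ?_ ?_
  · exact_mod_cast (h.sum_units_in_le hg hI v).trans_lt (h.precision_mul_lt hg')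
  · exact_mod_cast (h.sum_units_out_le hg hI v).trans_lt (h.precision_mul_lt hg')

lemma meets_mwStep (h : N.IsSetup c S) (hN : N.PolyBounded c)
    (hH : N.IsSparsifier H) (hε : 0 < ε) (hε1 : ε ≤ 1) (hn : 1 ≤ Fintype.card V * ε) (hg : 1 ≤ g)
    (hI : N.WeightInvariant ε S g t Φ) {y : ℕ → ℝ} (hy : N.IsPotential (y ∘ N.ident))
    (hgy : g ≤ (1 + ε / 3) * N.dualValue (y ∘ N.ident)) {β : ℕ}
    (hβ : 2 * ((4 * c + 14) * bitLength V) + 1 ≤ β) :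
    (S.mwStep c ε H g y t Φ).Meets N ε β (4 * Fintype.card V)
      (Sum.elim (N.IsGood ε) (N.WeightInvariant ε S g (t + 1))) := by
  have hg0 : 0 < g := by linarith
  have hg' : g ≤ 2 * 2 ^ ((2 * c + 2) * bitLength V) := by
    have hdual : 0 ≤ N.dualValue (y ∘ N.ident) := by
      by_contra! hneg
      nlinarith
    nlinarith [hN.dualValue_le hy, hdual]
  refine (BoardProgram.meets_ask (m := 1) (T := 0) (fun v a ha => ?_) (fun v => ?_) ?_).mono
    (T := 2 * (Fintype.card V * (1 + 1)) + 0) (by omega) fun _ => id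
  · exact (h.add_one_lt_of_mem_flowPost hg0.le hg' hI ha).trans_le
      (Nat.pow_le_pow_right two_pos hβ)
  · simp [Setup.flowPost]
  · split_ifs with hrouting hwitness
    · exact h.isGood_of_isRouting hH hε hε1 hg0 hI hy hgy hrouting.choose_spec
    · exact h.weightInvariant_of_isWitness hN hH hε hε1 hn hg hI hwitness.choose_spec
    · have := h.one_le_ratio_real
      rcases Clustering.exists_isRouting_or_isWitness (τ := ε / 3 * g / (2 * S.ratio))
        (h.ids_eq ▸ hH.mem_ids) (S.residual c (N.board ε (S.flowPost c ε g t Φ)))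
        (by positivity) with hex | hex
      · exact absurd hex hrouting
      · exact absurd hex hwitness

end IsSetup

end Network

/-! ### The algorithm -/

namespace Setup

variable (S : Setup) (c : ℕ) (ε : ℝ)

/-- The number of iterations of the multiplicative weights method for one guess. -/
def iterations : ℕ := ⌊8 * S.bits / S.gap ε ^ 2⌋₊ + 1

/-- The number of guesses for which the multiplicative weights method is run: after `⌈3 / ε⌉₊`
further factors `1 + ε / 3`, the guess has at least doubled. -/
def scanLength : ℕ := ⌈3 / ε⌉₊ * ((2 * c + 3) * S.bits)

/-- The multiplicative weights method for the guess `g`: it returns a solution, or else a potential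
of value `g`. -/
def mwLoop (H : Clustering) (g : ℝ) (y : ℕ → ℝ) : BoardProgram (Solution ⊕ (ℕ → ℝ)) :=
  (BoardProgram.iter (fun t => Sum.elim (fun sol => .pure (.inl sol)) (S.mwStep c ε H g y t))
    (S.iterations ε) (.inr 0)).bind
    (Sum.elim (fun sol => .pure (.inl sol))
      fun Φ => .pure (.inr fun a => g / S.dual Φ * Φ a))

/-- The multiplicative weights method for the guesses `(1 + ε / 3) ^ j`, until it finds a solution.
The guesses eventually exceed the optimum, so the last branch is never reached. -/
def scan (H : Clustering) : BoardProgram Solution :=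
  (BoardProgram.iter (fun j => Sum.elim (fun sol => .pure (.inl sol))
      (S.mwLoop c ε H ((1 + ε / 3) ^ j)))
    (S.scanLength c ε) (.inr fun a => if 0 < S.demand a then 1 else 0)).bind
    (Sum.elim .pure fun y => .pure ⟨y, 0⟩)

/-- If each node `a` has posted the pairs `(b, w)` for the arcs from `a` to `b` of cost `w`, then
the flow `F` and the potential `y` form a `(1 + ε)`-approximate solution. -/
structure IsPublicSolution (board : Finset ℕ) (F : ℕ → ℕ → ℝ) (y : ℕ → ℝ) : Prop where
  nonneg : ∀ a ∈ S.ids, ∀ b ∈ S.ids, 0 ≤ F a b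
  support : ∀ a ∈ S.ids, ∀ b ∈ S.ids, (∀ w, Nat.pair b w ∉ postedBy board a) → F a b = 0
  netFlow_eq : ∀ a ∈ S.ids, ∑ b ∈ S.ids, F b a - ∑ b ∈ S.ids, F a b = S.demand a
  isPotential : ∀ a ∈ S.ids, ∀ b ∈ S.ids, ∀ w, Nat.pair b w ∈ postedBy board a → y b - y a ≤ w
  cost_le : ∑ a ∈ S.ids, ∑ x ∈ postedBy board a, x.unpair.2 * F a x.unpair.1 ≤ (1 + ε) * S.dual y

/-- The announcement of all arcs that leave the node. -/
def arcPost (inp : LocalInput) : Finset ℕ := inp.incident.image fun x => Nat.pair x.1 x.2.1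

open Classical in
/-- All arcs are announced, and every node computes the same solution locally. -/
def gather : BoardProgram Solution :=
  .ask arcPost fun board =>
    if h : ∃ p : (ℕ → ℕ → ℝ) × (ℕ → ℝ), S.IsPublicSolution ε board p.1 p.2 then
      .pure ⟨h.choose.2, fun a b _ => h.choose.1 a b⟩
    else .pure ⟨0, 0⟩

open Classical in
/-- The main part of the algorithm. If `n * ε < 1`, then announcing the whole network is
affordable, and otherwise the rounding errors of the multiplicative weights method are. -/
def solve : BoardProgram Solution :=
  if ∀ a ∈ S.ids, S.demand a = 0 then .pure ⟨0, 0⟩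
  else if #S.ids * ε < 1 then S.gather ε
  else (sparsify S.ids (c * S.bits + 1) S.bits).bind (S.scan c ε)

/-- The output of a node that knows the public solution. The sum over the incident edges has one
term: it looks up the costs of the edge to the neighbor `b`. -/
def output (sol : Solution) (inp : LocalInput) : NodeOutput where
  value := (1 + ε) * S.dual sol.potential
  potential := sol.potential inp.ident
  flow b := ∑ x ∈ inp.incident with x.1 = b,
    if x.2.2 < x.2.1 ∨ x.2.2 = x.2.1 ∧ inp.ident < b then
      sol.flow inp.ident b x.2.1 - sol.flow b inp.ident x.2.2
    else sol.flow b inp.ident x.2.2 - sol.flow inp.ident b x.2.1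

end Setup

/-- The first announcement of a node: its demand, as a difference of natural numbers, and a bound
for the cost ratios of the incident edges. -/
def setupPost (inp : LocalInput) : Finset ℕ :=
  {Nat.pair (Nat.pair inp.demand.toNat (-inp.demand).toNat)
    (inp.incident.sup fun x => x.2.1 / x.2.2 + 1)}

/-- The public knowledge decoded from the announcements `setupPost`. -/
def readSetup (board : Finset ℕ) : Setup where
  ids := senders board
  demand a := ((postedNumber board a).unpair.1.unpair.1 : ℤ) -
    (postedNumber board a).unpair.1.unpair.2
  ratio := max 1 ((senders board).sup fun a => (postedNumber board a).unpair.2)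

/-- The transshipment algorithm as a program for a shared blackboard. -/
def transshipment (c : ℕ) (ε : ℝ) : BoardProgram (LocalInput → NodeOutput) :=
  .ask setupPost fun board => ((readSetup board).solve c ε).bind fun sol =>
    .pure ((readSetup board).output ε sol)

namespace Network

variable {V : Type} [Fintype V] {N : Network V} {ε : ℝ} {c : ℕ}

/-! ### The first announcement -/

lemma one_le_asymmetry : 1 ≤ N.asymmetry := le_max_left _ _

lemma cost_div_le_asymmetry {u v : V} (huv : N.graph.Adj u v) :
    (N.cost u v : ℝ) / N.cost v u ≤ N.asymmetry := by
  rcases isForward_or_isForward huv with hforward | hbackward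
  · exact (le_ciSup (f := fun e : N.Edge => N.wPlus e / N.wMinus e)
      (Set.finite_range _).bddAbove ⟨(u, v), hforward⟩).trans (le_max_right _ _)
  · have hle : N.cost u v ≤ N.cost v u := by
      have := hbackward.2
      omega
    have hratio : (N.cost u v : ℝ) / N.cost v u ≤ 1 :=
      div_le_one_of_le₀ (by exact_mod_cast hle) (Nat.cast_nonneg _)
    exact hratio.trans one_le_asymmetry

lemma postedNumber_setupPost (v : V) : postedNumber (N.board ε setupPost) (N.ident v) =
    Nat.pair (Nat.pair (N.demand v).toNat (-N.demand v).toNat)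
      ((N.localInput ε v).incident.sup fun x => x.2.1 / x.2.2 + 1) :=
  postedNumber_board rfl

lemma ratio_readSetup_le {m : ℕ} (hm : 1 ≤ m)
    (h : ∀ u v, N.graph.Adj u v → N.cost u v / N.cost v u + 1 ≤ m) :
    (readSetup (N.board ε setupPost)).ratio ≤ m := by
  refine max_le hm (Finset.sup_le fun a ha => ?_)
  rw [senders_board] at ha
  obtain ⟨v, -, rfl⟩ := mem_image.1 ha
  rw [postedNumber_setupPost, Nat.unpair_pair]
  refine Finset.sup_le fun x hx => ?_
  obtain ⟨u, hu, rfl⟩ := mem_incident.1 hx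
  exact h v u hu

lemma le_ratio_readSetup {u v : V} (huv : N.graph.Adj u v) :
    N.cost u v / N.cost v u + 1 ≤ (readSetup (N.board ε setupPost)).ratio := by
  have hu : N.ident u ∈ senders (N.board ε setupPost) := by
    rw [senders_board]
    exact ident_mem_ids u
  calc N.cost u v / N.cost v u + 1
      ≤ (N.localInput ε u).incident.sup fun x => x.2.1 / x.2.2 + 1 :=
        le_sup (f := fun x : ℕ × ℕ × ℕ => x.2.1 / x.2.2 + 1) (mem_incident.2 ⟨v, huv, rfl⟩)
    _ = (postedNumber (N.board ε setupPost) (N.ident u)).unpair.2 := by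
        rw [postedNumber_setupPost, Nat.unpair_pair]
    _ ≤ (senders (N.board ε setupPost)).sup
          fun a => (postedNumber (N.board ε setupPost) a).unpair.2 :=
        le_sup (f := fun a => (postedNumber (N.board ε setupPost) a).unpair.2) hu
    _ ≤ (readSetup (N.board ε setupPost)).ratio := le_max_right _ _

lemma ratio_readSetup_le_asymmetry :
    ((readSetup (N.board ε setupPost)).ratio : ℝ) ≤ 2 * N.asymmetry := by
  have hone := one_le_asymmetry (N := N)
  refine (Nat.le_floor_iff (by linarith)).1 (ratio_readSetup_le ?_ fun u v huv => ?_)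
  · exact Nat.le_floor (by push_cast; linarith)
  · refine Nat.le_floor ?_
    have hdiv : ((N.cost u v / N.cost v u : ℕ) : ℝ) ≤ (N.cost u v : ℝ) / N.cost v u :=
      Nat.cast_div_le
    push_cast
    linarith [cost_div_le_asymmetry huv]

lemma two_pow_mul_bitLength_lt (c : ℕ) : 2 ^ (c * bitLength V) < 2 ^ ((c + 1) * bitLength V) :=
  Nat.pow_lt_pow_right one_lt_two (Nat.mul_lt_mul_of_pos_right c.lt_succ_self one_le_bitLength)

lemma PolyBounded.cost_div_lt (hN : N.PolyBounded c) {u v : V} (huv : N.graph.Adj u v) :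
    N.cost u v / N.cost v u < 2 ^ ((c + 1) * bitLength V) :=
  (Nat.div_le_self _ _).trans_lt ((hN.cost_le huv).trans_lt (two_pow_mul_bitLength_lt c))

lemma isSetup_readSetup (hN : N.PolyBounded c) :
    N.IsSetup c (readSetup (N.board ε setupPost)) where
  ids_eq := senders_board _
  demand_eq v := by
    simp only [readSetup, postedNumber_setupPost, Nat.unpair_pair]
    exact Int.toNat_sub_toNat_neg _
  one_le_ratio := le_max_left _ _
  ratio_le := ratio_readSetup_le Nat.one_le_two_pow fun _ _ => hN.cost_div_lt
  cost_le u v huv := by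
    have hlt := Nat.lt_mul_div_succ (N.cost u v) (N.cost_pos v u huv.symm)
    calc N.cost u v ≤ (N.cost u v / N.cost v u + 1) * N.cost v u := by
          rw [mul_comm]
          exact hlt.le
      _ ≤ _ := Nat.mul_le_mul_right _ (le_ratio_readSetup huv)

lemma add_one_lt_of_mem_setupPost (hN : N.PolyBounded c) {v : V} {a : ℕ}
    (ha : a ∈ setupPost (N.localInput ε v)) :
    a + 1 < 2 ^ (2 * (2 * ((c + 1) * bitLength V) + 1) + 1) := by
  have hident : (N.localInput ε v).demand = N.demand v := rfl
  have hdemand : |N.demand v| < ((2 ^ ((c + 1) * bitLength V) : ℕ) : ℤ) := by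
    refine lt_of_le_of_lt ?_ (Nat.cast_lt.2 (two_pow_mul_bitLength_lt c))
    exact_mod_cast hN.abs_demand_le v
  rw [abs_lt] at hdemand
  rw [setupPost, mem_singleton] at ha
  rw [ha, hident]
  refine pair_add_one_lt ?_ ?_
  · exact (Nat.lt_succ_self _).trans (pair_add_one_lt (by omega) (by omega))
  · refine lt_of_le_of_lt (Finset.sup_le fun x hx => ?_)
      (Nat.pow_lt_pow_right one_lt_two (by omega : (c + 1) * bitLength V < _))
    obtain ⟨u, hu, rfl⟩ := mem_incident.1 hx
    exact hN.cost_div_lt hu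

/-! ### The output of the nodes -/

open Classical in
lemma flow_output {S : Setup} {sol : Solution} {f : V → V → ℝ}
    (hf : ∀ u v, N.graph.Adj u v → f u v = sol.flow (N.ident u) (N.ident v) (N.cost u v))
    {u v : V} (huv : N.graph.Adj u v) :
    (S.output ε sol (N.localInput ε u)).flow (N.ident v) =
      if N.IsForward u v then f u v - f v u else f v u - f u v := by
  have hident : (N.localInput ε u).ident = N.ident u := rfl
  simp only [Setup.output, hident]
  rw [sum_filter, sum_incident, sum_eq_single v]
  · simp only [if_true, hf u v huv, hf v u huv.symm, IsForward, huv, true_and]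
  · intro w _ hw
    simp [N.ident_injective.ne hw]
  · simp

lemma IsSetup.isApproximation {S : Setup} (h : N.IsSetup c S) (hε : 0 < ε) {sol : Solution}
    (hsol : N.IsGood ε sol) :
    N.IsApproximation ε fun v => S.output ε sol (N.localInput ε v) := by
  obtain ⟨f, hf, hflow⟩ := hsol
  refine hf.isApproximation hε.le (fun v => ?_) (fun v => rfl) fun u v huv => ?_
  · simp only [Setup.output, h.dual_eq]
  · rw [flow_output hflow huv.1, flow_output hflow huv.1.symm, if_pos huv,
      if_neg (not_isForward_of_isForward huv)]
    exact ⟨rfl, rfl⟩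

/-! ### Gathering the network -/

lemma pair_mem_postedBy_arcPost {u v : V} {w : ℕ} :
    Nat.pair (N.ident v) w ∈ postedBy (N.board ε Setup.arcPost) (N.ident u) ↔
      N.graph.Adj u v ∧ N.cost u v = w := by
  simp only [postedBy_board, Setup.arcPost, mem_image, mem_incident, Nat.pair_eq_pair]
  constructor
  · rintro ⟨_, ⟨v', huv, rfl⟩, hv, hw⟩
    obtain rfl := N.ident_injective hv
    exact ⟨huv, hw⟩
  · rintro ⟨huv, hw⟩
    exact ⟨_, ⟨v, huv, rfl⟩, rfl, hw⟩

lemma sum_postedBy_arcPost {F : ℕ → ℕ → ℝ}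
    (hF : ∀ u v, ¬N.graph.Adj u v → F (N.ident u) (N.ident v) = 0) (u : V) :
    ∑ x ∈ postedBy (N.board ε Setup.arcPost) (N.ident u), x.unpair.2 * F (N.ident u) x.unpair.1 =
      ∑ v, N.cost u v * F (N.ident u) (N.ident v) := by
  classical
  rw [postedBy_board, Setup.arcPost, sum_image, sum_incident]
  · refine sum_congr rfl fun v _ => ?_
    split_ifs with huv
    · rw [Nat.unpair_pair]
    · rw [hF u v huv, mul_zero]
  · intro x hx x' hx' heq
    obtain ⟨v, -, rfl⟩ := mem_incident.1 hx
    obtain ⟨v', -, rfl⟩ := mem_incident.1 hx'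
    rw [N.ident_injective (Nat.pair_eq_pair.1 heq).1]

lemma IsSetup.forall_mem_ids {S : Setup} (h : N.IsSetup c S) {P : ℕ → Prop} :
    (∀ a ∈ S.ids, P a) ↔ ∀ v, P (N.ident v) := by
  simp only [h.ids_eq, mem_ids, forall_exists_index, forall_apply_eq_imp_iff]

lemma IsSetup.netFlow_eq_iff {S : Setup} (h : N.IsSetup c S) {F : ℕ → ℕ → ℝ} :
    (∀ a ∈ S.ids, ∑ b ∈ S.ids, F b a - ∑ b ∈ S.ids, F a b = S.demand a) ↔
      ∀ v, netFlow (fun u v => F (N.ident u) (N.ident v)) v = N.demand v := by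
  rw [h.forall_mem_ids]
  refine forall_congr' fun v => ?_
  rw [h.ids_eq, sum_ids, sum_ids, h.demand_eq, netFlow_apply]

lemma IsSetup.isPublicSolution_iff {S : Setup} (h : N.IsSetup c S) {F : ℕ → ℕ → ℝ} {y : ℕ → ℝ} :
    S.IsPublicSolution ε (N.board ε Setup.arcPost) F y ↔
      N.IsApproxPair ε (fun u v => F (N.ident u) (N.ident v)) (y ∘ N.ident) := by
  have hsupport : (∀ a ∈ S.ids, ∀ b ∈ S.ids,
        (∀ w, Nat.pair b w ∉ postedBy (N.board ε Setup.arcPost) a) → F a b = 0) ↔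
      ∀ u v, ¬N.graph.Adj u v → F (N.ident u) (N.ident v) = 0 := by
    simp only [h.forall_mem_ids, pair_mem_postedBy_arcPost, not_and]
    exact forall₂_congr fun u v => imp_congr_left
      ⟨fun hcost huv => hcost _ huv rfl, fun huv _ huv' => absurd huv' huv⟩
  have hpotential : (∀ a ∈ S.ids, ∀ b ∈ S.ids, ∀ w,
        Nat.pair b w ∈ postedBy (N.board ε Setup.arcPost) a → y b - y a ≤ w) ↔
      N.IsPotential (y ∘ N.ident) := by
    simp only [h.forall_mem_ids, pair_mem_postedBy_arcPost]
    exact forall₂_congr fun u v =>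
      ⟨fun hy huv => hy _ ⟨huv, rfl⟩, fun hy _ huv => huv.2 ▸ hy huv.1⟩
  have hcost : (∀ u v, ¬N.graph.Adj u v → F (N.ident u) (N.ident v) = 0) →
      ∑ a ∈ S.ids, ∑ x ∈ postedBy (N.board ε Setup.arcPost) a, x.unpair.2 * F a x.unpair.1 =
        ∑ u, ∑ v, N.cost u v * F (N.ident u) (N.ident v) := fun hF => by
    rw [h.ids_eq, sum_ids]
    exact sum_congr rfl fun u _ => sum_postedBy_arcPost hF u
  constructor
  · intro hsol
    have hF := hsupport.1 hsol.support
    exact ⟨fun u v => h.forall_mem_ids.1 (h.forall_mem_ids.1 hsol.nonneg u) v, hF,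
      h.netFlow_eq_iff.1 hsol.netFlow_eq, hpotential.1 hsol.isPotential,
      hcost hF ▸ h.dual_eq y ▸ hsol.cost_le⟩
  · intro hsol
    exact ⟨h.forall_mem_ids.2 fun u => h.forall_mem_ids.2 fun v => hsol.nonneg u v,
      hsupport.2 hsol.support, h.netFlow_eq_iff.2 hsol.netFlow_eq, hpotential.2 hsol.isPotential,
      (hcost hsol.support).symm ▸ (h.dual_eq y).symm ▸ hsol.cost_le⟩

lemma IsSetup.exists_isPublicSolution {S : Setup} (h : N.IsSetup c S) (hε : 0 < ε) :
    ∃ F y, S.IsPublicSolution ε (N.board ε Setup.arcPost) F y := by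
  obtain ⟨f, y, hf⟩ := N.exists_isApproxPair hε
  have := N.connected.nonempty
  have hnode : ∀ v, Function.invFun N.ident (N.ident v) = v :=
    Function.leftInverse_invFun N.ident_injective
  refine ⟨fun a b => f (Function.invFun N.ident a) (Function.invFun N.ident b),
    y ∘ Function.invFun N.ident, h.isPublicSolution_iff.2 ?_⟩
  simpa only [hnode, Function.comp_assoc, Function.invFun_comp N.ident_injective,
    Function.comp_id] using hf

lemma add_one_lt_of_mem_arcPost (hN : N.PolyBounded c) {v : V} {a : ℕ}
    (ha : a ∈ Setup.arcPost (N.localInput ε v)) :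
    a + 1 < 2 ^ (2 * ((c + 1) * bitLength V) + 1) := by
  obtain ⟨x, hx, rfl⟩ := mem_image.1 ha
  obtain ⟨u, hu, rfl⟩ := mem_incident.1 hx
  exact pair_add_one_lt (hN.ident_lt u) ((hN.cost_le hu).trans_lt (two_pow_mul_bitLength_lt c))

lemma card_arcPost_le (v : V) : #(Setup.arcPost (N.localInput ε v)) ≤ Fintype.card V := by
  classical
  calc #(Setup.arcPost (N.localInput ε v)) ≤ #(N.localInput ε v).incident := card_image_le
    _ ≤ _ := card_image_le
    _ ≤ Fintype.card V := card_filter_le _ _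

lemma IsSetup.meets_gather {S : Setup} (h : N.IsSetup c S) (hN : N.PolyBounded c) (hε : 0 < ε)
    {β : ℕ} (hβ : 2 * ((c + 1) * bitLength V) + 1 ≤ β) :
    (S.gather ε).Meets N ε β (2 * (Fintype.card V * (Fintype.card V + 1))) (N.IsGood ε) := by
  refine BoardProgram.meets_ask (T := 0) (fun v a ha => ?_) card_arcPost_le ?_
  · exact (add_one_lt_of_mem_arcPost hN ha).trans_le (Nat.pow_le_pow_right two_pos hβ)
  · obtain ⟨F, y, hF⟩ := h.exists_isPublicSolution hε
    have hex : ∃ p : (ℕ → ℕ → ℝ) × (ℕ → ℝ),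
        S.IsPublicSolution ε (N.board ε Setup.arcPost) p.1 p.2 := ⟨(F, y), hF⟩
    rw [dif_pos hex]
    exact ⟨_, h.isPublicSolution_iff.1 hex.choose_spec, fun u v _ => rfl⟩

end Network

namespace Network

variable {V : Type} [Fintype V] {N : Network V} {ε : ℝ} {c : ℕ}

/-! ### The scan over the guesses -/

lemma exists_adj (h : ∃ v, N.demand v ≠ 0) : ∃ u v, N.graph.Adj u v := by
  by_contra! hadj
  obtain ⟨v, hv⟩ := h
  have hunique : ∀ u, u = v := fun u => by
    obtain ⟨walk⟩ := N.connected u v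
    cases walk with
    | nil => rfl
    | cons huw _ => exact absurd huw (hadj _ _)
  have hsum := N.sum_demand
  rw [Fintype.sum_eq_single v fun u hu => absurd (hunique u) hu] at hsum
  exact hv hsum

lemma cast_card_sq_le_exp :
    (Fintype.card V : ℝ) ^ 2 ≤ Real.exp (2 * bitLength V) := by
  have htwo : (2 : ℝ) ≤ Real.exp 1 := by linarith [Real.add_one_le_exp (1 : ℝ)]
  calc (Fintype.card V : ℝ) ^ 2
      ≤ (2 ^ bitLength V) ^ 2 :=
        pow_le_pow_left₀ (Nat.cast_nonneg _) cast_card_le_two_pow_bitLength 2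
    _ ≤ (Real.exp 1 ^ bitLength V) ^ 2 := by gcongr
    _ = Real.exp (2 * bitLength V) := by
        rw [← Real.exp_nat_mul, ← Real.exp_nat_mul, mul_one]
        norm_cast

lemma weightInvariant_zero (S : Setup) (g : ℝ) : N.WeightInvariant ε S g 0 0 := by
  classical
  have hshift : S.shift ε g 0 0 = 0 := by simp [Setup.shift, Setup.dual]
  rw [WeightInvariant, hshift, Real.exp_zero, mul_one]
  calc N.totalWeight (S.gap ε / 2) ((0 : ℕ → ℝ) ∘ N.ident) ≤ ∑ _u : V, ∑ _v : V, (1 : ℝ) := by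
        refine sum_le_sum fun u _ => sum_le_sum fun v _ => ?_
        split_ifs <;> simp
    _ = Fintype.card V ^ 2 := by simp [sq]

/-- The state of the scan before the guess of index `j`: a potential whose dual value is at least
the preceding guess. -/
def ScanInvariant (N : Network V) (ε : ℝ) (j : ℕ) (y : ℕ → ℝ) : Prop :=
  N.IsPotential (y ∘ N.ident) ∧ (1 + ε / 3) ^ j ≤ (1 + ε / 3) * N.dualValue (y ∘ N.ident)

lemma scanInvariant_zero (h : ∃ v, N.demand v ≠ 0) (hε : 0 ≤ ε) {y : ℕ → ℝ}
    (hy : ∀ v, y (N.ident v) = if 0 < N.demand v then 1 else 0) : N.ScanInvariant ε 0 y := by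
  have hcomp : y ∘ N.ident = fun v => if 0 < N.demand v then 1 else 0 := funext hy
  rw [ScanInvariant, hcomp, pow_zero]
  exact ⟨isPotential_indicator,
    one_le_mul_of_one_le_of_one_le (by linarith) (one_le_dualValue_indicator h)⟩

namespace IsSetup

variable {S : Setup} {H : Clustering}

lemma two_mul_bits_lt (h : N.IsSetup c S) (hε : 0 < ε) :
    2 * (S.bits : ℝ) < S.iterations ε * (S.gap ε ^ 2 / 4) := by
  have hgap := h.gap_pos hε
  have hlt : 8 * S.bits / S.gap ε ^ 2 < S.iterations ε := by
    rw [Setup.iterations]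
    push_cast
    exact Nat.lt_floor_add_one _
  rw [div_lt_iff₀ (by positivity)] at hlt
  linarith

lemma isPotential_of_weightInvariant (h : N.IsSetup c S) (hε : 0 < ε) {g : ℝ}
    (hg : 0 < g) (hdemand : ∃ v, N.demand v ≠ 0) {Φ : ℕ → ℝ}
    (hI : N.WeightInvariant ε S g (S.iterations ε) Φ) :
    N.IsPotential ((fun a => g / S.dual Φ * Φ a) ∘ N.ident) ∧
      N.dualValue ((fun a => g / S.dual Φ * Φ a) ∘ N.ident) = g := by
  have hcomp : (fun a => g / S.dual Φ * Φ a) ∘ N.ident =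
      fun v => g / N.dualValue (Φ ∘ N.ident) * (Φ ∘ N.ident) v := by
    rw [← h.dual_eq]
    rfl
  rw [hcomp]
  refine isPotential_of_totalWeight_lt hg (half_pos (h.gap_pos hε)) (exists_adj hdemand)
    (lt_of_le_of_lt hI ?_)
  calc (Fintype.card V : ℝ) ^ 2 * Real.exp (S.shift ε g (S.iterations ε) Φ)
      ≤ Real.exp (2 * bitLength V) * Real.exp (S.shift ε g (S.iterations ε) Φ) :=
        mul_le_mul_of_nonneg_right cast_card_sq_le_exp (Real.exp_pos _).le
    _ = Real.exp (2 * S.bits + S.shift ε g (S.iterations ε) Φ) := by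
        rw [h.bits_eq, Real.exp_add]
    _ < Real.exp (S.gap ε / 2 * (N.dualValue (Φ ∘ N.ident) / g)) := by
        rw [Real.exp_lt_exp, Setup.shift, h.dual_eq, mul_div_assoc (S.gap ε / 2)]
        linarith [h.two_mul_bits_lt hε]

lemma meets_mwLoop (h : N.IsSetup c S) (hN : N.PolyBounded c) (hH : N.IsSparsifier H)
    (hε : 0 < ε) (hε1 : ε ≤ 1) (hn : 1 ≤ Fintype.card V * ε) (hdemand : ∃ v, N.demand v ≠ 0)
    {j : ℕ} {y : ℕ → ℝ} (hy : N.ScanInvariant ε j y) {β : ℕ}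
    (hβ : 2 * ((4 * c + 14) * bitLength V) + 1 ≤ β) :
    (S.mwLoop c ε H ((1 + ε / 3) ^ j) y).Meets N ε β (S.iterations ε * (4 * Fintype.card V))
      (Sum.elim (N.IsGood ε) (N.ScanInvariant ε (j + 1))) := by
  have hg : 1 ≤ (1 + ε / 3) ^ j := one_le_pow₀ (by linarith)
  rw [← Nat.add_zero (S.iterations ε * _)]
  refine BoardProgram.Meets.bind (BoardProgram.meets_iter (fun t => Sum.elim (N.IsGood ε)
    (N.WeightInvariant ε S ((1 + ε / 3) ^ j) t)) (weightInvariant_zero S _) ?_) ?_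
  · rintro t - (sol | Φ) hstate
    · exact hstate
    · exact h.meets_mwStep hN hH hε hε1 hn hg hstate hy.1 hy.2 hβ
  · rintro (sol | Φ) hstate
    · exact hstate
    · obtain ⟨hpotential, hdual⟩ :=
        h.isPotential_of_weightInvariant hε (by linarith) hdemand hstate
      refine ⟨hpotential, ?_⟩
      rw [hdual, pow_succ']

lemma two_pow_le_pow_scanLength (h : N.IsSetup c S) (hε : 0 < ε) :
    (2 : ℝ) ^ ((2 * c + 3) * bitLength V) ≤ (1 + ε / 3) ^ S.scanLength c ε := by
  rw [Setup.scanLength, pow_mul (1 + ε / 3), h.bits_eq]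
  refine pow_le_pow_left₀ zero_le_two ?_ _
  have hone : 1 ≤ (⌈3 / ε⌉₊ : ℝ) * (ε / 3) := by
    calc 1 = 3 / ε * (ε / 3) := by field_simp
      _ ≤ ⌈3 / ε⌉₊ * (ε / 3) := by
          gcongr
          exact Nat.le_ceil _
  linarith [one_add_mul_le_pow (show -2 ≤ ε / 3 by linarith) ⌈3 / ε⌉₊]

lemma not_scanInvariant_scanLength (h : N.IsSetup c S) (hN : N.PolyBounded c) (hε : 0 < ε)
    (hε1 : ε ≤ 1) {y : ℕ → ℝ} : ¬N.ScanInvariant ε (S.scanLength c ε) y := by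
  rintro ⟨hpotential, hguess⟩
  have htwo : (2 : ℝ) ≤ 2 ^ bitLength V := le_self_pow₀ one_le_two (by simp [bitLength])
  have : (2 : ℝ) ^ ((2 * c + 3) * bitLength V) < 2 ^ ((2 * c + 3) * bitLength V) := by
    calc (2 : ℝ) ^ ((2 * c + 3) * bitLength V)
        ≤ (1 + ε / 3) ^ S.scanLength c ε := h.two_pow_le_pow_scanLength hε
      _ ≤ (1 + ε / 3) * N.dualValue (y ∘ N.ident) := hguess
      _ ≤ (1 + ε / 3) * 2 ^ ((2 * c + 2) * bitLength V) := by
          gcongr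
          exact hN.dualValue_le hpotential
      _ < 2 ^ bitLength V * 2 ^ ((2 * c + 2) * bitLength V) := by
          gcongr
          linarith
      _ = 2 ^ ((2 * c + 3) * bitLength V) := by ring
  exact this.false

lemma meets_scan (h : N.IsSetup c S) (hN : N.PolyBounded c) (hH : N.IsSparsifier H)
    (hε : 0 < ε) (hε1 : ε ≤ 1) (hn : 1 ≤ Fintype.card V * ε) (hdemand : ∃ v, N.demand v ≠ 0)
    {β : ℕ} (hβ : 2 * ((4 * c + 14) * bitLength V) + 1 ≤ β) :
    (S.scan c ε H).Meets N ε β (S.scanLength c ε * (S.iterations ε * (4 * Fintype.card V)))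
      (N.IsGood ε) := by
  rw [← Nat.add_zero (S.scanLength c ε * _)]
  refine BoardProgram.Meets.bind (BoardProgram.meets_iter
    (fun j => Sum.elim (N.IsGood ε) (N.ScanInvariant ε j)) ?_ ?_) ?_
  · exact scanInvariant_zero hdemand hε.le fun v => by simp [h.demand_eq]
  · rintro j - (sol | y) hstate
    · exact hstate
    · exact h.meets_mwLoop hN hH hε hε1 hn hdemand hstate hβ
  · rintro (sol | y) hstate
    · exact hstate
    · exact absurd hstate (h.not_scanInvariant_scanLength hN hε hε1)

end IsSetup

/-! ### Counting rounds -/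

/-- The number of rounds of the algorithm, up to a constant factor. -/
def roundScale (N : Network V) (ε : ℝ) : ℝ :=
  N.asymmetry ^ 2 * ε⁻¹ ^ 3 * Fintype.card V * bitLength V ^ 4

lemma one_le_cast_bitLength : (1 : ℝ) ≤ bitLength V := by exact_mod_cast one_le_bitLength (V := V)

lemma card_mul_bitLength_pow_le_roundScale (hε : 0 < ε) (hε1 : ε ≤ 1) :
    (Fintype.card V : ℝ) * bitLength V ^ 4 ≤ N.roundScale ε := by
  have hasymmetry : 1 ≤ N.asymmetry ^ 2 := one_le_pow₀ one_le_asymmetry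
  have hinv : 1 ≤ ε⁻¹ ^ 3 := one_le_pow₀ ((one_le_inv₀ hε).2 hε1)
  calc (Fintype.card V : ℝ) * bitLength V ^ 4
      = 1 * 1 * Fintype.card V * bitLength V ^ 4 := by ring
    _ ≤ N.roundScale ε := by
        unfold roundScale
        gcongr

lemma card_le_roundScale (hε : 0 < ε) (hε1 : ε ≤ 1) : (Fintype.card V : ℝ) ≤ N.roundScale ε :=
  (le_mul_of_one_le_right (Nat.cast_nonneg _) (one_le_pow₀ one_le_cast_bitLength)).trans
    (card_mul_bitLength_pow_le_roundScale hε hε1)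

lemma card_mul_card_le_roundScale (hε : 0 < ε) (hε1 : ε ≤ 1) (hn : Fintype.card V * ε < 1) :
    (Fintype.card V : ℝ) * Fintype.card V ≤ N.roundScale ε := by
  have hinv : 1 ≤ ε⁻¹ := (one_le_inv₀ hε).2 hε1
  have hcard : (Fintype.card V : ℝ) ≤ ε⁻¹ ^ 3 := by
    rw [← lt_div_iff₀ hε, one_div] at hn
    exact hn.le.trans (le_self_pow₀ hinv (by norm_num))
  have hasymmetry : 1 ≤ N.asymmetry ^ 2 := one_le_pow₀ one_le_asymmetry
  have hbits : (1 : ℝ) ≤ bitLength V ^ 4 := one_le_pow₀ one_le_cast_bitLength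
  calc (Fintype.card V : ℝ) * Fintype.card V = 1 * Fintype.card V * Fintype.card V * 1 := by ring
    _ ≤ N.roundScale ε := by
        unfold roundScale
        gcongr

lemma gather_rounds_le (hε : 0 < ε) (hε1 : ε ≤ 1) (hn : Fintype.card V * ε < 1) :
    ((2 * (Fintype.card V * (Fintype.card V + 1)) : ℕ) : ℝ) ≤ 4 * N.roundScale ε := by
  push_cast
  linarith [card_mul_card_le_roundScale (N := N) hε hε1 hn, card_le_roundScale (N := N) hε hε1]

lemma sparsify_rounds_le (hε : 0 < ε) (hε1 : ε ≤ 1) :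
    ((bitLength V * (2 * (Fintype.card V * ((c * bitLength V + 1) * (bitLength V + 1) + 1))) : ℕ) :
      ℝ) ≤ (4 * c + 10) * N.roundScale ε := by
  have hbits := one_le_cast_bitLength (V := V)
  set L : ℝ := ((bitLength V : ℕ) : ℝ)
  have hquadratic : (c * L + 1) * (L + 1) + 1 ≤ (2 * c + 5) * L ^ 2 := by
    have hmul : c * L ≤ c * L ^ 2 := by
      gcongr
      exact le_self_pow₀ hbits two_ne_zero
    nlinarith
  push_cast
  calc L * (2 * (Fintype.card V * ((c * L + 1) * (L + 1) + 1)))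
      ≤ L * (2 * (Fintype.card V * ((2 * c + 5) * L ^ 2))) := by gcongr
    _ = (4 * c + 10) * (Fintype.card V * L ^ 3) := by ring
    _ ≤ (4 * c + 10) * (Fintype.card V * L ^ 4) := by
        gcongr
        norm_num
    _ ≤ (4 * c + 10) * N.roundScale ε := by
        gcongr
        exact card_mul_bitLength_pow_le_roundScale hε hε1

namespace IsSetup

variable {S : Setup}

lemma scanLength_le (h : N.IsSetup c S) (hε : 0 < ε) (hε1 : ε ≤ 1) :
    (S.scanLength c ε : ℝ) ≤ 4 * ε⁻¹ * ((2 * c + 3) * bitLength V) := by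
  have hinv : 1 ≤ ε⁻¹ := (one_le_inv₀ hε).2 hε1
  have hceil : (⌈3 / ε⌉₊ : ℝ) ≤ 4 * ε⁻¹ := by
    have hlt := Nat.ceil_lt_add_one (show 0 ≤ 3 / ε by positivity)
    rw [div_eq_mul_inv] at hlt ⊢
    linarith
  rw [Setup.scanLength, h.bits_eq]
  push_cast
  gcongr

lemma inv_gap_le (h : N.IsSetup c S) (hε : 0 < ε) (hratio : (S.ratio : ℝ) ≤ 2 * N.asymmetry) :
    (S.gap ε)⁻¹ ≤ 72 * N.asymmetry * bitLength V * ε⁻¹ := by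
  have hstretch : S.stretch ≤ 3 * bitLength V := by
    rw [h.stretch_eq]
    linarith [one_le_cast_bitLength (V := V)]
  have := S.one_le_stretch
  have := h.one_le_ratio_real
  have := one_le_asymmetry (N := N)
  calc (S.gap ε)⁻¹ = 12 * S.ratio * S.stretch * ε⁻¹ := by
        rw [Setup.gap]
        field_simp
        norm_num
    _ ≤ 12 * (2 * N.asymmetry) * (3 * bitLength V) * ε⁻¹ := by gcongr
    _ = 72 * N.asymmetry * bitLength V * ε⁻¹ := by ring

lemma iterations_le (h : N.IsSetup c S) (hε : 0 < ε) (hε1 : ε ≤ 1)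
    (hratio : (S.ratio : ℝ) ≤ 2 * N.asymmetry) :
    (S.iterations ε : ℝ) ≤ 41473 * (N.asymmetry ^ 2 * bitLength V ^ 3 * ε⁻¹ ^ 2) := by
  have hgap := h.gap_pos hε
  have hquotient : 8 * S.bits / S.gap ε ^ 2 ≤
      41472 * (N.asymmetry ^ 2 * bitLength V ^ 3 * ε⁻¹ ^ 2) := by
    rw [h.bits_eq, div_eq_mul_inv, ← inv_pow]
    calc 8 * bitLength V * (S.gap ε)⁻¹ ^ 2
        ≤ 8 * bitLength V * (72 * N.asymmetry * bitLength V * ε⁻¹) ^ 2 := by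
          gcongr
          exact h.inv_gap_le hε hratio
      _ = 41472 * (N.asymmetry ^ 2 * bitLength V ^ 3 * ε⁻¹ ^ 2) := by ring
  have hone : 1 ≤ N.asymmetry ^ 2 * bitLength V ^ 3 * ε⁻¹ ^ 2 :=
    one_le_mul_of_one_le_of_one_le (one_le_mul_of_one_le_of_one_le
      (one_le_pow₀ one_le_asymmetry) (one_le_pow₀ one_le_cast_bitLength))
      (one_le_pow₀ ((one_le_inv₀ hε).2 hε1))
  rw [Setup.iterations]
  push_cast
  linarith [Nat.floor_le (show 0 ≤ 8 * S.bits / S.gap ε ^ 2 by positivity)]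

lemma scan_rounds_le (h : N.IsSetup c S) (hε : 0 < ε) (hε1 : ε ≤ 1)
    (hratio : (S.ratio : ℝ) ≤ 2 * N.asymmetry) :
    ((S.scanLength c ε * (S.iterations ε * (4 * Fintype.card V)) : ℕ) : ℝ) ≤
      16 * (2 * c + 3) * 41473 * N.roundScale ε := by
  push_cast
  calc (S.scanLength c ε * (S.iterations ε * (4 * Fintype.card V)) : ℝ)
      ≤ 4 * ε⁻¹ * ((2 * c + 3) * bitLength V) *
          (41473 * (N.asymmetry ^ 2 * bitLength V ^ 3 * ε⁻¹ ^ 2) * (4 * Fintype.card V)) := by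
        gcongr
        · exact h.scanLength_le hε hε1
        · exact h.iterations_le hε hε1 hratio
    _ = 16 * (2 * c + 3) * 41473 * N.roundScale ε := by
        rw [roundScale]
        ring

lemma meets_solve (h : N.IsSetup c S) (hN : N.PolyBounded c) (hε : 0 < ε) (hε1 : ε ≤ 1)
    (hratio : (S.ratio : ℝ) ≤ 2 * N.asymmetry) {β : ℕ}
    (hβ : 2 * ((4 * c + 14) * bitLength V) + 1 ≤ β) :
    ∃ T : ℕ, (T : ℝ) ≤ (16 * (2 * c + 3) * 41473 + 4 * c + 10) * N.roundScale ε ∧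
      (S.solve c ε).Meets N ε β T (N.IsGood ε) := by
  have hscale : 0 ≤ N.roundScale ε := (Nat.cast_nonneg _).trans (card_le_roundScale hε hε1)
  have hβ' : 2 * ((c + 1) * bitLength V) + 1 ≤ β := by nlinarith
  have hzero : (∀ a ∈ S.ids, S.demand a = 0) ↔ ∀ v, N.demand v = 0 := by
    simp only [h.forall_mem_ids, h.demand_eq]
  simp only [Setup.solve, hzero, h.card_ids]
  split_ifs with hdemand hn
  · exact ⟨0, by rw [Nat.cast_zero]; positivity, fun _ _ => 0, isApproxPair_zero hdemand,
      fun _ _ _ => rfl⟩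
  · refine ⟨_, (gather_rounds_le (N := N) hε hε1 hn).trans ?_, h.meets_gather hN hε hβ'⟩
    gcongr
    linarith [c.cast_nonneg (α := ℝ)]
  · rw [not_lt] at hn
    have hsparsify := meets_sparsify (ε := ε) hN hβ'
    rw [← h.bits_eq, ← h.ids_eq] at hsparsify
    refine ⟨_, ?_, hsparsify.bind fun H hH =>
      h.meets_scan hN hH hε hε1 hn (not_forall.1 hdemand) hβ⟩
    rw [h.bits_eq, Nat.cast_add]
    linarith [sparsify_rounds_le (N := N) (c := c) hε hε1, h.scan_rounds_le hε hε1 hratio]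

end IsSetup

theorem meets_transshipment (hN : N.PolyBounded c) (hε : 0 < ε) (hε1 : ε ≤ 1) :
    ∃ T : ℕ, (T : ℝ) ≤ (16 * (2 * c + 3) * 41473 + 4 * c + 14) * N.roundScale ε ∧
      (transshipment c ε).Meets N ε ((8 * c + 30) * bitLength V) T fun a =>
        N.IsApproximation ε fun v => a (N.localInput ε v) := by
  have hbits := one_le_bitLength (V := V)
  have hsetup := isSetup_readSetup (ε := ε) hN
  obtain ⟨T, hT, hsolve⟩ := hsetup.meets_solve hN hε hε1 ratio_readSetup_le_asymmetry
    (β := (8 * c + 30) * bitLength V) (by nlinarith)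
  have hpost : ∀ v, ∀ a ∈ setupPost (N.localInput ε v),
      a + 1 < 2 ^ ((8 * c + 30) * bitLength V) := fun v a ha =>
    (add_one_lt_of_mem_setupPost hN ha).trans_le (Nat.pow_le_pow_right two_pos (by nlinarith))
  refine ⟨2 * (Fintype.card V * (1 + 1)) + (T + 0), ?_, BoardProgram.meets_ask hpost
    (fun v => (card_singleton _).le) (hsolve.bind fun sol hsol => hsetup.isApproximation hε hsol)⟩
  push_cast
  linarith [card_le_roundScale (N := N) hε hε1]

end Network

end Transshipment

end

theorem mainTheorem9_general :
    ∀ c : ℕ,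
      ∃ (alg : Transshipment.BroadcastAlgorithm Transshipment.NodeOutput) (B k : ℕ) (C : ℝ),
        ∀ (V : Type) [Fintype V] (N : Transshipment.Network V), N.PolyBounded c →
          ∀ ε : ℝ, 0 < ε → ε ≤ 1 →
            alg.MessagesBounded N ε (B * (Nat.log 2 (Fintype.card V) + 1)) ∧
            ∃ (T : ℕ) (out : V → Transshipment.NodeOutput),
              (T : ℝ) ≤ C * N.asymmetry ^ 2 * (ε⁻¹) ^ 3 * (Fintype.card V : ℝ) *
                ((Nat.log 2 (Fintype.card V) : ℝ) + 1) ^ k ∧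
              alg.ComputesWithin N ε T out ∧
              N.IsApproximation ε out := by
  intro c
  refine ⟨Transshipment.compile (Transshipment.transshipment c), 16 * c + 61, 4,
    16 * (2 * c + 3) * 41473 + 4 * c + 14, fun V _ N hN ε hε hε1 => ?_⟩
  have hbits := Transshipment.Network.one_le_bitLength (V := V)
  have hident : ∀ v, N.ident v < 2 ^ ((8 * c + 30) * Transshipment.Network.bitLength V) := fun v =>
    (hN.ident_lt v).trans_le (Nat.pow_le_pow_right two_pos (by gcongr <;> omega))
  obtain ⟨T, hT, hmeets⟩ := Transshipment.Network.meets_transshipment hN hε hε1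
  obtain ⟨hmessages, out, happrox, hcomputes⟩ := Transshipment.compile_spec hident hmeets
  refine ⟨fun t v => (hmessages t v).trans ?_, T, _, ?_, hcomputes, happrox⟩
  · change _ ≤ (16 * c + 61) * Transshipment.Network.bitLength V
    linarith
  · rw [Transshipment.Network.roundScale, Transshipment.Network.bitLength] at hT
    push_cast at hT
    linarith

theorem mainTheorem9 :
    ∀ c : ℕ,
      ∃ (alg : Transshipment.BroadcastAlgorithm Transshipment.NodeOutput) (B k : ℕ) (C : ℝ),
        ∀ (V : Type) [Fintype V] (N : Transshipment.Network V), N.PolyBounded c →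
          ∀ ε : ℝ, 0 < ε → ε ≤ 1 →
            alg.MessagesBounded N ε (B * (Nat.log 2 (Fintype.card V) + 1)) ∧
            ∃ (T : ℕ) (out : V → Transshipment.NodeOutput),
              (T : ℝ) ≤ C * N.asymmetry ^ 4 * (ε⁻¹) ^ 3 * (Fintype.card V : ℝ) *
                ((Nat.log 2 (Fintype.card V) : ℝ) + 1) ^ k ∧
              alg.ComputesWithin N ε T out ∧
              N.IsApproximation ε out := by
  intro c
  obtain ⟨alg, B, k, C, halg⟩ := mainTheorem9_general c
  refine ⟨alg, B, k, |C|, fun V _ N hN ε hε hε1 => ?_⟩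
  obtain ⟨hmessages, T, out, hT, hout⟩ := halg V N hN ε hε hε1
  have hasymmetry : C * N.asymmetry ^ 2 ≤ |C| * N.asymmetry ^ 4 :=
    mul_le_mul (le_abs_self C)
      (pow_le_pow_right₀ Transshipment.Network.one_le_asymmetry (by norm_num))
      (sq_nonneg _) (abs_nonneg C)
  exact ⟨hmessages, T, out, hT.trans (by gcongr), hout⟩
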